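/- **Setting.** Let $T>0$, $c>0$, $M\ge 1$. There are $M$ consumer types with demand functions $d_m$ on the price domain $[0,p_\infty]$ such that, for constants $M_1,\dots,M_4$ with $M_3>0$: $d_m$ is nonnegative, strictly decreasing and bounded by $M_1$; $d_m$, $d_m^{-1}$ and $r_m(\lambda)=\lambda d_m^{-1}(\lambda)$ are Lipschitz with constant $M_2$; $r_m$ is twice differentiable with $M_3\le -r_m''\le M_4$. (Outside $[0,p_\infty]$, $d_m$ is extended arbitrarily with values in $[0,M_1]$.) Let $\mathcal P_m(z)$ be the maximizer and $\mathcal R_m(z)$ the maximum of $d_m(p)(p-z)$ over $p\in[0,p_\infty]$, let $g(z)=cz+T\sum_m\mathcal R_m(z)$, let $z^*$ minimize $g$ over $[0,\infty)$ and $p_m^*=\mathcal P_m(z^*)$. The firm knows $M,T,c,n$ and $\underline p,\overline p,\overline z$ with $[\underline p,\overline p]\subset[0,p_\infty]$, $p_m^*\in(\underline p,\overline p)$, $z^*<\overline z$ and $\mathcal P_m(z)\in[\underline p,\overline p]$ for all $z\in[0,\overline z]$ and all $m$. In the $n$-th system the inventory is $nc$ and type-$m$ sales form a Poisson process with instantaneous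 rate $n\,d_m(P_m(t))$ (independent Poisson noise across types), where $P_m(t)$ is the price charged. Let $S(t)$ be the aggregate sales up to time $t$. The fluid value is $$J_n^D=\sup\Big\{\sum_m\int_0^T p_m(t)\,n d_m(p_m(t))\,dt:\ \sum_m\int_0^T n d_m(p_m(t))\,dt\le nc,\ p_m(t)\in[0,p_\infty]\Big\}.$$ **Algorithm.** Let $\epsilon>0$ and $q_k=(3/5)^{k-1}$, and put $\alpha=(\log n)^{1+9\epsilon}n^{-1/4}$, $\tau^{(k)}=n^{-q_k/2}(\log n)^{1+15\epsilon}$, $\bar\Delta^{(k)}=n^{-(1-q_k)/4}$, $\bar\Delta_z^{(k)}=\bar\Delta^{(k)}(\log n)^{-2\epsilon}$, $N^{(k)}=\lceil n^{q_k/10}(\log n)^{3\epsilon}\rceil$, $N_z^{(k)}=\lceil n^{q_k/10}(\log n)^{\epsilon}\rceil$ for $k\ge2$, $N_z^{(1)}=\lceil n^{1/10}(\log n)^{3\epsilon}\rceil$, $K=\min\{k\ge 1:(\bar\Delta^{(k)})^2\le n^{-1/2}(\log n)^{2+16\epsilon}\}$ and $t_k=\sum_{i<k}\tau^{(i)}$.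 Start with the intervals $[\underline p_m^{(1)},\overline p_m^{(1)}]=[\underline p,\overline p]$ and $[\underline z^{(1)},\overline z^{(1)}]=[0,\overline z]$. In phase $k=1,\dots,K-1$, starting at $t_k$, charge type $m$ each grid price $p_{m,i}^{(k)}=\underline p_m^{(k)}+i(\overline p_m^{(k)}-\underline p_m^{(k)})/(N^{(k)}+1)$, $i=0,\dots,N^{(k)}$, in turn, for a time $\tau^{(k)}/(N^{(k)}+1)$ each. If $D_{m,i}^{(k)}$ is the number of the resulting sales, put $\hat d_{m,i}^{(k)}=\frac{N^{(k)}+1}{n\tau^{(k)}}D_{m,i}^{(k)}$. Let $z^{(k)*}$ minimize $cz+T\sum_m\max_i\hat d_{m,i}^{(k)}(p_{m,i}^{(k)}-z)$ over the points $\underline z^{(k)}+i(\overline z^{(k)}-\underline z^{(k)})/(N_z^{(k)}+1)$, $0\le i\le N_z^{(k)}$, and let $p_m^{(k)*}$ be a grid price that maximizes $\hat d_{m,i}^{(k)}(p_{m,i}^{(k)}-z^{(k)*})$ (ties are broken by any fixed rule). The next intervals are $[p_m^{(k)*}-\bar\Delta^{(k+1)}/2,\,p_m^{(k)*}+\bar\Delta^{(k+1)}/2]\cap[\underline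 p,\overline p]$ and $[z^{(k)*}-\bar\Delta_z^{(k+1)}/2,\,z^{(k)*}+\bar\Delta_z^{(k+1)}/2]\cap[0,\overline z]$. In phase $K$, if $0\in[\underline z^{(K)},\overline z^{(K)}]$, charge $\overline p_m^{(K)}+\alpha$ until $T$. Otherwise let $p_m^l=\underline p_m^{(K)}-\alpha$, $p_m^u=\overline p_m^{(K)}+\alpha$ and $h=(\log n)^{-\epsilon}$. Charge $p_m^l$ during $(t_K,t_K+h]$ and $p_m^u$ during $(t_K+h,t_K+2h]$, and let $D_l,D_u$ be the aggregate numbers of sales in these two periods divided by $h$. Let $\theta$ be the projection to $[0,1]$ of the solution of $(T-t_K)(\theta D_l+(1-\theta)D_u)=nc-S(t_K)$. Charge $p_m^l$ from $t_K+2h$ until $t_K+\theta(T-t_K)+h$ (this time being projected to $[t_K+2h,T]$), and $p_m^u$ afterwards until $T$. **Values.** Let $J_n^\pi$ be the expected revenue of the algorithm when demand is turned off as soon as the inventory $nc$ is depleted. Let $\tilde J_n^\pi=\mathbb E\big[\sum_m\int_0^TP_m\,dN_m\big]-\overline p\,\mathbb E[(S(T)-nc)^+]$, where $N_m$ counts type-$m$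 sales, be its expected revenue when instead the excess demand is outsourced at unit cost $\overline p$. Let $R_n^\pi=1-J_n^\pi/J_n^D$. **Proposition.** If $z^*>0$ (insufficient capacity), then for every $\epsilon>0$, as $n\to\infty$, $$J_n^D-\tilde J_n^\pi=O\big((\log n)^{2+18\epsilon}n^{1/2}\big)\qquad\text{and}\qquad R_n^\pi=O\big((\log n)^{2+18\epsilon}n^{-1/2}\big),$$ where the implied constants do not depend on $n$. -/

import Mathlib

open MeasureTheory ProbabilityTheory Set Filter Asymptotics
open scoped ENNReal NNReal

noncomputable section

namespace PersonalizedPricing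

/-! ### The market: demand, fluid benchmark, dual problem -/

/-- The set of demand rates attainable for type `m` with prices in `[0, pInf]`. -/
def demandRange {M : ℕ} (d : Fin M → ℝ → ℝ) (pInf : ℝ) (m : Fin M) : Set ℝ :=
  d m '' Icc 0 pInf

/-- The inverse demand function of type `m` on the price domain `[0, pInf]`. -/
def invDemand {M : ℕ} (d : Fin M → ℝ → ℝ) (pInf : ℝ) (m : Fin M) : ℝ → ℝ :=
  Function.invFunOn (d m) (Icc 0 pInf)

/-- The revenue rate as a function of the demand rate, `r_m(x) = x * d_m⁻¹(x)`. -/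
def revenueRate {M : ℕ} (d : Fin M → ℝ → ℝ) (pInf : ℝ) (m : Fin M) (x : ℝ) : ℝ :=
  x * invDemand d pInf m x

/-- The standing regularity assumption on the demand functions. The price domain is `[0, pInf]`.
Outside of the price domain a demand function is only required to be a rate in `[0, M₁]`
(its values there are otherwise arbitrary). -/
structure RegularDemand {M : ℕ} (d : Fin M → ℝ → ℝ) (pInf M₁ : ℝ) (M₂ : ℝ≥0) (M₃ M₄ : ℝ) :
    Prop where
  nonneg : ∀ m p, 0 ≤ d m p
  bounded : ∀ m p, d m p ≤ M₁
  strictAnti : ∀ m, StrictAntiOn (d m) (Icc 0 pInf)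
  lipschitz_demand : ∀ m, LipschitzOnWith M₂ (d m) (Icc 0 pInf)
  lipschitz_inv : ∀ m, LipschitzOnWith M₂ (invDemand d pInf m) (demandRange d pInf m)
  lipschitz_revenue : ∀ m, LipschitzOnWith M₂ (revenueRate d pInf m) (demandRange d pInf m)
  differentiable : ∀ m, ∀ x ∈ interior (demandRange d pInf m),
    DifferentiableAt ℝ (revenueRate d pInf m) x
  differentiable_deriv : ∀ m, ∀ x ∈ interior (demandRange d pInf m),
    DifferentiableAt ℝ (deriv (revenueRate d pInf m)) x
  pos : 0 < M₃
  concave_lower : ∀ m, ∀ x ∈ interior (demandRange d pInf m),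
    M₃ ≤ -deriv (deriv (revenueRate d pInf m)) x
  concave_upper : ∀ m, ∀ x ∈ interior (demandRange d pInf m),
    -deriv (deriv (revenueRate d pInf m)) x ≤ M₄

/-- The value `J^D(T, c)` of the fluid problem: maximize the revenue over all (measurable,
time-dependent) price paths in the price domain, subject to the inventory constraint. -/
def fluidValue {M : ℕ} (d : Fin M → ℝ → ℝ) (pInf T c : ℝ) : ℝ :=
  sSup {v : ℝ | ∃ p : Fin M → ℝ → ℝ,
    (∀ m, Measurable (p m)) ∧ (∀ m t, p m t ∈ Icc 0 pInf) ∧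
    (∑ m, ∫ t in (0 : ℝ)..T, d m (p m t)) ≤ c ∧
    v = ∑ m, ∫ t in (0 : ℝ)..T, p m t * d m (p m t)}

/-- The fluid value `J_n^D(T, c)` of the `n`-th system: demand and capacity are scaled by `n`. -/
def scaledFluidValue {M : ℕ} (d : Fin M → ℝ → ℝ) (pInf T c : ℝ) (n : ℕ) : ℝ :=
  fluidValue (fun m p => n * d m p) pInf T (n * c)

/-- `R_m(z) = max_p d_m(p) (p - z)` over the price domain. -/
def maxProfit {M : ℕ} (d : Fin M → ℝ → ℝ) (pInf : ℝ) (m : Fin M) (z : ℝ) : ℝ :=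
  sSup ((fun p => d m p * (p - z)) '' Icc 0 pInf)

/-- The set of maximizers of `d_m(p) (p - z)` over the price domain. Under `RegularDemand` it has
exactly one element, `P_m(z)`. -/
def optimalPrices {M : ℕ} (d : Fin M → ℝ → ℝ) (pInf : ℝ) (m : Fin M) (z : ℝ) : Set ℝ :=
  {p | p ∈ Icc 0 pInf ∧ IsMaxOn (fun p => d m p * (p - z)) (Icc 0 pInf) p}

/-- The dual function `g(z) = c z + T ∑ R_m(z)`. -/
def dualFunction {M : ℕ} (d : Fin M → ℝ → ℝ) (pInf T c z : ℝ) : ℝ :=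
  c * z + T * ∑ m, maxProfit d pInf m z

/-- `z` minimizes the dual function over `[0, ∞)`. -/
def IsDualOptimal {M : ℕ} (d : Fin M → ℝ → ℝ) (pInf T c z : ℝ) : Prop :=
  z ∈ Ici (0 : ℝ) ∧ IsMinOn (dualFunction d pInf T c) (Ici 0) z

/-! ### What the firm knows -/

/-- The quantities known to the firm: season length `T`, (unscaled) inventory `c`,
the range `[pLo, pHi]` of prices and the range `[0, zHi]` of dual variables. -/
structure FirmInfo where
  T : ℝ
  c : ℝ
  pLo : ℝ
  pHi : ℝ
  zHi : ℝ

/-- The assumption on the initial ranges: `[pLo, pHi]` lies in the price domain,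
`p_m^* = P_m(z^*)` is in `(pLo, pHi)`, `z^*` is in `[0, zHi)`,
and `P_m(z)` is in `[pLo, pHi]` for every `z` in `[0, zHi]`. -/
structure InitialRanges {M : ℕ} (F : FirmInfo) (d : Fin M → ℝ → ℝ) (pInf zStar : ℝ) : Prop where
  price_domain : Icc F.pLo F.pHi ⊆ Icc 0 pInf
  optimal_price : ∀ m, optimalPrices d pInf m zStar ⊆ Ioo F.pLo F.pHi
  optimal_dual : zStar ∈ Ico 0 F.zHi
  price_range : ∀ m, ∀ z ∈ Icc 0 F.zHi, optimalPrices d pInf m z ⊆ Icc F.pLo F.pHi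

/-! ### Parameters of the algorithm

Phases are indexed from `0`: index `j` is the `(j + 1)`-st phase. -/

/-- The markup `α`. -/
def alpha (n : ℕ) (ε : ℝ) : ℝ :=
  Real.log n ^ (1 + 9 * ε) * (n : ℝ) ^ (-(1 / 4) : ℝ)

/-- The length of exploration phase `j`. -/
def tau (n : ℕ) (ε : ℝ) (j : ℕ) : ℝ :=
  (n : ℝ) ^ (-(1 / 2) * (3 / 5) ^ j : ℝ) * Real.log n ^ (1 + 15 * ε)

/-- The width (before truncation) of the price intervals of phase `j`. -/
def width (n : ℕ) (j : ℕ) : ℝ :=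
  (n : ℝ) ^ (-(1 / 4) * (1 - (3 / 5) ^ j) : ℝ)

/-- The width (before truncation) of the dual interval of phase `j`. -/
def widthZ (n : ℕ) (ε : ℝ) (j : ℕ) : ℝ :=
  width n j * Real.log n ^ (-2 * ε)

/-- There are `gridN n ε j + 1` grid prices in phase `j`. -/
def gridN (n : ℕ) (ε : ℝ) (j : ℕ) : ℕ :=
  ⌈(n : ℝ) ^ ((1 / 10) * (3 / 5) ^ j : ℝ) * Real.log n ^ (3 * ε)⌉₊

/-- There are `gridZ n ε j + 1` dual grid points in phase `j`. In the first phase the interval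
`[0, zHi]` has constant length, and the exponent of the logarithm is `3 ε` so that the resolution
is of the same order as in the other phases. -/
def gridZ (n : ℕ) (ε : ℝ) (j : ℕ) : ℕ :=
  if j = 0 then ⌈(n : ℝ) ^ (1 / 10 : ℝ) * Real.log n ^ (3 * ε)⌉₊
  else ⌈(n : ℝ) ^ ((1 / 10) * (3 / 5) ^ j : ℝ) * Real.log n ^ ε⌉₊

/-- The number `K - 1` of exploration phases, which is also the index of the last phase. -/
def numExplore (n : ℕ) (ε : ℝ) : ℕ :=
  sInf {j : ℕ | width n j ^ 2 ≤ (n : ℝ) ^ (-(1 / 2) : ℝ) * Real.log n ^ (2 + 16 * ε)}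

/-- The time at which phase `j` begins. -/
def phaseStart (n : ℕ) (ε : ℝ) (j : ℕ) : ℝ :=
  ∑ i ∈ Finset.range j, tau n ε i

/-- The time at which the `i`-th grid price of exploration phase `j` starts to be charged. -/
def slotTime (n : ℕ) (ε : ℝ) (j i : ℕ) : ℝ :=
  phaseStart n ε j + i * (tau n ε j / (gridN n ε j + 1))

/-! ### The primal-dual learning algorithm

The algorithm sees the market only through `obs`: `obs m a b p` is the number of sales to type-`m`
consumers during `(a, b]` when the price `p` is charged to them during `(a, b]`.
The map `sel` breaks ties: it selects an element of the set of optimal indices. -/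

/-- The interval estimators at the beginning of a phase. -/
structure PhaseState (M : ℕ) where
  pl : Fin M → ℝ
  pu : Fin M → ℝ
  zl : ℝ
  zu : ℝ

open Classical in
/-- A minimizer of `f` over `{0, …, N}`. -/
def minIdx (sel : Finset ℕ → ℕ) (N : ℕ) (f : ℕ → ℝ) : ℕ :=
  sel ((Finset.range (N + 1)).filter fun i => ∀ j ∈ Finset.range (N + 1), f i ≤ f j)

/-- A maximizer of `f` over `{0, …, N}`. -/
def maxIdx (sel : Finset ℕ → ℕ) (N : ℕ) (f : ℕ → ℝ) : ℕ :=
  minIdx sel N fun i => -f i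

variable {M : ℕ}

/-- The `i`-th grid price for type `m` in exploration phase `j`. -/
def gridPrice (n : ℕ) (ε : ℝ) (j : ℕ) (s : PhaseState M) (m : Fin M) (i : ℕ) : ℝ :=
  s.pl m + i * ((s.pu m - s.pl m) / (gridN n ε j + 1))

/-- The observed sales to type `m` at the `i`-th grid price in exploration phase `j`. -/
def slotSales (n : ℕ) (ε : ℝ) (obs : Fin M → ℝ → ℝ → ℝ → ℝ) (j : ℕ) (s : PhaseState M)
    (m : Fin M) (i : ℕ) : ℝ :=
  obs m (slotTime n ε j i) (slotTime n ε j (i + 1)) (gridPrice n ε j s m i)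

/-- The empirical estimate of `d_m` at the `i`-th grid price. -/
def demandEst (n : ℕ) (ε : ℝ) (obs : Fin M → ℝ → ℝ → ℝ → ℝ) (j : ℕ) (s : PhaseState M)
    (m : Fin M) (i : ℕ) : ℝ :=
  (gridN n ε j + 1) / (n * tau n ε j) * slotSales n ε obs j s m i

/-- The empirical profit of type `m` at the `i`-th grid price and unit cost `z`. -/
def profitEst (n : ℕ) (ε : ℝ) (obs : Fin M → ℝ → ℝ → ℝ → ℝ) (j : ℕ) (s : PhaseState M)
    (m : Fin M) (z : ℝ) (i : ℕ) : ℝ :=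
  demandEst n ε obs j s m i * (gridPrice n ε j s m i - z)

/-- The empirical dual function. -/
def dualEst (F : FirmInfo) (n : ℕ) (ε : ℝ) (obs : Fin M → ℝ → ℝ → ℝ → ℝ) (j : ℕ)
    (s : PhaseState M) (z : ℝ) : ℝ :=
  F.c * z + F.T * ∑ m, (Finset.range (gridN n ε j + 1)).sup' Finset.nonempty_range_add_one
    (profitEst n ε obs j s m z)

/-- The `i`-th dual grid point in exploration phase `j`. -/
def gridDual (n : ℕ) (ε : ℝ) (j : ℕ) (s : PhaseState M) (i : ℕ) : ℝ :=
  s.zl + i * ((s.zu - s.zl) / (gridZ n ε j + 1))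

/-- The point estimator of `z^*` at the end of exploration phase `j`. -/
def zEst (F : FirmInfo) (sel : Finset ℕ → ℕ) (n : ℕ) (ε : ℝ) (obs : Fin M → ℝ → ℝ → ℝ → ℝ)
    (j : ℕ) (s : PhaseState M) : ℝ :=
  gridDual n ε j s (minIdx sel (gridZ n ε j) fun i => dualEst F n ε obs j s (gridDual n ε j s i))

/-- The point estimator of `p_m^*` at the end of exploration phase `j`. -/
def pEst (F : FirmInfo) (sel : Finset ℕ → ℕ) (n : ℕ) (ε : ℝ) (obs : Fin M → ℝ → ℝ → ℝ → ℝ)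
    (j : ℕ) (s : PhaseState M) (m : Fin M) : ℝ :=
  gridPrice n ε j s m
    (maxIdx sel (gridN n ε j) (profitEst n ε obs j s m (zEst F sel n ε obs j s)))

/-- The interval estimators at the beginning of phase `j`. -/
def phaseState (F : FirmInfo) (sel : Finset ℕ → ℕ) (n : ℕ) (ε : ℝ)
    (obs : Fin M → ℝ → ℝ → ℝ → ℝ) : ℕ → PhaseState M
  | 0 => { pl := fun _ => F.pLo, pu := fun _ => F.pHi, zl := 0, zu := F.zHi }
  | j + 1 =>
    let s := phaseState F sel n ε obs j
    { pl := fun m => max F.pLo (pEst F sel n ε obs j s m - width n (j + 1) / 2)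
      pu := fun m => min F.pHi (pEst F sel n ε obs j s m + width n (j + 1) / 2)
      zl := max 0 (zEst F sel n ε obs j s - widthZ n ε (j + 1) / 2)
      zu := min F.zHi (zEst F sel n ε obs j s + widthZ n ε (j + 1) / 2) }

/-- The beginning `t_K` of the last phase. -/
def lastStart (n : ℕ) (ε : ℝ) : ℝ := phaseStart n ε (numExplore n ε)

/-- The interval estimators at the beginning of the last phase. -/
def lastState (F : FirmInfo) (sel : Finset ℕ → ℕ) (n : ℕ) (ε : ℝ)
    (obs : Fin M → ℝ → ℝ → ℝ → ℝ) : PhaseState M :=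
  phaseState F sel n ε obs (numExplore n ε)

/-- The aggregate sales in all the exploration phases. -/
def exploreSales (F : FirmInfo) (sel : Finset ℕ → ℕ) (n : ℕ) (ε : ℝ)
    (obs : Fin M → ℝ → ℝ → ℝ → ℝ) : ℝ :=
  ∑ j ∈ Finset.range (numExplore n ε), ∑ i ∈ Finset.range (gridN n ε j + 1), ∑ m,
    slotSales n ε obs j (phaseState F sel n ε obs j) m i

/-- The conservative lower price `p_m^l` of the last phase. -/
def lowPrice (F : FirmInfo) (sel : Finset ℕ → ℕ) (n : ℕ) (ε : ℝ)
    (obs : Fin M → ℝ → ℝ → ℝ → ℝ) (m : Fin M) : ℝ :=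
  (lastState F sel n ε obs).pl m - alpha n ε

/-- The conservative upper price `p_m^u` of the last phase. -/
def highPrice (F : FirmInfo) (sel : Finset ℕ → ℕ) (n : ℕ) (ε : ℝ)
    (obs : Fin M → ℝ → ℝ → ℝ → ℝ) (m : Fin M) : ℝ :=
  (lastState F sel n ε obs).pu m + alpha n ε

/-- The length of each of the two tests in the last phase. -/
def testLength (n : ℕ) (ε : ℝ) : ℝ := Real.log n ^ (-ε)

/-- The observed aggregate sales rate at the lower prices. -/
def rateLow (F : FirmInfo) (sel : Finset ℕ → ℕ) (n : ℕ) (ε : ℝ)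
    (obs : Fin M → ℝ → ℝ → ℝ → ℝ) : ℝ :=
  Real.log n ^ ε * ∑ m, obs m (lastStart n ε) (lastStart n ε + testLength n ε)
    (lowPrice F sel n ε obs m)

/-- The observed aggregate sales rate at the upper prices. -/
def rateHigh (F : FirmInfo) (sel : Finset ℕ → ℕ) (n : ℕ) (ε : ℝ)
    (obs : Fin M → ℝ → ℝ → ℝ → ℝ) : ℝ :=
  Real.log n ^ ε * ∑ m, obs m (lastStart n ε + testLength n ε)
    (lastStart n ε + 2 * testLength n ε) (highPrice F sel n ε obs m)

/-- The projection to `[0, 1]` of the solution `θ` of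
`(T - t_K) (θ D_l + (1 - θ) D_u) = n c - S(t_K)`. -/
def theta (F : FirmInfo) (sel : Finset ℕ → ℕ) (n : ℕ) (ε : ℝ)
    (obs : Fin M → ℝ → ℝ → ℝ → ℝ) : ℝ :=
  max 0 (min 1
    ((n * F.c - exploreSales F sel n ε obs - (F.T - lastStart n ε) * rateHigh F sel n ε obs) /
      ((F.T - lastStart n ε) * (rateLow F sel n ε obs - rateHigh F sel n ε obs))))

/-- The time of the last switch from the lower to the upper prices. -/
def switchTime (F : FirmInfo) (sel : Finset ℕ → ℕ) (n : ℕ) (ε : ℝ)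
    (obs : Fin M → ℝ → ℝ → ℝ → ℝ) : ℝ :=
  max (lastStart n ε + 2 * testLength n ε)
    (min F.T (lastStart n ε + theta F sel n ε obs * (F.T - lastStart n ε) + testLength n ε))

/-- The price charged to type `m` at time `t` of the last phase (and `0` at all other times). -/
def lastPrice (F : FirmInfo) (sel : Finset ℕ → ℕ) (n : ℕ) (ε : ℝ)
    (obs : Fin M → ℝ → ℝ → ℝ → ℝ) (m : Fin M) (t : ℝ) : ℝ :=
  let tK := lastStart n ε
  let h := testLength n ε
  let pl := lowPrice F sel n ε obs m
  let pu := highPrice F sel n ε obs m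
  let sw := switchTime F sel n ε obs
  open Classical in
  if 0 ∈ Icc (lastState F sel n ε obs).zl (lastState F sel n ε obs).zu then
    (Ioc tK F.T).indicator (fun _ => pu) t
  else
    (Ioc tK (tK + h)).indicator (fun _ => pl) t
      + (Ioc (tK + h) (tK + 2 * h)).indicator (fun _ => pu) t
      + (Ioc (tK + 2 * h) sw).indicator (fun _ => pl) t
      + (Ioc sw F.T).indicator (fun _ => pu) t

/-- The price `P_m(t)` charged by the algorithm to type `m` at time `t ∈ (0, T]`, as a function of
the observed sales. -/
def policyPrice (F : FirmInfo) (sel : Finset ℕ → ℕ) (n : ℕ) (ε : ℝ)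
    (obs : Fin M → ℝ → ℝ → ℝ → ℝ) (m : Fin M) (t : ℝ) : ℝ :=
  (∑ j ∈ Finset.range (numExplore n ε), ∑ i ∈ Finset.range (gridN n ε j + 1),
    (Ioc (slotTime n ε j i) (slotTime n ε j (i + 1))).indicator
      (fun _ => gridPrice n ε j (phaseState F sel n ε obs j) m i) t)
    + lastPrice F sel n ε obs m t

/-! ### The stochastic system

The randomness is a Poisson random measure with unit intensity on points `(m, t, u)`:
type, time, mark. The point `(m, t, u)` is a sale to type `m` at time `t` if and only if
`0 < u ≤ n d_m(P_m(t))`, so that type-`m` sales form a Poisson process with instantaneous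
rate `n d_m(P_m(t))`. -/

/-- `N` is a Poisson random measure with intensity measure `μ`. -/
structure IsPoissonRandomMeasure {Ω E : Type*} [MeasurableSpace Ω] [MeasurableSpace E]
    (P : Measure Ω) (μ : Measure E) (N : Ω → Measure E) : Prop where
  measurable : Measurable N
  poisson : ∀ A : Set E, MeasurableSet A → μ A ≠ ∞ →
    P.map (fun ω => N ω A) = (poissonMeasure (μ A).toNNReal).map (fun k : ℕ => (k : ℝ≥0∞))
  indep : ∀ (r : ℕ) (A : Fin r → Set E), (∀ i, MeasurableSet (A i)) →
    Pairwise (Function.onFun Disjoint A) → iIndepFun (fun i ω => N ω (A i)) P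

/-- The unit intensity on types, times and marks. -/
def unitIntensity (M : ℕ) : Measure (Fin M × ℝ × ℝ) :=
  Measure.count.prod (volume.prod volume)

/-- The observed number of type-`m` sales during `(a, b]` at the price `p` in the `n`-th system,
when `ν` is the realization of the Poisson random measure. -/
def observe (d : Fin M → ℝ → ℝ) (n : ℕ) (ν : Measure (Fin M × ℝ × ℝ))
    (m : Fin M) (a b p : ℝ) : ℝ :=
  (ν ({m} ×ˢ (Ioc a b ×ˢ Ioc 0 (n * d m p)))).toReal

/-- The price path of the algorithm in the `n`-th system under the realization `ν`. -/
def pricePath (F : FirmInfo) (d : Fin M → ℝ → ℝ) (sel : Finset ℕ → ℕ) (n : ℕ) (ε : ℝ)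
    (ν : Measure (Fin M × ℝ × ℝ)) (m : Fin M) (t : ℝ) : ℝ :=
  policyPrice F sel n ε (observe d n ν) m t

/-- The sales during `(0, t]`, as a set of points `(type, time, mark)`. -/
def saleSet (F : FirmInfo) (d : Fin M → ℝ → ℝ) (sel : Finset ℕ → ℕ) (n : ℕ) (ε : ℝ)
    (ν : Measure (Fin M × ℝ × ℝ)) (t : ℝ) : Set (Fin M × ℝ × ℝ) :=
  {x | x.2.1 ∈ Ioc 0 t ∧ x.2.2 ∈ Ioc 0 (n * d x.1 (pricePath F d sel n ε ν x.1 x.2.1))}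

/-- The cumulative aggregate sales `S(t)`. -/
def cumSales (F : FirmInfo) (d : Fin M → ℝ → ℝ) (sel : Finset ℕ → ℕ) (n : ℕ) (ε : ℝ)
    (ν : Measure (Fin M × ℝ × ℝ)) (t : ℝ) : ℝ :=
  (ν (saleSet F d sel n ε ν t)).toReal

/-- The total sales revenue `∑_m ∫ P_m(t) dN_m(t)` over `(0, T]`, ignoring the inventory. -/
def grossRevenue (F : FirmInfo) (d : Fin M → ℝ → ℝ) (sel : Finset ℕ → ℕ) (n : ℕ) (ε : ℝ)
    (ν : Measure (Fin M × ℝ × ℝ)) : ℝ :=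
  ∫ x in saleSet F d sel n ε ν F.T, pricePath F d sel n ε ν x.1 x.2.1 ∂ν

/-- The revenue with the inventory constraint: only the sales that the initial inventory `n c`
covers take place, and demand is turned off once the inventory is depleted. -/
def constrainedRevenue (F : FirmInfo) (d : Fin M → ℝ → ℝ) (sel : Finset ℕ → ℕ) (n : ℕ) (ε : ℝ)
    (ν : Measure (Fin M × ℝ × ℝ)) : ℝ :=
  ∫ x in saleSet F d sel n ε ν F.T ∩ {x | cumSales F d sel n ε ν x.2.1 ≤ n * F.c},
    pricePath F d sel n ε ν x.1 x.2.1 ∂ν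

variable {Ω : Type*} [MeasurableSpace Ω]

/-- The expected revenue of the modified system, in which demand in excess of the inventory is
outsourced at the unit cost `pHi`. -/
def modifiedValue (F : FirmInfo) (d : Fin M → ℝ → ℝ) (sel : Finset ℕ → ℕ) (ε : ℝ)
    (P : Measure Ω) (N : Ω → Measure (Fin M × ℝ × ℝ)) (n : ℕ) : ℝ :=
  (∫ ω, grossRevenue F d sel n ε (N ω) ∂P)
    - F.pHi * ∫ ω, max (cumSales F d sel n ε (N ω) F.T - n * F.c) 0 ∂P

/-- The expected revenue `J_n^π(T, c)` of the algorithm in the `n`-th system. -/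
def policyValue (F : FirmInfo) (d : Fin M → ℝ → ℝ) (sel : Finset ℕ → ℕ) (ε : ℝ)
    (P : Measure Ω) (N : Ω → Measure (Fin M × ℝ × ℝ)) (n : ℕ) : ℝ :=
  ∫ ω, constrainedRevenue F d sel n ε (N ω) ∂P

/-- The regret `R_n^π(T, c) = 1 - J_n^π(T, c) / J_n^D(T, c)`. -/
def regret (F : FirmInfo) (d : Fin M → ℝ → ℝ) (pInf : ℝ) (sel : Finset ℕ → ℕ) (ε : ℝ)
    (P : Measure Ω) (N : Ω → Measure (Fin M × ℝ × ℝ)) (n : ℕ) : ℝ :=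
  1 - policyValue F d sel ε P N n / scaledFluidValue d pInf F.T F.c n

end PersonalizedPricing

end

namespace PersonalizedPricing

/-! ### Quadratic behaviour of the Lagrangian at the optimal prices -/

/-! Write each price as `(p - z*) + z*`: revenue is Lagrangian revenue plus `z*` times the number of
sales. Since `p_m*` maximizes `d_m(p) (p - z*)`, charging a price at distance `r` from it loses only
`O(r²)` of Lagrangian revenue. Since `z* > 0` is an interior minimizer of the dual, the first-order
condition says `c = T ∑ d_m(p_m*)`. Hence revenue is within the claimed order of the fluid value
once (i) the accumulated `n · r²` is of that order and (ii) total sales equal `n c` up to that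
order. `exists_marketBounds` extracts the quadratic and Lipschitz bounds and the slackness identity
from the assumptions; everything later uses only these. `MarketBounds.scaledFluidValue_eq` computes
the benchmark by weak duality.

(i) Learning. Let `g = (log n)^ε` and let `ρ` be the next interval width divided by `g³`. The phase
lengths and grids are tuned so that demand is estimated with error `O(ρ²)` on grids of spacing
`O(ρ)`. The empirical dual lies between two parabolas around `z*` up to `O(ρ²)`
(`PhaseHyp.le_dualEst`, `PhaseHyp.dualEst_le`), so its minimizer is within `O(ρ)` of `z*`, and then
the best grid price is within `O(ρ)` of `p_m*`. Spare powers of `g` absorb all constants, so by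
induction no interval ever loses the optimum (`MarketBounds.exists_phaseInv`). The product `n τ ·
width²` is the same in all phases, and there are at most `log n` of them, so exploration costs
`O(√n)` up to logarithms (`explore_lagrangian_le`).

(ii) Steering. Exploration perturbs sales to first order, by about `n^(3/4) (log n) g⁷`. The prices
of the last phase lie at distance between `α` and `2α` from the optimum on either side, which moves
the sales rate by order `n α = n^(3/4) (log n) g⁹` in both directions. So the target rate lies
strictly between the two test rates, no projection is active, and the sales end at `n c` with error
`O(√n)` up to logarithms (`MarketBounds.exists_last_sales`). The markup costs `n α²`, which is the
stated rate.

Randomness enters through a single event of probability `1 - O(n⁻²)` on which the counts of all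
cells, for all windows and marks at once, are close to their means
(`IsPoissonRandomMeasure.exists_goodEvent`). On it the adaptive algorithm is analysed path by path,
with no conditioning (`MarketBounds.exists_goodPath`, `GoodPath.values`). The complement is
negligible by a second moment bound (`abs_integral_sub_le`). Measurability of the revenues follows
because the price path takes countably many values almost surely (`isDiscrete_policyPrice`). -/

/-- A function on an interval whose second derivative is between `-K` and `-k` is pinched between
two parabolas at an interior maximizer. -/
lemma quadratic_gap_of_second_deriv {φ : ℝ → ℝ} {u v x₀ k K : ℝ}
    (hcont : ContinuousOn φ (Icc u v))
    (hd : ∀ x ∈ Ioo u v, DifferentiableAt ℝ φ x)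
    (hdd : ∀ x ∈ Ioo u v, DifferentiableAt ℝ (deriv φ) x)
    (hk : ∀ x ∈ Ioo u v, k ≤ -deriv (deriv φ) x)
    (hK : ∀ x ∈ Ioo u v, -deriv (deriv φ) x ≤ K)
    (hx₀ : x₀ ∈ Ioo u v) (hmax : IsMaxOn φ (Icc u v) x₀) {x : ℝ} (hx : x ∈ Icc u v) :
    k / 2 * (x - x₀) ^ 2 ≤ φ x₀ - φ x ∧ φ x₀ - φ x ≤ K / 2 * (x - x₀) ^ 2 := by
  have h0 : deriv φ x₀ = 0 := by
    have hl : IsLocalMax φ x₀ := hmax.isLocalMax (Icc_mem_nhds hx₀.1 hx₀.2)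
    exact hl.deriv_eq_zero
  have hq : ∀ (c y : ℝ), HasDerivAt (fun x => c / 2 * (x - x₀) ^ 2) (c * (y - x₀)) y := by
    intro c y
    have h1 : HasDerivAt (fun x => (x - x₀) ^ 2) (2 * (y - x₀)) y := by
      simpa using ((hasDerivAt_id y).sub_const x₀).fun_pow 2
    have := h1.const_mul (c / 2)
    convert! this using 1
    ring
  have hq' : ∀ (c y : ℝ), HasDerivAt (fun x => c * (x - x₀)) c y := by
    intro c y
    simpa using ((hasDerivAt_id y).sub_const x₀).const_mul c
  have hx₀' : x₀ ∈ interior (Icc u v) := by rw [interior_Icc]; exact hx₀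
  -- convex functions with vanishing derivative at `x₀`
  have key : ∀ (ψ ψ' ψ'' : ℝ → ℝ), ContinuousOn ψ (Icc u v) →
      (∀ y ∈ Ioo u v, HasDerivAt ψ (ψ' y) y) → (∀ y ∈ Ioo u v, HasDerivAt ψ' (ψ'' y) y) →
      (∀ y ∈ Ioo u v, 0 ≤ ψ'' y) → ψ' x₀ = 0 → ψ x₀ ≤ ψ x := by
    intro ψ ψ' ψ'' hc h1 h2 h3 h4
    have hconv : ConvexOn ℝ (Icc u v) ψ := by
      refine convexOn_of_hasDerivWithinAt2_nonneg (convex_Icc u v) hc (f' := ψ') (f'' := ψ'')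
        ?_ ?_ ?_ <;> rw [interior_Icc]
      · exact fun y hy => (h1 y hy).hasDerivWithinAt
      · exact fun y hy => (h2 y hy).hasDerivWithinAt
      · exact h3
    have hmin := hconv.isMinOn_of_rightDeriv_eq_zero hx₀'
      (by rw [((h1 x₀ hx₀).hasDerivWithinAt).derivWithin (uniqueDiffWithinAt_Ioi x₀), h4])
    exact hmin hx
  constructor
  · have := key (fun x => -φ x - k / 2 * (x - x₀) ^ 2) (fun x => -deriv φ x - k * (x - x₀))
      (fun x => -deriv (deriv φ) x - k) (by fun_prop)
      (fun y hy => (hd y hy).hasDerivAt.neg.sub (hq k y))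
      (fun y hy => (hdd y hy).hasDerivAt.neg.sub (hq' k y))
      (fun y hy => by linarith [hk y hy]) (by simp [h0])
    simp only [sub_self] at this
    nlinarith
  · have := key (fun x => φ x + K / 2 * (x - x₀) ^ 2) (fun x => deriv φ x + K * (x - x₀))
      (fun x => deriv (deriv φ) x + K) (by fun_prop)
      (fun y hy => (hd y hy).hasDerivAt.add (hq K y))
      (fun y hy => (hdd y hy).hasDerivAt.add (hq' K y))
      (fun y hy => by linarith [hK y hy]) (by simp [h0])
    simp only [sub_self] at this
    nlinarith

variable {M : ℕ}

/-- What the analysis uses of the market: the dual optimum `zS`, the optimal prices `pS`, and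
constants `a`, `b`, `l`, `B` for the behaviour of demand and Lagrangian around `pS`. -/
structure MarketBounds (F : FirmInfo) (d : Fin M → ℝ → ℝ) (pInf zS : ℝ) (pS : Fin M → ℝ)
    (a b l B : ℝ) : Prop where
  T_pos : 0 < F.T
  M_pos : 0 < M
  a_pos : 0 < a
  b_pos : 0 < b
  l_pos : 0 < l
  B_pos : 0 < B
  pLo_nonneg : 0 ≤ F.pLo
  pHi_le : F.pHi ≤ pInf
  pS_mem : ∀ m, pS m ∈ Ioo F.pLo F.pHi
  z_pos : 0 < zS
  z_lt : zS < F.zHi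
  slack : F.c = F.T * ∑ m, d m (pS m)
  nonneg : ∀ m p, 0 ≤ d m p
  le_B : ∀ m p, d m p ≤ B
  gap_lower : ∀ m, ∀ p ∈ Icc 0 pInf,
    a * (p - pS m) ^ 2 ≤ d m (pS m) * (pS m - zS) - d m p * (p - zS)
  gap_upper : ∀ m, ∀ p ∈ Icc 0 pInf,
    d m (pS m) * (pS m - zS) - d m p * (p - zS) ≤ b * (p - pS m) ^ 2
  lip : ∀ m, ∀ p ∈ Icc 0 pInf, |d m p - d m (pS m)| ≤ l * |p - pS m|
  expand : ∀ m, ∀ p ∈ Icc 0 pInf, (p - pS m) ^ 2 / l ≤ (d m (pS m) - d m p) * (p - pS m)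

/-- In the variable `x = d_m(p)` the profit becomes `r_m(x) - z x`. The linear term does not affect
the second derivative, so the curvature bounds on `r_m` apply for every `z`. Strict monotonicity
sends the interior maximizer `p₀` to an interior point of the demand range. -/
lemma exists_lagrangian_bounds {d : Fin M → ℝ → ℝ} {pInf M₁ : ℝ} {M₂ : ℝ≥0} {M₃ M₄ : ℝ}
    (hd : RegularDemand d pInf M₁ M₂ M₃ M₄) (m : Fin M) {z p₀ : ℝ} (hp₀ : p₀ ∈ Ioo 0 pInf)
    (hopt : IsMaxOn (fun p => d m p * (p - z)) (Icc 0 pInf) p₀) {p : ℝ} (hp : p ∈ Icc 0 pInf) :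
    M₃ / 2 * (d m p - d m p₀) ^ 2 ≤ d m p₀ * (p₀ - z) - d m p * (p - z) ∧
    d m p₀ * (p₀ - z) - d m p * (p - z) ≤ M₄ / 2 * (d m p - d m p₀) ^ 2 := by
  have hpI : 0 ≤ pInf := (hp₀.1.trans hp₀.2).le
  have hanti := hd.strictAnti m
  have h0 : (0 : ℝ) ∈ Icc 0 pInf := ⟨le_rfl, hpI⟩
  have h1 : pInf ∈ Icc 0 pInf := ⟨hpI, le_rfl⟩
  have hp₀' : p₀ ∈ Icc 0 pInf := ⟨hp₀.1.le, hp₀.2.le⟩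
  have hrange : demandRange d pInf m = Icc (d m pInf) (d m 0) := by
    apply Subset.antisymm
    · rintro _ ⟨q, hq, rfl⟩
      exact ⟨hanti.antitoneOn hq h1 hq.2, hanti.antitoneOn h0 hq hq.1⟩
    · exact intermediate_value_Icc' hpI (hd.lipschitz_demand m).continuousOn
  have hinv : ∀ q ∈ Icc 0 pInf, invDemand d pInf m (d m q) = q := fun q hq =>
    hanti.injOn.leftInvOn_invFunOn hq
  have hrev : ∀ q ∈ Icc 0 pInf, revenueRate d pInf m (d m q) - z * d m q = d m q * (q - z) := by
    intro q hq
    rw [revenueRate, hinv q hq]; ring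
  have hint : interior (demandRange d pInf m) = Ioo (d m pInf) (d m 0) := by
    rw [hrange, interior_Icc]
  set r := revenueRate d pInf m with hr
  have hdiff : ∀ x ∈ Ioo (d m pInf) (d m 0), DifferentiableAt ℝ r x := by
    rw [← hint]; exact hd.differentiable m
  have hder : ∀ x ∈ Ioo (d m pInf) (d m 0), deriv (fun x => r x - z * x) x = deriv r x - z := by
    intro x hx
    rw [deriv_fun_sub (hdiff x hx) (by fun_prop)]
    simp
  have hev : ∀ x ∈ Ioo (d m pInf) (d m 0),
      deriv (fun x => r x - z * x) =ᶠ[nhds x] fun x => deriv r x - z := by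
    intro x hx
    filter_upwards [isOpen_Ioo.mem_nhds hx] with y hy using hder y hy
  have hder2 : ∀ x ∈ Ioo (d m pInf) (d m 0),
      deriv (deriv (fun x => r x - z * x)) x = deriv (deriv r) x := by
    intro x hx
    rw [(hev x hx).deriv_eq, deriv_sub_const]
  have main := quadratic_gap_of_second_deriv (φ := fun x => r x - z * x) (u := d m pInf)
    (v := d m 0) (x₀ := d m p₀) (k := M₃) (K := M₄) (x := d m p)
    (by
      have : ContinuousOn r (Icc (d m pInf) (d m 0)) := by
        rw [← hrange]; exact (hd.lipschitz_revenue m).continuousOn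
      fun_prop)
    (fun x hx => (hdiff x hx).sub (by fun_prop))
    (fun x hx => by
      have h2 : DifferentiableAt ℝ (deriv r) x := hd.differentiable_deriv m x (by rw [hint]; exact hx)
      exact (h2.sub_const z).congr_of_eventuallyEq (hev x hx))
    (fun x hx => by rw [hder2 x hx]; exact hd.concave_lower m x (by rw [hint]; exact hx))
    (fun x hx => by rw [hder2 x hx]; exact hd.concave_upper m x (by rw [hint]; exact hx))
    ⟨hanti hp₀' h1 hp₀.2, hanti h0 hp₀' hp₀.1⟩
    (by
      rw [← hrange]
      rintro _ ⟨q, hq, rfl⟩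
      change r (d m q) - z * d m q ≤ r (d m p₀) - z * d m p₀
      rw [hrev q hq, hrev p₀ hp₀']
      exact hopt hq)
    (by rw [← hrange]; exact ⟨p, hp, rfl⟩)
  simp only [hrev p₀ hp₀', hrev p hp] at main
  exact main

lemma maxProfit_eq {d : Fin M → ℝ → ℝ} {pInf : ℝ} {m : Fin M} {z p : ℝ}
    (hp : p ∈ optimalPrices d pInf m z) : maxProfit d pInf m z = d m p * (p - z) := by
  apply IsGreatest.csSup_eq
  refine ⟨⟨p, hp.1, rfl⟩, ?_⟩
  rintro _ ⟨q, hq, rfl⟩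
  exact hp.2 hq

/-- A vanishing first-order term: if `0 ≤ κ w + C w²` near `0` then `κ = 0`. -/
lemma eq_zero_of_forall_quadratic_nonneg {κ C δ : ℝ} (hC : 0 < C) (hδ : 0 < δ)
    (h : ∀ w, -δ ≤ w → 0 ≤ κ * w + C * w ^ 2) : κ = 0 := by
  by_contra hκ
  have hκ' : 0 < |κ| := abs_pos.mpr hκ
  -- The test point is `w = -κ t`. The first bound on `t` makes the quadratic term at most half of
  -- the linear one, the second keeps `w ≥ -δ`.
  set t := min (1 / (2 * C)) (δ / |κ|) with ht
  have ht0 : 0 < t := by rw [ht]; positivity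
  have h1 : t * C ≤ 1 / 2 := by
    calc t * C ≤ 1 / (2 * C) * C := by gcongr; exact min_le_left _ _
      _ = 1 / 2 := by field_simp
  have h2 : t * |κ| ≤ δ := by
    calc t * |κ| ≤ δ / |κ| * |κ| := by gcongr; exact min_le_right _ _
      _ = δ := by field_simp
  have h3 := h (-κ * t) (by nlinarith [le_abs_self κ])
  have h4 : 0 < κ ^ 2 * t := by positivity
  nlinarith

/-- The interface between the assumptions and the analysis. Curvature in the demand variable becomes
curvature in the price because demand and its inverse are both Lipschitz; inventory slackness is the
stationarity of the dual at `zS > 0`. -/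
theorem exists_marketBounds (hM : 0 < M) {F : FirmInfo} (hT : 0 < F.T)
    {d : Fin M → ℝ → ℝ} {pInf M₁ : ℝ} {M₂ : ℝ≥0} {M₃ M₄ : ℝ}
    (hd : RegularDemand d pInf M₁ M₂ M₃ M₄)
    {zS : ℝ} (hc : 0 < F.c) (hz : IsDualOptimal d pInf F.T F.c zS)
    (hF : InitialRanges F d pInf zS) (hpos : 0 < zS) :
    ∃ (pS : Fin M → ℝ) (a b l B : ℝ), MarketBounds F d pInf zS pS a b l B := by
  -- With an empty price domain the dual function would be `c z`, minimized at `0` and not at `zS >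
  -- 0`.
  have hpI : 0 ≤ pInf := by
    by_contra hneg
    have hempty : Icc 0 pInf = ∅ := Icc_eq_empty hneg
    have h0 := hz.2 (mem_Ici.mpr le_rfl : (0 : ℝ) ∈ Ici 0)
    simp only [mem_ofPred_eq, dualFunction, maxProfit, hempty, image_empty, Real.sSup_empty,
      Finset.sum_const_zero, mul_zero, add_zero] at h0
    nlinarith
  have hcont : ∀ m, ContinuousOn (d m) (Icc 0 pInf) := fun m =>
    (hd.lipschitz_demand m).continuousOn
  have hex : ∀ m, ∃ p, p ∈ optimalPrices d pInf m zS := by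
    intro m
    obtain ⟨p, hp, hp'⟩ := isCompact_Icc.exists_isMaxOn (nonempty_Icc.mpr hpI)
      (f := fun p => d m p * (p - zS)) ((hcont m).mul (by fun_prop))
    exact ⟨p, hp, hp'⟩
  choose pS hpS using hex
  have hmem : ∀ m, pS m ∈ Ioo F.pLo F.pHi := fun m => hF.optimal_price m (hpS m)
  have hlt : F.pLo < F.pHi := (hmem ⟨0, hM⟩).1.trans (hmem ⟨0, hM⟩).2
  have hlo : 0 ≤ F.pLo := (hF.price_domain ⟨le_rfl, hlt.le⟩).1
  have hhi : F.pHi ≤ pInf := (hF.price_domain ⟨hlt.le, le_rfl⟩).2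
  have hpS0 : ∀ m, pS m ∈ Ioo 0 pInf := fun m =>
    ⟨hlo.trans_lt (hmem m).1, (hmem m).2.trans_le hhi⟩
  have hpSI : ∀ m, pS m ∈ Icc 0 pInf := fun m => (hpS m).1
  have hinvlip : ∀ m, ∀ p ∈ Icc 0 pInf, ∀ q ∈ Icc 0 pInf, |p - q| ≤ M₂ * |d m p - d m q| := by
    intro m p hp q hq
    have h := (hd.lipschitz_inv m).dist_le_mul (d m p) ⟨p, hp, rfl⟩ (d m q) ⟨q, hq, rfl⟩
    have hinv : ∀ q ∈ Icc 0 pInf, invDemand d pInf m (d m q) = q := fun q hq =>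
      (hd.strictAnti m).injOn.leftInvOn_invFunOn hq
    rwa [hinv p hp, hinv q hq, Real.dist_eq, Real.dist_eq] at h
  have hlip : ∀ m, ∀ p ∈ Icc 0 pInf, |d m p - d m (pS m)| ≤ M₂ * |p - pS m| := by
    intro m p hp
    simpa [Real.dist_eq] using (hd.lipschitz_demand m).dist_le_mul p hp (pS m) (hpSI m)
  have hM₂ : 0 < (M₂ : ℝ) := by
    have h1 := hinvlip ⟨0, hM⟩ _ (hpSI ⟨0, hM⟩) 0 ⟨le_rfl, hpI⟩
    have h2 : 0 < |pS ⟨0, hM⟩ - 0| := by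
      rw [sub_zero]; exact abs_pos.mpr (hpS0 ⟨0, hM⟩).1.ne'
    rcases (NNReal.coe_nonneg M₂).lt_or_eq with h | h
    · exact h
    · rw [← h, zero_mul] at h1; linarith
  have hM₃ := hd.pos
  have hgap := fun m p hp => exists_lagrangian_bounds hd m (hpS0 m) (hpS m).2 (p := p) hp
  have hM₄ : 0 < M₄ := by
    have h1 := hgap ⟨0, hM⟩ 0 ⟨le_rfl, hpI⟩
    have h2 : d ⟨0, hM⟩ (pS ⟨0, hM⟩) < d ⟨0, hM⟩ 0 :=
      hd.strictAnti _ ⟨le_rfl, hpI⟩ (hpSI _) (hpS0 _).1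
    have h3 : 0 < (d ⟨0, hM⟩ 0 - d ⟨0, hM⟩ (pS ⟨0, hM⟩)) ^ 2 := by
      have := sub_pos.mpr h2
      positivity
    have h4 := h1.1.trans h1.2
    nlinarith
  -- The gap is at least `M₃ / 2` times the squared change of demand, which is at least `M₂⁻²` times
  -- the squared change of price.
  set a := M₃ / (2 * (M₂ : ℝ) ^ 2) with ha
  have ha0 : 0 < a := by rw [ha]; positivity
  have hlower : ∀ m, ∀ p ∈ Icc 0 pInf,
      a * (p - pS m) ^ 2 ≤ d m (pS m) * (pS m - zS) - d m p * (p - zS) := by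
    intro m p hp
    refine le_trans ?_ (hgap m p hp).1
    have h1 : (p - pS m) ^ 2 ≤ (M₂ : ℝ) ^ 2 * (d m p - d m (pS m)) ^ 2 := by
      rw [← mul_pow, ← sq_abs, ← sq_abs (_ * _), abs_mul, abs_of_pos hM₂]
      have := hinvlip m p hp _ (hpSI m)
      gcongr
    calc a * (p - pS m) ^ 2 ≤ a * ((M₂ : ℝ) ^ 2 * (d m p - d m (pS m)) ^ 2) := by gcongr
      _ = M₃ / 2 * (d m p - d m (pS m)) ^ 2 := by rw [ha]; field_simp
  -- An envelope theorem without derivatives: each `R_m` has a quadratic majorant that touches it at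
  -- `zS` with slope `-d_m(pS m)`. Minimality of the dual at `zS` then gives `0 ≤ κ w + C w²` for `w
  -- ≥ -zS`, where `κ` is the difference of the two sides, and `zS > 0` permits both signs of `w`.
  have hslack : F.c = F.T * ∑ m, d m (pS m) := by
    have hmp : ∀ m z, maxProfit d pInf m z ≤ d m (pS m) * (pS m - zS) - (z - zS) * d m (pS m)
        + (M₂ : ℝ) ^ 2 / (4 * a) * (z - zS) ^ 2 := by
      intro m z
      apply csSup_le ((nonempty_Icc.mpr hpI).image _)
      rintro _ ⟨p, hp, rfl⟩
      have h1 := hlower m p hp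
      have h2 := hlip m p hp
      have h3 : -(z - zS) * (d m p - d m (pS m)) ≤ |z - zS| * (M₂ * |p - pS m|) := by
        calc _ ≤ |-(z - zS) * (d m p - d m (pS m))| := le_abs_self _
          _ = |z - zS| * |d m p - d m (pS m)| := by rw [abs_mul, abs_neg]
          _ ≤ _ := by gcongr
      have h4 : |z - zS| * (M₂ * |p - pS m|) ≤
          a * (p - pS m) ^ 2 + (M₂ : ℝ) ^ 2 / (4 * a) * (z - zS) ^ 2 := by
        rw [← sq_abs (p - pS m), ← sq_abs (z - zS)]
        have : 0 ≤ (2 * a * |p - pS m| - M₂ * |z - zS|) ^ 2 / (4 * a) := by positivity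
        have e : (2 * a * |p - pS m| - M₂ * |z - zS|) ^ 2 / (4 * a) = a * |p - pS m| ^ 2
          + (M₂ : ℝ) ^ 2 / (4 * a) * |z - zS| ^ 2 - |z - zS| * (M₂ * |p - pS m|) := by
          field_simp; ring
        linarith
      simp only
      nlinarith
    have hC : 0 < F.T * (M * ((M₂ : ℝ) ^ 2 / (4 * a))) := by
      have : (0 : ℝ) < M := by exact_mod_cast hM
      positivity
    have hκ := eq_zero_of_forall_quadratic_nonneg (κ := F.c - F.T * ∑ m, d m (pS m)) hC hpos
      (by
        intro w hw
        have h1 : dualFunction d pInf F.T F.c zS ≤ dualFunction d pInf F.T F.c (zS + w) :=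
          hz.2 (mem_Ici.mpr (by linarith))
        have h2 : ∑ m, maxProfit d pInf m (zS + w) ≤ ∑ m, (d m (pS m) * (pS m - zS)
            - w * d m (pS m) + (M₂ : ℝ) ^ 2 / (4 * a) * w ^ 2) := by
          apply Finset.sum_le_sum
          intro m _
          simpa using hmp m (zS + w)
        rw [dualFunction, dualFunction, Finset.sum_congr rfl fun m _ => maxProfit_eq (hpS m)] at h1
        rw [Finset.sum_add_distrib, Finset.sum_sub_distrib, ← Finset.mul_sum, Finset.sum_const,
          Finset.card_univ, Fintype.card_fin, nsmul_eq_mul] at h2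
        have h3 := mul_le_mul_of_nonneg_left h2 hT.le
        nlinarith)
    linarith
  refine ⟨pS, a, M₄ / 2 * (M₂ : ℝ) ^ 2, M₂, max M₁ 1, ?_⟩
  exact
  { T_pos := hT
    M_pos := hM
    a_pos := ha0
    b_pos := by positivity
    l_pos := hM₂
    B_pos := by positivity
    pLo_nonneg := hlo
    pHi_le := hhi
    pS_mem := hmem
    z_pos := hpos
    z_lt := hF.optimal_dual.2
    slack := hslack
    nonneg := hd.nonneg
    le_B := fun m p => (hd.bounded m p).trans (le_max_left _ _)
    gap_lower := hlower
    gap_upper := by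
      intro m p hp
      refine (hgap m p hp).2.trans ?_
      rw [mul_assoc, ← mul_pow, ← sq_abs, ← sq_abs (_ * _), abs_mul, abs_of_pos hM₂]
      have := hlip m p hp
      gcongr
    lip := hlip
    -- The Lipschitz inverse makes demand expand distances from below; monotonicity fixes the sign
    -- of the change.
    expand := by
      intro m p hp
      have h1 := hinvlip m p hp _ (hpSI m)
      have h2 : (d m (pS m) - d m p) * (p - pS m) = |d m p - d m (pS m)| * |p - pS m| := by
        rcases le_total p (pS m) with h | h
        · have := (hd.strictAnti m).antitoneOn hp (hpSI m) h
          rw [abs_of_nonneg (by linarith), abs_of_nonpos (by linarith)]; ring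
        · have := (hd.strictAnti m).antitoneOn (hpSI m) hp h
          rw [abs_of_nonpos (by linarith), abs_of_nonneg (by linarith)]; ring
      rw [h2, div_le_iff₀ hM₂, ← sq_abs]
      nlinarith [abs_nonneg (p - pS m)] }

/-- The optimal fluid revenue rate times the season length. -/
def fluidRevenue (F : FirmInfo) (d : Fin M → ℝ → ℝ) (pS : Fin M → ℝ) : ℝ :=
  F.T * ∑ m, pS m * d m (pS m)

section

variable {F : FirmInfo} {d : Fin M → ℝ → ℝ} {pInf zS : ℝ} {pS : Fin M → ℝ} {a b l B : ℝ}

lemma MarketBounds.pS_mem_Icc (h : MarketBounds F d pInf zS pS a b l B) (m : Fin M) :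
    pS m ∈ Icc 0 pInf :=
  ⟨h.pLo_nonneg.trans (h.pS_mem m).1.le, (h.pS_mem m).2.le.trans h.pHi_le⟩

lemma MarketBounds.fluidRevenue_eq (h : MarketBounds F d pInf zS pS a b l B) :
    fluidRevenue F d pS = F.T * ∑ m, d m (pS m) * (pS m - zS) + zS * F.c := by
  rw [fluidRevenue, h.slack, mul_left_comm zS, ← mul_add, Finset.mul_sum _ _ zS,
    ← Finset.sum_add_distrib]
  congr 1
  exact Finset.sum_congr rfl fun m _ => by ring

/-- Demand is arbitrary, possibly non-measurable, outside the price domain. On paths that stay in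
the domain it agrees with its continuous extension by constants, which yields the measurability
needed for the fluid integrals. -/
lemma MarketBounds.continuousOn (hd : ∀ m, ContinuousOn (d m) (Icc 0 pInf)) {q : ℝ → ℝ}
    (hq : Measurable q) (hmem : ∀ t, q t ∈ Icc 0 pInf) (m : Fin M) :
    Measurable fun t => d m (q t) := by
  have h0 : (0 : ℝ) ≤ pInf := (hmem 0).1.trans (hmem 0).2
  have h1 : Continuous (IccExtend h0 ((Icc 0 pInf).domRestrict (d m))) :=
    (continuousOn_iff_continuous_domRestrict.mp (hd m)).Icc_extend'
  have h2 : (fun t => d m (q t)) = fun t => IccExtend h0 ((Icc 0 pInf).domRestrict (d m)) (q t) := by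
    funext t
    rw [IccExtend_of_mem h0 _ (hmem t)]; rfl
  rw [h2]
  exact h1.measurable.comp hq

/-- Weak duality: pointwise, `p d_m(p)` is at most the maximal Lagrangian profit plus `zS d_m(p)`,
and the capacity constraint bounds the integral of the last term. The constant path `pS` uses the
capacity exactly, so it attains the bound. -/
theorem MarketBounds.scaledFluidValue_eq (h : MarketBounds F d pInf zS pS a b l B)
    (hd : ∀ m, ContinuousOn (d m) (Icc 0 pInf)) (n : ℕ) :
    scaledFluidValue d pInf F.T F.c n = n * fluidRevenue F d pS := by
  rw [scaledFluidValue, fluidValue]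
  apply IsGreatest.csSup_eq
  constructor
  · refine ⟨fun m _ => pS m, fun m => measurable_const, fun m _ => h.pS_mem_Icc m, ?_, ?_⟩
    · simp only [intervalIntegral.integral_const, sub_zero, smul_eq_mul]
      rw [← Finset.mul_sum, ← Finset.mul_sum, h.slack]
      exact le_of_eq (by ring)
    · simp only [intervalIntegral.integral_const, sub_zero, smul_eq_mul]
      rw [fluidRevenue, ← Finset.mul_sum, mul_left_comm, Finset.mul_sum _ _ (n : ℝ)]
      congr 1
      exact Finset.sum_congr rfl fun m _ => by ring
  · rintro _ ⟨p, hpm, hp, hcap, rfl⟩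
    have hmeas : ∀ m, Measurable fun t => d m (p m t) := fun m =>
      MarketBounds.continuousOn hd (hpm m) (hp m) m
    have hint : ∀ m, IntervalIntegrable (fun t => (n : ℝ) * d m (p m t)) volume 0 F.T := by
      intro m
      rw [intervalIntegrable_iff]
      refine Measure.integrableOn_of_bounded (M := n * B) (by simp)
        ((hmeas m).const_mul _).aestronglyMeasurable ?_
      refine Eventually.of_forall fun t => ?_
      rw [Real.norm_eq_abs, abs_of_nonneg (mul_nonneg n.cast_nonneg (h.nonneg _ _))]
      have := h.le_B m (p m t)
      gcongr
    have hbound : ∀ m t, p m t * (n * d m (p m t)) ≤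
        n * (d m (pS m) * (pS m - zS)) + zS * (n * d m (p m t)) := by
      intro m t
      have h1 := h.gap_lower m (p m t) (hp m t)
      have h2 : 0 ≤ a * (p m t - pS m) ^ 2 := mul_nonneg h.a_pos.le (sq_nonneg _)
      have h3 : d m (p m t) * (p m t - zS) ≤ d m (pS m) * (pS m - zS) := by linarith
      have h4 := mul_le_mul_of_nonneg_left h3 (n.cast_nonneg : (0 : ℝ) ≤ n)
      nlinarith
    have hle : ∀ m, ∫ t in (0 : ℝ)..F.T, p m t * (n * d m (p m t)) ≤
        F.T * (n * (d m (pS m) * (pS m - zS))) + zS * ∫ t in (0 : ℝ)..F.T, n * d m (p m t) := by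
      intro m
      have h1 : F.T * (n * (d m (pS m) * (pS m - zS))) + zS * ∫ t in (0 : ℝ)..F.T, n * d m (p m t)
          = ∫ t in (0 : ℝ)..F.T, (n * (d m (pS m) * (pS m - zS)) + zS * (n * d m (p m t))) := by
        rw [intervalIntegral.integral_add (by simp) ((hint m).const_mul _),
          intervalIntegral.integral_const, intervalIntegral.integral_const_mul,
          intervalIntegral.integral_const_mul, intervalIntegral.integral_const_mul, sub_zero,
          smul_eq_mul]
      rw [h1]
      apply intervalIntegral.integral_mono_on h.T_pos.le
      · rw [intervalIntegrable_iff]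
        refine Measure.integrableOn_of_bounded (M := pInf * (n * B)) (by simp)
          ((hpm m).mul ((hmeas m).const_mul _)).aestronglyMeasurable ?_
        refine Eventually.of_forall fun t => ?_
        have h2 := h.le_B m (p m t)
        have h3 := h.nonneg m (p m t)
        have h4 := hp m t
        rw [Real.norm_eq_abs, abs_of_nonneg (mul_nonneg h4.1 (by positivity))]
        have := h4.2
        have := h4.1
        gcongr
        linarith
      · exact (by simp : IntervalIntegrable (fun _ => (n * (d m (pS m) * (pS m - zS)) : ℝ))
          volume 0 F.T).add ((hint m).const_mul _)
      · exact fun t _ => hbound m t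
    calc ∑ m, ∫ t in (0 : ℝ)..F.T, p m t * (n * d m (p m t))
        ≤ ∑ m, (F.T * (n * (d m (pS m) * (pS m - zS)))
          + zS * ∫ t in (0 : ℝ)..F.T, n * d m (p m t)) := Finset.sum_le_sum fun m _ => hle m
      _ = n * (F.T * ∑ m, d m (pS m) * (pS m - zS))
          + zS * ∑ m, ∫ t in (0 : ℝ)..F.T, n * d m (p m t) := by
        rw [Finset.sum_add_distrib, ← Finset.mul_sum, ← Finset.mul_sum, ← Finset.mul_sum]
        ring
      _ ≤ n * (F.T * ∑ m, d m (pS m) * (pS m - zS)) + zS * (n * F.c) := by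
        gcongr
        exact h.z_pos.le
      _ = n * fluidRevenue F d pS := by rw [h.fluidRevenue_eq]; ring

lemma MarketBounds.fluidRevenue_pos (h : MarketBounds F d pInf zS pS a b l B) :
    0 < fluidRevenue F d pS := by
  have : Nonempty (Fin M) := ⟨⟨0, h.M_pos⟩⟩
  refine mul_pos h.T_pos (Finset.sum_pos (fun m _ => ?_) Finset.univ_nonempty)
  have h1 : pS m < pInf := (h.pS_mem m).2.trans_le h.pHi_le
  have h2 : 0 < pS m := h.pLo_nonneg.trans_lt (h.pS_mem m).1
  -- Comparison with the price `pInf`, where demand is nonnegative, forces `d m (pS m) > 0`.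
  have h3 := h.expand m pInf ⟨(h2.trans h1).le, le_rfl⟩
  have h4 : 0 < (pInf - pS m) ^ 2 / l := div_pos (pow_pos (sub_pos.mpr h1) 2) h.l_pos
  have h5 := pos_of_mul_pos_left (h4.trans_le h3) (sub_pos.mpr h1).le
  have := h.nonneg m pInf
  exact mul_pos h2 (by linarith)

end

end PersonalizedPricing

namespace PersonalizedPricing

/-! ### Concentration of the Poisson random measure -/

lemma lintegral_exp_poissonMeasure (r : ℝ≥0) (s : ℝ) :
    ∫⁻ k : ℕ, ENNReal.ofReal (Real.exp (s * k)) ∂(poissonMeasure r)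
      = ENNReal.ofReal (Real.exp (r * (Real.exp s - 1))) := by
  have h1 : ∀ k : ℕ, ENNReal.ofReal (Real.exp (-r) * r ^ k / (k.factorial : ℝ))
      * ENNReal.ofReal (Real.exp (s * k))
      = ENNReal.ofReal (Real.exp (-r) * ((r * Real.exp s) ^ k / (k.factorial : ℝ))) := by
    intro k
    rw [← ENNReal.ofReal_mul (by positivity), mul_comm s, Real.exp_nat_mul, mul_pow]
    congr 1
    ring
  have h2 : HasSum (fun k : ℕ => Real.exp (-r) * ((r * Real.exp s) ^ k / (k.factorial : ℝ)))
      (Real.exp (-r) * Real.exp (r * Real.exp s)) := by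
    apply HasSum.mul_left
    rw [Real.exp_eq_exp_ℝ]
    exact NormedSpace.expSeries_div_hasSum_exp _
  rw [lintegral_countable']
  simp_rw [poissonMeasure_singleton, mul_comm (ENNReal.ofReal (Real.exp (s * _))), h1]
  rw [← ENNReal.ofReal_tsum_of_nonneg (fun k => by positivity) h2.summable, h2.tsum_eq,
    ← Real.exp_add]
  congr 2
  ring

/-- Exponential Markov inequality with `exp s - 1 - s ≤ s²` for `|s| ≤ 1`. Both signs of `s` are
allowed, so this serves both tails; `v` may exceed the mean, which is what permits a slope of size
at most `1` when the mean is small. -/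
lemma poissonMeasure_chernoff {r : ℝ≥0} {v s x : ℝ} (hv : r ≤ v) (hs : |s| ≤ 1) :
    poissonMeasure r {k : ℕ | x ≤ s * (k - r)} ≤ ENNReal.ofReal (Real.exp (v * s ^ 2 - x)) := by
  have h1 : {k : ℕ | x ≤ s * (k - r)} ⊆
      {k : ℕ | ENNReal.ofReal (Real.exp (x + s * r)) ≤ ENNReal.ofReal (Real.exp (s * k))} := by
    intro k hk
    simp only [mem_ofPred_eq] at hk ⊢
    apply ENNReal.ofReal_le_ofReal
    apply Real.exp_le_exp.mpr
    linarith
  have h2 := meas_ge_le_lintegral_div (μ := poissonMeasure r)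
    (f := fun k : ℕ => ENNReal.ofReal (Real.exp (s * k))) (by fun_prop)
    (ε := ENNReal.ofReal (Real.exp (x + s * r)))
    (by simpa using Real.exp_pos _) ENNReal.ofReal_ne_top
  refine (measure_mono h1).trans (h2.trans ?_)
  rw [lintegral_exp_poissonMeasure, ← ENNReal.ofReal_div_of_pos (Real.exp_pos _), ← Real.exp_sub]
  apply ENNReal.ofReal_le_ofReal
  apply Real.exp_le_exp.mpr
  have h3 : Real.exp s - 1 - s ≤ s ^ 2 := (le_abs_self _).trans (Real.abs_exp_sub_one_sub_id_le hs)
  have h4 : (r : ℝ) * (Real.exp s - 1 - s) ≤ v * s ^ 2 :=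
    (mul_le_mul_of_nonneg_left h3 r.2).trans (mul_le_mul_of_nonneg_right hv (sq_nonneg s))
  nlinarith

lemma measurableSet_or {α : Type*} [MeasurableSpace α] {p q : α → Prop}
    (hp : MeasurableSet {x | p x}) (hq : MeasurableSet {x | q x}) :
    MeasurableSet {x | p x ∨ q x} := by
  convert! hp.union hq using 1

lemma sqrt_add_le_add_sqrt {x y : ℝ} (hx : 0 ≤ x) (hy : 0 ≤ y) : √(x + y) ≤ √x + √y := by
  rw [Real.sqrt_le_left (by positivity)]
  nlinarith [Real.sq_sqrt hx, Real.sq_sqrt hy, mul_nonneg (Real.sqrt_nonneg x) (Real.sqrt_nonneg y)]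

/-- The Chernoff bound is used with `v = max r L` and slope `s = √(L / v) ≤ 1`. Then `v s² = L` and
`s √(v L) = L`, so the exponent is `(1 - A) L`, while `√(v L) ≤ √(r L) + L`. For `A ≤ 0` the
right-hand side exceeds `1`. -/
lemma poissonMeasure_deviation (r : ℝ≥0) {L : ℝ} (hL : 0 < L) (A : ℝ) :
    poissonMeasure r {k : ℕ | A * (√(r * L) + L) < |(k : ℝ) - r|}
      ≤ ENNReal.ofReal (2 * Real.exp ((1 - A) * L)) := by
  rcases le_or_gt A 0 with hA | hA
  · refine prob_le_one.trans ?_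
    rw [← ENNReal.ofReal_one]
    apply ENNReal.ofReal_le_ofReal
    have : 1 ≤ Real.exp ((1 - A) * L) := Real.one_le_exp (by nlinarith)
    linarith
  set v : ℝ := max r L with hv
  have hv0 : 0 < v := lt_max_of_lt_right hL
  set s : ℝ := √(L / v) with hs
  have hs0 : 0 ≤ s := Real.sqrt_nonneg _
  have hs1 : s ≤ 1 := by
    rw [hs, Real.sqrt_le_one, div_le_one hv0]
    exact le_max_right _ _
  have hvs : v * s ^ 2 = L := by
    rw [hs, Real.sq_sqrt (by positivity)]; field_simp
  have hsv : s * √(v * L) = L := by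
    rw [hs, ← Real.sqrt_mul (by positivity)]
    rw [show L / v * (v * L) = L ^ 2 by field_simp, Real.sqrt_sq hL.le]
  have hvle : √(v * L) ≤ √(r * L) + L := by
    rw [hv]
    rcases le_total (r : ℝ) L with h | h
    · rw [max_eq_right h, Real.sqrt_mul_self hL.le]
      linarith [Real.sqrt_nonneg ((r : ℝ) * L)]
    · rw [max_eq_left h]; linarith
  have hsub : {k : ℕ | A * (√(r * L) + L) < |(k : ℝ) - r|} ⊆
      {k : ℕ | A * L ≤ s * (k - r)} ∪ {k : ℕ | A * L ≤ (-s) * (k - r)} := by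
    intro k hk
    simp only [mem_ofPred_eq, mem_union] at hk ⊢
    have h1 : A * L ≤ s * |(k : ℝ) - r| := by
      calc A * L = s * (A * √(v * L)) := by rw [mul_left_comm, hsv]
        _ ≤ s * |(k : ℝ) - r| := by
          apply mul_le_mul_of_nonneg_left _ hs0
          refine le_trans ?_ hk.le
          gcongr
    rcases abs_cases ((k : ℝ) - r) with ⟨h, _⟩ | ⟨h, _⟩
    · left; rwa [h] at h1
    · right; rw [h] at h1; linarith
  refine (measure_mono hsub).trans ((measure_union_le _ _).trans ?_)
  have h1 := poissonMeasure_chernoff (r := r) (v := v) (s := s) (x := A * L) (le_max_left _ _)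
    (by rwa [abs_of_nonneg hs0])
  have h2 := poissonMeasure_chernoff (r := r) (v := v) (s := -s) (x := A * L) (le_max_left _ _)
    (by rwa [abs_neg, abs_of_nonneg hs0])
  rw [neg_sq, hvs] at h2
  rw [hvs] at h1
  refine (add_le_add h1 h2).trans ?_
  rw [← ENNReal.ofReal_add (by positivity) (by positivity)]
  apply ENNReal.ofReal_le_ofReal
  rw [show L - A * L = (1 - A) * L by ring]
  linarith

variable {M : ℕ}

/-- The points of type `m` with time in `(a, b]` and mark in `(0, u]`. -/
def cell (m : Fin M) (a b u : ℝ) : Set (Fin M × ℝ × ℝ) := {m} ×ˢ (Ioc a b ×ˢ Ioc 0 u)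

/-- The points with time in `(a, b]` and mark in `(0, u]`. -/
def slab (M : ℕ) (a b u : ℝ) : Set (Fin M × ℝ × ℝ) := univ ×ˢ (Ioc a b ×ˢ Ioc 0 u)

lemma measurableSet_cell (m : Fin M) (a b u : ℝ) : MeasurableSet (cell m a b u) :=
  (measurableSet_singleton m).prod (measurableSet_Ioc.prod measurableSet_Ioc)

lemma measurableSet_slab (a b u : ℝ) : MeasurableSet (slab M a b u) :=
  MeasurableSet.univ.prod (measurableSet_Ioc.prod measurableSet_Ioc)

lemma slab_eq_iUnion (a b u : ℝ) : slab M a b u = ⋃ m, cell m a b u := by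
  ext ⟨m, t, x⟩
  simp [slab, cell]

lemma cell_subset_slab (m : Fin M) (a b u : ℝ) : cell m a b u ⊆ slab M a b u := by
  rw [slab_eq_iUnion]; exact subset_iUnion (fun m => cell m a b u) m

lemma cell_mono (m : Fin M) {a a' b b' u u' : ℝ} (ha : a' ≤ a) (hb : b ≤ b') (hu : u ≤ u') :
    cell m a b u ⊆ cell m a' b' u' :=
  prod_mono subset_rfl (prod_mono (Ioc_subset_Ioc ha hb) (Ioc_subset_Ioc le_rfl hu))

lemma slab_mono {a a' b b' u u' : ℝ} (ha : a' ≤ a) (hb : b ≤ b') (hu : u ≤ u') :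
    slab M a b u ⊆ slab M a' b' u' :=
  prod_mono subset_rfl (prod_mono (Ioc_subset_Ioc ha hb) (Ioc_subset_Ioc le_rfl hu))

lemma unitIntensity_cell (m : Fin M) (a b u : ℝ) :
    unitIntensity M (cell m a b u) = ENNReal.ofReal (b - a) * ENNReal.ofReal u := by
  rw [unitIntensity, cell, Measure.prod_prod, Measure.prod_prod, Measure.count_singleton,
    Real.volume_Ioc, Real.volume_Ioc, one_mul, sub_zero]

lemma unitIntensity_slab (a b u : ℝ) :
    unitIntensity M (slab M a b u) = M * (ENNReal.ofReal (b - a) * ENNReal.ofReal u) := by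
  rw [unitIntensity, slab, Measure.prod_prod, Measure.prod_prod, Measure.count_univ,
    Real.volume_Ioc, Real.volume_Ioc, sub_zero]
  simp

variable {Ω : Type*} [MeasurableSpace Ω] {P : Measure Ω} {N : Ω → Measure (Fin M × ℝ × ℝ)}

lemma IsPoissonRandomMeasure.measurable_apply
    (hN : IsPoissonRandomMeasure P (unitIntensity M) N) {A : Set (Fin M × ℝ × ℝ)}
    (hA : MeasurableSet A) : Measurable fun ω => N ω A :=
  (Measure.measurable_coe hA).comp hN.measurable

lemma IsPoissonRandomMeasure.measure_preimage
    (hN : IsPoissonRandomMeasure P (unitIntensity M) N) {A : Set (Fin M × ℝ × ℝ)}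
    (hA : MeasurableSet A) (hfin : unitIntensity M A ≠ ∞) {S : Set ℝ≥0∞} (hS : MeasurableSet S) :
    P {ω | N ω A ∈ S} = poissonMeasure (unitIntensity M A).toNNReal {k : ℕ | (k : ℝ≥0∞) ∈ S} := by
  have h : (P.map fun ω => N ω A) S =
      ((poissonMeasure (unitIntensity M A).toNNReal).map fun k : ℕ => (k : ℝ≥0∞)) S := by
    rw [hN.poisson A hA hfin]
  rw [Measure.map_apply (hN.measurable_apply hA) hS, Measure.map_apply (by fun_prop) hS] at h
  exact h

lemma IsPoissonRandomMeasure.ae_natCast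
    (hN : IsPoissonRandomMeasure P (unitIntensity M) N) {A : Set (Fin M × ℝ × ℝ)}
    (hA : MeasurableSet A) (hfin : unitIntensity M A ≠ ∞) :
    ∀ᵐ ω ∂P, ∃ k : ℕ, N ω A = k := by
  have hS : MeasurableSet (range fun k : ℕ => (k : ℝ≥0∞))ᶜ :=
    (countable_range _).measurableSet.compl
  have h := hN.measure_preimage hA hfin hS
  have h0 : {k : ℕ | (k : ℝ≥0∞) ∈ (range fun k : ℕ => (k : ℝ≥0∞))ᶜ} = ∅ := by
    ext k; simp
  rw [h0, measure_empty] at h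
  filter_upwards [measure_eq_zero_iff_ae_notMem.mp h] with ω hω
  simp only [not_not, mem_compl_iff, mem_range] at hω
  obtain ⟨k, hk⟩ := hω
  exact ⟨k, hk.symm⟩

/-- Deviation bound for a cell. -/
lemma IsPoissonRandomMeasure.cell_deviation
    (hN : IsPoissonRandomMeasure P (unitIntensity M) N) (m : Fin M) {a b u : ℝ} (hab : a ≤ b)
    (hu : 0 ≤ u) {L : ℝ} (hL : 0 < L) (A : ℝ) :
    P {ω | N ω (cell m a b u) = ∞ ∨
        A * (√((b - a) * u * L) + L) < |(N ω (cell m a b u)).toReal - (b - a) * u|}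
      ≤ ENNReal.ofReal (2 * Real.exp ((1 - A) * L)) := by
  have hfin : unitIntensity M (cell m a b u) ≠ ∞ := by
    rw [unitIntensity_cell]
    exact ENNReal.mul_ne_top ENNReal.ofReal_ne_top ENNReal.ofReal_ne_top
  have hr : ((unitIntensity M (cell m a b u)).toNNReal : ℝ) = (b - a) * u := by
    rw [unitIntensity_cell, ← ENNReal.ofReal_mul (by linarith)]
    have : 0 ≤ (b - a) * u := mul_nonneg (by linarith) hu
    rw [ENNReal.coe_toNNReal_eq_toReal, ENNReal.toReal_ofReal this]
  have hS : MeasurableSet {y : ℝ≥0∞ | y = ∞ ∨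
      A * (√((b - a) * u * L) + L) < |y.toReal - (b - a) * u|} := by
    exact measurableSet_or (measurableSet_singleton ∞)
      (measurableSet_lt measurable_const (ENNReal.measurable_toReal.sub_const _).abs)
  have h := hN.measure_preimage (measurableSet_cell m a b u) hfin hS
  have h2 := poissonMeasure_deviation (unitIntensity M (cell m a b u)).toNNReal hL A
  simp only [mem_ofPred_eq] at h
  rw [h]
  refine le_trans (measure_mono ?_) h2
  intro k hk
  simp only [mem_ofPred_eq, ENNReal.natCast_ne_top, false_or, ENNReal.toReal_natCast] at hk ⊢
  rw [hr]
  exact hk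

/-- On a realization `ν` of the good event, all counts in cells deviate little from their means. -/
structure IsGood (T B C : ℝ) (n : ℕ) (ν : Measure (Fin M × ℝ × ℝ)) : Prop where
  finite : ν (slab M 0 T (n * B)) ≠ ∞
  dev : ∀ m a b u, 0 ≤ a → a ≤ b → b ≤ T → 0 ≤ u → u ≤ n * B →
    |(ν (cell m a b u)).toReal - (b - a) * u| ≤
      C * (√(n * (b - a) * Real.log n) + Real.log n)

set_option maxHeartbeats 1000000 in
/-- Good behaviour on a grid implies good behaviour everywhere, by monotonicity. -/
lemma isGood_of_grid {T B : ℝ} (hB : 0 < B) {n : ℕ} (hn : 3 ≤ n)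
    {ν : Measure (Fin M × ℝ × ℝ)}
    (h : ∀ m, ∀ i ∈ Finset.range (⌈T * n⌉₊ + 1), ∀ j ∈ Finset.range (⌈T * n⌉₊ + 1),
      ∀ k ∈ Finset.range (⌈n * B⌉₊ + 1), i ≤ j →
        ν (cell m (i / n) (j / n) k) ≠ ∞ ∧
        |(ν (cell m (i / n) (j / n) k)).toReal - ((j : ℝ) / n - i / n) * k|
          ≤ 6 * (√(((j : ℝ) / n - i / n) * k * Real.log n) + Real.log n)) :
    IsGood T B (((2 * B + T + 4) + 6 * (√B + (2 * B + T + 4) + 2)) + B) n ν := by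
  have hn0 : (0 : ℝ) < n := by positivity
  have hn1 : (1 : ℝ) ≤ n := by exact_mod_cast (by omega : 1 ≤ n)
  have hL : 1 ≤ Real.log n := by
    rw [Real.le_log_iff_exp_le hn0]
    have : (3 : ℝ) ≤ n := by exact_mod_cast hn
    linarith [Real.exp_one_lt_three]
  set L := Real.log n with hLdef
  constructor
  · rw [slab_eq_iUnion]
    refine ((measure_iUnion_le _).trans_lt ?_).ne
    rw [tsum_fintype]
    refine ENNReal.sum_lt_top.mpr fun m _ => lt_of_le_of_lt (measure_mono ?_)
      (h m 0 (by simp) ⌈T * n⌉₊ (by simp) ⌈n * B⌉₊ (by simp) (Nat.zero_le _)).1.lt_top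
    apply cell_mono
    · simp
    · rw [le_div_iff₀ hn0]; exact Nat.le_ceil _
    · exact Nat.le_ceil _
  · intro m a b u ha hab hbT hu huB
    -- Rounding times to multiples of `1 / n` and marks to integers changes the mean `(b - a) u` by
    -- at most `c₁`, since `u ≤ n B` and `b - a ≤ T`.
    set c₁ := 2 * B + T + 4 with hc₁
    have hT : 0 ≤ T := by linarith
    have hc₁0 : 0 < c₁ := by positivity
    have hX : 0 ≤ √(n * (b - a) * L) := Real.sqrt_nonneg _
    have hXB : ∀ r : ℝ, r ≤ (b - a) * u + c₁ →
        √(r * L) ≤ √B * √(n * (b - a) * L) + (c₁ + 1) * L := by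
      intro r hr
      have hle : r * L ≤ B * (n * (b - a) * L) + c₁ * L := by
        have h1 : (b - a) * u ≤ (b - a) * (n * B) := by
          apply mul_le_mul_of_nonneg_left huB; linarith
        have h2 : r ≤ B * (n * (b - a)) + c₁ := by linarith
        nlinarith
      have hba : 0 ≤ n * (b - a) := mul_nonneg hn0.le (by linarith)
      refine (Real.sqrt_le_sqrt hle).trans ?_
      refine (sqrt_add_le_add_sqrt (by positivity) (by positivity)).trans ?_
      rw [Real.sqrt_mul hB.le]
      have h3 : √(c₁ * L) ≤ (c₁ + 1) * L := by
        apply Real.sqrt_le_iff.mpr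
        refine ⟨by positivity, ?_⟩
        nlinarith [mul_pos hc₁0 (by linarith : 0 < L), mul_self_nonneg (c₁ * L)]
      linarith
    have hsB : 0 ≤ √B := Real.sqrt_nonneg _
    have hbn : b * n ≤ T * n := by gcongr
    have han : a * n ≤ b * n := by gcongr
    have hbn0 : 0 ≤ b * n := mul_nonneg (by linarith) hn0.le
    have han0 : 0 ≤ a * n := mul_nonneg ha hn0.le
    have huT : (b - a) * u / n ≤ (b - a) * B := by
      rw [div_le_iff₀ hn0]
      have := mul_le_mul_of_nonneg_left huB (by linarith : 0 ≤ b - a)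
      linarith
    have hun : u / n ≤ B := by rw [div_le_iff₀ hn0]; linarith
    have hun0 : 0 ≤ u / n := by positivity
    have h1n : 1 / (n : ℝ) ≤ 1 := by rw [div_le_one hn0]; exact hn1
    have hfinal : (c₁ + 6 * (√B + c₁ + 2) + B) * (√(n * (b - a) * L) + L) ≥
        c₁ + 6 * ((√B * √(n * (b - a) * L) + (c₁ + 1) * L) + L) + B := by
      nlinarith [mul_nonneg hc₁0.le hX, mul_nonneg hB.le hX, mul_nonneg hsB (by linarith : 0 ≤ L)]
    rw [abs_le]
    constructor
    · -- lower bound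
      set i := ⌈a * n⌉₊ with hi
      set j := ⌊b * n⌋₊ with hj
      set k := ⌊u⌋₊ with hk
      have hi1 : a * n ≤ i := Nat.le_ceil _
      have hi2 : (i : ℝ) < a * n + 1 := Nat.ceil_lt_add_one han0
      have hj1 : (j : ℝ) ≤ b * n := Nat.floor_le hbn0
      have hj2 : b * n < j + 1 := Nat.lt_floor_add_one _
      have hk1 : (k : ℝ) ≤ u := Nat.floor_le hu
      have hk2 : u < k + 1 := Nat.lt_floor_add_one _
      rcases lt_or_ge j i with hlt | hle
      -- No grid cell fits inside. The window is then no longer than `1 / n`, its mean is at most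
      -- `B`, and nonnegativity of the count suffices.
      · have h1 : (j : ℝ) + 1 ≤ i := by exact_mod_cast hlt
        have h2 : (b - a) * n ≤ 1 := by linarith
        have h3 : (b - a) * u ≤ B := by
          have := mul_le_mul_of_nonneg_left huB (by linarith : 0 ≤ b - a)
          nlinarith
        have h4 : 0 ≤ (ν (cell m a b u)).toReal := ENNReal.toReal_nonneg
        have h5 : 0 ≤ √B * √(n * (b - a) * L) := mul_nonneg hsB hX
        have h6 : 0 ≤ (c₁ + 1) * L := by positivity
        linarith
      · have hjT : j ≤ ⌈T * n⌉₊ := by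
          exact_mod_cast (hj1.trans (hbn.trans (Nat.le_ceil _)))
        have hkB : k ≤ ⌈n * B⌉₊ := by
          exact_mod_cast (hk1.trans (huB.trans (Nat.le_ceil _)))
        have hfin : ν (cell m a b u) ≠ ∞ := by
          have := (h m 0 (by simp) ⌈T * n⌉₊ (by simp) ⌈n * B⌉₊ (by simp) (Nat.zero_le _)).1
          refine ne_top_of_le_ne_top this (measure_mono (cell_mono m ?_ ?_ ?_))
          · simpa using ha
          · rw [le_div_iff₀ hn0]; exact hbn.trans (Nat.le_ceil _)
          · exact huB.trans (Nat.le_ceil _)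
        have hg := (h m i (Finset.mem_range.mpr (by omega)) j (Finset.mem_range.mpr (by omega)) k
          (Finset.mem_range.mpr (by omega)) hle).2
        have hmono : (ν (cell m (i / n) (j / n) k)).toReal ≤ (ν (cell m a b u)).toReal := by
          apply ENNReal.toReal_mono hfin
          apply measure_mono
          apply cell_mono m _ _ hk1
          · rw [le_div_iff₀ hn0]; exact hi1
          · rw [div_le_iff₀ hn0]; exact hj1
        have hji : (0 : ℝ) ≤ (j : ℝ) / n - i / n := by
          rw [← sub_div]
          have : (i : ℝ) ≤ j := by exact_mod_cast hle
          apply div_nonneg _ hn0.le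
          linarith
        have hji1 : (j : ℝ) / n - i / n ≤ b - a := by
          rw [← sub_div, div_le_iff₀ hn0]; linarith
        have hji2 : b - a - 2 / n ≤ (j : ℝ) / n - i / n := by
          rw [← sub_div, le_div_iff₀ hn0, sub_mul, div_mul_cancel₀ _ hn0.ne']; linarith
        set δ := (j : ℝ) / n - i / n with hδ
        have hr1 : δ * k ≤ (b - a) * u := by
          apply mul_le_mul hji1 hk1 (Nat.cast_nonneg _); linarith
        have hr2 : (b - a) * u - c₁ ≤ δ * k := by
          have e1 : δ * u ≤ δ * (k + 1) := mul_le_mul_of_nonneg_left hk2.le hji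
          have e2 : (b - a - 2 / n) * u ≤ δ * u := mul_le_mul_of_nonneg_right hji2 hu
          have e3 : (b - a - 2 / n) * u = (b - a) * u - 2 * (u / n) := by ring
          rw [e3] at e2
          rw [mul_add, mul_one] at e1
          linarith
        have hs := hXB (δ * k) (by linarith)
        have := (abs_le.mp hg).1
        linarith
    · -- upper bound
      set i := ⌊a * n⌋₊ with hi
      set j := ⌈b * n⌉₊ with hj
      set k := ⌈u⌉₊ with hk
      have hi1 : (i : ℝ) ≤ a * n := Nat.floor_le han0
      have hi2 : a * n < i + 1 := Nat.lt_floor_add_one _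
      have hj1 : b * n ≤ j := Nat.le_ceil _
      have hj2 : (j : ℝ) < b * n + 1 := Nat.ceil_lt_add_one hbn0
      have hk1 : u ≤ k := Nat.le_ceil _
      have hk2 : (k : ℝ) < u + 1 := Nat.ceil_lt_add_one hu
      have hle : i ≤ j := by exact_mod_cast (hi1.trans (han.trans hj1))
      have hjT : j ≤ ⌈T * n⌉₊ := Nat.ceil_le_ceil hbn
      have hkB : k ≤ ⌈n * B⌉₊ := Nat.ceil_le_ceil huB
      have hir : i ∈ Finset.range (⌈T * n⌉₊ + 1) := Finset.mem_range.mpr (by omega)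
      have hjr : j ∈ Finset.range (⌈T * n⌉₊ + 1) := Finset.mem_range.mpr (by omega)
      have hkr : k ∈ Finset.range (⌈n * B⌉₊ + 1) := Finset.mem_range.mpr (by omega)
      clear_value i j k
      have hg := h m i hir j hjr k hkr hle
      have hmono : (ν (cell m a b u)).toReal ≤ (ν (cell m (i / n) (j / n) k)).toReal := by
        apply ENNReal.toReal_mono hg.1
        apply measure_mono
        apply cell_mono m _ _ hk1
        · rw [div_le_iff₀ hn0]; exact hi1
        · rw [le_div_iff₀ hn0]; exact hj1
      have hji1 : (j : ℝ) / n - i / n ≤ b - a + 2 / n := by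
        rw [← sub_div, div_le_iff₀ hn0, add_mul, div_mul_cancel₀ _ hn0.ne']; linarith
      have hji : (0 : ℝ) ≤ (j : ℝ) / n - i / n := by
        rw [← sub_div]
        have : (i : ℝ) ≤ j := by exact_mod_cast hle
        apply div_nonneg _ hn0.le
        linarith
      set δ := (j : ℝ) / n - i / n with hδ
      have hr1 : δ * k ≤ (b - a) * u + c₁ := by
        have e1 : δ * k ≤ δ * (u + 1) := by gcongr
        have e2 : δ * (u + 1) ≤ (b - a + 2 / n) * (u + 1) :=
          mul_le_mul_of_nonneg_right hji1 (by linarith)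
        have e3 : (b - a + 2 / n) * (u + 1) = (b - a) * u + (b - a) + 2 * (u / n) + 2 * (1 / n) := by
          ring
        linarith
      have hs := hXB (δ * k) hr1
      have := (abs_le.mp hg.2).2
      linarith

/-- A union bound over `O(n³)` grid cells, each failing with probability at most `2 n⁻⁵`: this is
the deviation bound with `L = log n` and `A = 6`. Uniformity over all cells is essential, because
the windows and prices of the algorithm depend on the past; the event covers whatever it chooses. -/
theorem IsPoissonRandomMeasure.exists_goodEvent [IsProbabilityMeasure P]
    (hN : IsPoissonRandomMeasure P (unitIntensity M) N) {T B : ℝ} (hT : 0 < T) (hB : 0 < B) :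
    ∃ C C' : ℝ, 0 < C ∧ 0 < C' ∧ ∀ n : ℕ, 3 ≤ n → ∃ S : Set Ω, MeasurableSet S ∧
      P.real S ≤ C' / (n : ℝ) ^ 2 ∧ ∀ ω ∉ S, IsGood T B C n (N ω) := by
  refine ⟨((2 * B + T + 4) + 6 * (√B + (2 * B + T + 4) + 2)) + B,
    M * ((T + 2) * ((T + 2) * ((B + 2) * 2))) + 1, by positivity, by positivity, ?_⟩
  · intro n hn
    have hn0 : (0 : ℝ) < n := by positivity
    have hn1 : (1 : ℝ) ≤ n := by exact_mod_cast (by omega : 1 ≤ n)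
    have hL : 0 < Real.log n := Real.log_pos (by exact_mod_cast (by omega : 1 < n))
    let bad : Fin M → ℕ → ℕ → ℕ → Set Ω := fun m i j k =>
      if i ≤ j then {ω | N ω (cell m (i / n) (j / n) k) = ∞ ∨
        6 * (√(((j : ℝ) / n - i / n) * k * Real.log n) + Real.log n) <
          |(N ω (cell m (i / n) (j / n) k)).toReal - ((j : ℝ) / n - i / n) * k|} else ∅
    have hbad : ∀ m i j k, P (bad m i j k) ≤ ENNReal.ofReal (2 * Real.exp ((1 - 6) * Real.log n)) := by
      intro m i j k
      by_cases hij : i ≤ j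
      · simp only [bad, if_pos hij]
        refine hN.cell_deviation m ?_ (Nat.cast_nonneg k) hL 6
        have : (i : ℝ) ≤ j := by exact_mod_cast hij
        gcongr
      · simp [bad, if_neg hij]
    have hexp : Real.exp ((1 - 6) * Real.log n) = 1 / (n : ℝ) ^ 5 := by
      rw [mul_comm, ← Real.rpow_def_of_pos hn0, show ((1 : ℝ) - 6) = -((5 : ℕ) : ℝ) by norm_num,
        Real.rpow_neg hn0.le, Real.rpow_natCast, one_div]
    rw [hexp] at hbad
    have hmeas : ∀ m i j k, MeasurableSet (bad m i j k) := by
      intro m i j k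
      by_cases hij : i ≤ j
      · simp only [bad, if_pos hij]
        have h1 := hN.measurable_apply (measurableSet_cell m (i / n : ℝ) (j / n) k)
        exact measurableSet_or (h1 (measurableSet_singleton ∞))
          (measurableSet_lt measurable_const (h1.ennreal_toReal.sub_const _).abs)
      · simp [bad, if_neg hij]
    refine ⟨⋃ m, ⋃ i ∈ Finset.range (⌈T * n⌉₊ + 1), ⋃ j ∈ Finset.range (⌈T * n⌉₊ + 1),
      ⋃ k ∈ Finset.range (⌈n * B⌉₊ + 1), bad m i j k, ?_, ?_, ?_⟩
    · exact MeasurableSet.iUnion fun m => Finset.measurableSet_biUnion _ fun i _ =>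
        Finset.measurableSet_biUnion _ fun j _ => Finset.measurableSet_biUnion _ fun k _ =>
          hmeas m i j k
    · have h1 : (⌈T * n⌉₊ : ℝ) + 1 ≤ (T + 2) * n := by
        have := Nat.ceil_lt_add_one (by positivity : 0 ≤ T * (n : ℝ))
        linarith
      have h2 : (⌈n * B⌉₊ : ℝ) + 1 ≤ (B + 2) * n := by
        have := Nat.ceil_lt_add_one (by positivity : 0 ≤ (n : ℝ) * B)
        linarith
      have hreal : ∀ m i j k, P.real (bad m i j k) ≤ 2 * (1 / (n : ℝ) ^ 5) := fun m i j k =>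
        ENNReal.toReal_le_of_le_ofReal (by positivity) (hbad m i j k)
      have h3 : ∀ m i j, P.real (⋃ k ∈ Finset.range (⌈n * B⌉₊ + 1), bad m i j k)
          ≤ (B + 2) * n * (2 * (1 / (n : ℝ) ^ 5)) := by
        intro m i j
        refine (measureReal_biUnion_finset_le _ _).trans ?_
        refine (Finset.sum_le_card_nsmul _ _ _ fun k _ => hreal m i j k).trans ?_
        rw [Finset.card_range, nsmul_eq_mul, Nat.cast_add, Nat.cast_one]
        gcongr
      have h4 : ∀ m i, P.real (⋃ j ∈ Finset.range (⌈T * n⌉₊ + 1),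
          ⋃ k ∈ Finset.range (⌈n * B⌉₊ + 1), bad m i j k)
          ≤ (T + 2) * n * ((B + 2) * n * (2 * (1 / (n : ℝ) ^ 5))) := by
        intro m i
        refine (measureReal_biUnion_finset_le _ _).trans ?_
        refine (Finset.sum_le_card_nsmul _ _ _ fun k _ => h3 m i k).trans ?_
        rw [Finset.card_range, nsmul_eq_mul, Nat.cast_add, Nat.cast_one]
        gcongr
      have h5 : ∀ m, P.real (⋃ i ∈ Finset.range (⌈T * n⌉₊ + 1),
          ⋃ j ∈ Finset.range (⌈T * n⌉₊ + 1), ⋃ k ∈ Finset.range (⌈n * B⌉₊ + 1), bad m i j k)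
          ≤ (T + 2) * n * ((T + 2) * n * ((B + 2) * n * (2 * (1 / (n : ℝ) ^ 5)))) := by
        intro m
        refine (measureReal_biUnion_finset_le _ _).trans ?_
        refine (Finset.sum_le_card_nsmul _ _ _ fun k _ => h4 m k).trans ?_
        rw [Finset.card_range, nsmul_eq_mul, Nat.cast_add, Nat.cast_one]
        gcongr
      refine (measureReal_iUnion_fintype_le _).trans ?_
      refine (Finset.sum_le_card_nsmul _ _ _ fun m _ => h5 m).trans ?_
      rw [Finset.card_univ, Fintype.card_fin, nsmul_eq_mul, le_div_iff₀ (by positivity)]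
      have : (M : ℝ) * ((T + 2) * n * ((T + 2) * n * ((B + 2) * n * (2 * (1 / (n : ℝ) ^ 5))))) * n ^ 2
          = M * ((T + 2) * ((T + 2) * ((B + 2) * 2))) := by
        field_simp
      rw [this]; linarith
    · intro ω hω
      apply isGood_of_grid hB hn
      intro m i hi j hj k hk hij
      simp only [mem_iUnion, not_exists] at hω
      have h1 := hω m i hi j hj k hk
      simp only [bad, if_pos hij, mem_ofPred_eq, not_or, not_lt] at h1
      exact h1

/-- Second moment of the number of points in the slab that contains all sales. -/
theorem IsPoissonRandomMeasure.integral_sq_slab_le [IsProbabilityMeasure P]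
    (hN : IsPoissonRandomMeasure P (unitIntensity M) N) {T B : ℝ} (hT : 0 < T) (hB : 0 < B)
    {n : ℕ} (hn : 1 ≤ n) :
    Integrable (fun ω => (N ω (slab M 0 T (n * B))).toReal ^ 2) P ∧
    ∫ ω, (N ω (slab M 0 T (n * B))).toReal ^ 2 ∂P ≤ 2 * n ^ 2 * Real.exp (2 * (M * (T * B))) := by
  have hn0 : (0 : ℝ) < n := by positivity
  set A := slab M 0 T (n * B) with hAdef
  have hA : MeasurableSet A := measurableSet_slab _ _ _
  have hfin : unitIntensity M A ≠ ∞ := by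
    rw [hAdef, unitIntensity_slab]
    exact ENNReal.mul_ne_top (by simp)
      (ENNReal.mul_ne_top ENNReal.ofReal_ne_top ENNReal.ofReal_ne_top)
  have hr : ((unitIntensity M A).toNNReal : ℝ) = n * (M * (T * B)) := by
    rw [hAdef, unitIntensity_slab, ENNReal.coe_toNNReal_eq_toReal, ENNReal.toReal_mul,
      ENNReal.toReal_mul, ENNReal.toReal_ofReal (by linarith),
      ENNReal.toReal_ofReal (by positivity), ENNReal.toReal_natCast]
    ring
  have hmY : Measurable fun ω => (N ω A).toReal := (hN.measurable_apply hA).ennreal_toReal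
  -- The mean count is of order `n`, so the exponential moment at `1 / n` is bounded uniformly in
  -- `n`; the square is dominated by `2 n²` times this exponential.
  have hexp : ∫⁻ ω, ENNReal.ofReal (Real.exp (1 / n * (N ω A).toReal)) ∂P
      ≤ ENNReal.ofReal (Real.exp (2 * (M * (T * B)))) := by
    have hg : Measurable fun y : ℝ≥0∞ => ENNReal.ofReal (Real.exp (1 / n * y.toReal)) := by
      fun_prop
    have h1 := lintegral_map (μ := P) hg (hN.measurable_apply hA)
    rw [← h1, hN.poisson A hA hfin, lintegral_map hg (by fun_prop)]
    simp only [ENNReal.toReal_natCast]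
    rw [lintegral_exp_poissonMeasure, hr]
    apply ENNReal.ofReal_le_ofReal
    apply Real.exp_le_exp.mpr
    have h2 : |(1 / n : ℝ)| ≤ 1 := by
      rw [abs_of_pos (by positivity), div_le_one hn0]; exact_mod_cast hn
    have h3 := Real.abs_exp_sub_one_le h2
    rw [abs_of_pos (by positivity : (0 : ℝ) < 1 / n)] at h3
    have h4 := (le_abs_self _).trans h3
    have h5 : (0 : ℝ) ≤ M * (T * B) := by positivity
    calc (n : ℝ) * (M * (T * B)) * (Real.exp (1 / n) - 1)
        ≤ n * (M * (T * B)) * (2 * (1 / n)) := by gcongr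
      _ = 2 * (M * (T * B)) := by field_simp
  have hpt : ∀ ω, (N ω A).toReal ^ 2 ≤ 2 * n ^ 2 * Real.exp (1 / n * (N ω A).toReal) := by
    intro ω
    have h0 : 0 ≤ (N ω A).toReal := ENNReal.toReal_nonneg
    have h1 := Real.quadratic_le_exp_of_nonneg (x := 1 / n * (N ω A).toReal) (by positivity)
    have h2 : (1 / n * (N ω A).toReal) ^ 2 / 2 ≤ Real.exp (1 / n * (N ω A).toReal) := by
      have : (0 : ℝ) ≤ 1 / n * (N ω A).toReal := by positivity
      linarith
    calc (N ω A).toReal ^ 2 = 2 * n ^ 2 * ((1 / n * (N ω A).toReal) ^ 2 / 2) := by field_simp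
      _ ≤ _ := by gcongr
  have hlin : ∫⁻ ω, ENNReal.ofReal ((N ω A).toReal ^ 2) ∂P
      ≤ ENNReal.ofReal (2 * n ^ 2 * Real.exp (2 * (M * (T * B)))) := by
    calc ∫⁻ ω, ENNReal.ofReal ((N ω A).toReal ^ 2) ∂P
        ≤ ∫⁻ ω, ENNReal.ofReal (2 * n ^ 2) * ENNReal.ofReal (Real.exp (1 / n * (N ω A).toReal)) ∂P := by
          apply lintegral_mono
          intro ω
          simp only
          rw [← ENNReal.ofReal_mul (by positivity)]
          exact ENNReal.ofReal_le_ofReal (hpt ω)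
      _ ≤ _ := by
          rw [lintegral_const_mul' _ _ ENNReal.ofReal_ne_top,
            ENNReal.ofReal_mul (p := 2 * (n : ℝ) ^ 2) (by positivity)]
          exact mul_le_mul_right hexp _
  have hint : Integrable (fun ω => (N ω A).toReal ^ 2) P := by
    refine ⟨(hmY.pow_const 2).aestronglyMeasurable, ?_⟩
    rw [hasFiniteIntegral_iff_ofReal (Eventually.of_forall fun ω => by positivity)]
    exact hlin.trans_lt ENNReal.ofReal_lt_top
  refine ⟨hint, ?_⟩
  rw [integral_eq_lintegral_of_nonneg_ae (Eventually.of_forall fun ω => by positivity)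
    hint.aestronglyMeasurable]
  exact ENNReal.toReal_le_of_le_ofReal (by positivity) hlin

end PersonalizedPricing

namespace PersonalizedPricing

/-! ### The parameters of the algorithm as monomials

With `y = n ^ (q / 20)`, `g = (log n) ^ ε` and `v = n ^ (1 / 4)` all parameters of a phase are
monomials in `y`, `g`, `v` and `log n`. -/

/-- `n ^ (q_j / 20)`. -/
noncomputable def phaseBase (n : ℕ) (j : ℕ) : ℝ := (n : ℝ) ^ ((3 / 5 : ℝ) ^ j / 20)

/-- `(log n) ^ ε`. -/
noncomputable def logPow (n : ℕ) (ε : ℝ) : ℝ := Real.log n ^ ε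

/-- `n ^ (1 / 4)`. -/
noncomputable def quarter (n : ℕ) : ℝ := (n : ℝ) ^ (1 / 4 : ℝ)

lemma one_le_log {n : ℕ} (hn : 3 ≤ n) : 1 ≤ Real.log n := by
  have hn0 : (0 : ℝ) < n := by positivity
  rw [Real.le_log_iff_exp_le hn0]
  have : (3 : ℝ) ≤ n := by exact_mod_cast hn
  linarith [Real.exp_one_lt_three]

lemma one_le_logPow {n : ℕ} (hn : 3 ≤ n) {ε : ℝ} (hε : 0 < ε) : 1 ≤ logPow n ε :=
  Real.one_le_rpow (one_le_log hn) hε.le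

lemma one_le_phaseBase {n : ℕ} (hn : 3 ≤ n) (j : ℕ) : 1 ≤ phaseBase n j :=
  Real.one_le_rpow (by exact_mod_cast (by omega : 1 ≤ n)) (by positivity)

lemma one_le_quarter {n : ℕ} (hn : 3 ≤ n) : 1 ≤ quarter n :=
  Real.one_le_rpow (by exact_mod_cast (by omega : 1 ≤ n)) (by positivity)

lemma log_rpow_add_mul {n : ℕ} (hn : 3 ≤ n) (ε : ℝ) (i k : ℕ) :
    Real.log n ^ ((i : ℝ) + k * ε) = Real.log n ^ i * logPow n ε ^ k := by
  have hL : 0 < Real.log n := by linarith [one_le_log hn]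
  rw [Real.rpow_add hL, Real.rpow_natCast, mul_comm (k : ℝ), Real.rpow_mul hL.le,
    Real.rpow_natCast, logPow]

lemma phaseBase_pow {n : ℕ} (j k : ℕ) :
    phaseBase n j ^ k = (n : ℝ) ^ ((3 / 5 : ℝ) ^ j / 20 * k) := by
  rw [phaseBase, Real.rpow_mul (Nat.cast_nonneg n), Real.rpow_natCast]

lemma quarter_pow {n : ℕ} (k : ℕ) : quarter n ^ k = (n : ℝ) ^ ((1 / 4 : ℝ) * k) := by
  rw [quarter, Real.rpow_mul (Nat.cast_nonneg n), Real.rpow_natCast]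

lemma quarter_pow_four (n : ℕ) : quarter n ^ 4 = n := by
  rw [quarter_pow]; norm_num

lemma width_eq {n : ℕ} (hn : 3 ≤ n) (j : ℕ) : width n j = phaseBase n j ^ 5 / quarter n := by
  have hn0 : (0 : ℝ) < n := by positivity
  rw [phaseBase_pow, quarter, ← Real.rpow_sub hn0, width]
  congr 1; push_cast; ring

/-- Passing to the next phase raises the base `y` to the power `3 / 5`, so `y ^ 5` turns into `y ^
3`. This expresses the target width of a phase in its own base. -/
lemma width_succ_eq {n : ℕ} (hn : 3 ≤ n) (j : ℕ) :
    width n (j + 1) = phaseBase n j ^ 3 / quarter n := by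
  have hn0 : (0 : ℝ) < n := by positivity
  rw [phaseBase_pow, quarter, ← Real.rpow_sub hn0, width]
  congr 1; push_cast; ring

lemma widthZ_eq {n : ℕ} (hn : 3 ≤ n) (ε : ℝ) (j : ℕ) :
    widthZ n ε j = width n j / logPow n ε ^ 2 := by
  have hL : 0 < Real.log n := by linarith [one_le_log hn]
  rw [widthZ, show -2 * ε = -(ε * (2 : ℕ)) by push_cast; ring, Real.rpow_neg hL.le,
    Real.rpow_mul hL.le, Real.rpow_natCast, logPow, div_eq_mul_inv]

lemma tau_eq {n : ℕ} (hn : 3 ≤ n) (ε : ℝ) (j : ℕ) :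
    tau n ε j = Real.log n * logPow n ε ^ 15 / phaseBase n j ^ 10 := by
  have hn0 : (0 : ℝ) < n := by positivity
  have h := log_rpow_add_mul hn ε 1 15
  push_cast at h
  rw [tau, h, pow_one, phaseBase_pow, div_eq_mul_inv _ ((n : ℝ) ^ _), ← Real.rpow_neg hn0.le, mul_comm]
  congr 2; push_cast; ring

lemma mul_tau_eq {n : ℕ} (hn : 3 ≤ n) (ε : ℝ) (j : ℕ) :
    n * tau n ε j = quarter n ^ 4 * Real.log n * logPow n ε ^ 15 / phaseBase n j ^ 10 := by
  rw [tau_eq hn, quarter_pow_four]; ring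

lemma gridN_eq {n : ℕ} (hn : 3 ≤ n) (ε : ℝ) (j : ℕ) :
    gridN n ε j = ⌈phaseBase n j ^ 2 * logPow n ε ^ 3⌉₊ := by
  have h := log_rpow_add_mul hn ε 0 3
  push_cast at h
  rw [zero_add, pow_zero, one_mul] at h
  rw [gridN, h, phaseBase_pow]
  congr 3; push_cast; ring

lemma gridZ_zero_eq {n : ℕ} (hn : 3 ≤ n) (ε : ℝ) :
    gridZ n ε 0 = ⌈phaseBase n 0 ^ 2 * logPow n ε ^ 3⌉₊ := by
  have h := log_rpow_add_mul hn ε 0 3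
  push_cast at h
  rw [zero_add, pow_zero, one_mul] at h
  rw [gridZ, if_pos rfl, h, phaseBase_pow]
  congr 3; norm_num

lemma gridZ_succ_eq (n : ℕ) (ε : ℝ) (j : ℕ) :
    gridZ n ε (j + 1) = ⌈phaseBase n (j + 1) ^ 2 * logPow n ε⌉₊ := by
  rw [gridZ, if_neg (Nat.succ_ne_zero j), phaseBase_pow, logPow]
  congr 3; push_cast; ring

lemma alpha_eq {n : ℕ} (hn : 3 ≤ n) (ε : ℝ) :
    alpha n ε = Real.log n * logPow n ε ^ 9 / quarter n := by
  have hn0 : (0 : ℝ) < n := by positivity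
  have h := log_rpow_add_mul hn ε 1 9
  push_cast at h
  rw [alpha, h, pow_one, quarter, div_eq_mul_inv _ ((n : ℝ) ^ _), ← Real.rpow_neg hn0.le]

lemma testLength_eq {n : ℕ} (hn : 3 ≤ n) (ε : ℝ) : testLength n ε = 1 / logPow n ε := by
  have hL : 0 < Real.log n := by linarith [one_le_log hn]
  rw [testLength, Real.rpow_neg hL.le, logPow, one_div]

lemma rate_eq {n : ℕ} (hn : 3 ≤ n) (ε : ℝ) :
    Real.log n ^ (2 + 18 * ε) * (n : ℝ) ^ (1 / 2 : ℝ)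
      = quarter n ^ 2 * Real.log n ^ 2 * logPow n ε ^ 18 := by
  have h := log_rpow_add_mul hn ε 2 18
  push_cast at h
  rw [h, quarter_pow, show (1 / 4 : ℝ) * (2 : ℕ) = 1 / 2 by norm_num]
  ring

lemma phaseBase_pow_five_le {n : ℕ} (hn : 3 ≤ n) (j : ℕ) : phaseBase n j ^ 5 ≤ quarter n := by
  have hn1 : (1 : ℝ) ≤ n := by exact_mod_cast (by omega : 1 ≤ n)
  rw [phaseBase_pow, quarter]
  apply Real.rpow_le_rpow_of_exponent_le hn1
  have : (3 / 5 : ℝ) ^ j ≤ 1 := pow_le_one₀ (by norm_num) (by norm_num)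
  push_cast; linarith

/-- The stopping criterion of the exploration in terms of the monomials. -/
lemma stop_iff {n : ℕ} (hn : 3 ≤ n) {ε : ℝ} (hε : 0 < ε) (j : ℕ) :
    width n j ^ 2 ≤ (n : ℝ) ^ (-(1 / 2) : ℝ) * Real.log n ^ (2 + 16 * ε) ↔
      phaseBase n j ^ 5 ≤ Real.log n * logPow n ε ^ 8 := by
  have hn0 : (0 : ℝ) < n := by positivity
  have hy := one_le_phaseBase hn j
  have hv := one_le_quarter hn
  have hg := one_le_logPow hn hε
  have hL := one_le_log hn
  have h := log_rpow_add_mul hn ε 2 16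
  push_cast at h
  have h2 : (n : ℝ) ^ (-(1 / 2) : ℝ) = 1 / quarter n ^ 2 := by
    rw [quarter_pow, one_div (_ ^ _), ← Real.rpow_neg hn0.le]
    congr 1; norm_num
  rw [h, h2, width_eq hn, div_pow, one_div, div_eq_inv_mul,
    mul_le_mul_iff_right₀ (by positivity),
    show Real.log n ^ 2 * logPow n ε ^ 16 = (Real.log n * logPow n ε ^ 8) ^ 2 by ring]
  exact pow_le_pow_iff_left₀ (by positivity) (by positivity) two_ne_zero

/-- By Bernoulli's inequality `(5 / 3) ^ j` grows at least linearly in `j`, so after about `log n`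
phases the exponent `log n · (3 / 5) ^ j` is at most `3 / 2` and `y ^ 5` is bounded by `2`. A
logarithmic number of phases is more than the double-logarithmic truth, but suffices. -/
lemma phaseBase_floor_log {n : ℕ} (hn : 3 ≤ n) (hL : 2 ≤ Real.log n) :
    phaseBase n ⌊Real.log n⌋₊ ^ 5 ≤ Real.log n := by
  have hn0 : (0 : ℝ) < n := by positivity
  set j := ⌊Real.log n⌋₊ with hj
  have h1 : Real.log n < j + 1 := Nat.lt_floor_add_one _
  have h2 : (1 : ℝ) + j * (2 / 3) ≤ (1 + 2 / 3) ^ j := one_add_mul_le_pow (by norm_num) j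
  have h3 : Real.log n * (3 / 5 : ℝ) ^ j ≤ 3 / 2 := by
    have h4 : (3 / 5 : ℝ) ^ j * (1 + 2 / 3) ^ j = 1 := by rw [← mul_pow]; norm_num
    have h5 : (0 : ℝ) < (3 / 5) ^ j := by positivity
    have h6 : Real.log n ≤ 3 / 2 * (1 + 2 / 3) ^ j := by
      have : (0 : ℝ) ≤ j := Nat.cast_nonneg j
      linarith
    nlinarith
  rw [phaseBase_pow, Real.rpow_def_of_pos hn0]
  calc Real.exp (Real.log n * ((3 / 5) ^ j / 20 * (5 : ℕ)))
      ≤ Real.exp (1 / 2) := by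
        apply Real.exp_le_exp.mpr; push_cast; linarith
    _ ≤ 2 := by
        have h7 : Real.exp (1 / 2) ^ 2 = Real.exp 1 := by rw [← Real.exp_nat_mul]; norm_num
        nlinarith [Real.exp_one_lt_three, Real.exp_pos (1 / 2)]
    _ ≤ _ := hL

lemma numExplore_nonempty {n : ℕ} (hn : 3 ≤ n) (hL : 2 ≤ Real.log n) {ε : ℝ} (hε : 0 < ε) :
    ⌊Real.log n⌋₊ ∈
      {j : ℕ | width n j ^ 2 ≤ (n : ℝ) ^ (-(1 / 2) : ℝ) * Real.log n ^ (2 + 16 * ε)} := by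
  rw [mem_ofPred_eq, stop_iff hn hε]
  refine (phaseBase_floor_log hn hL).trans ?_
  exact le_mul_of_one_le_right (by linarith) (one_le_pow₀ (one_le_logPow hn hε))

lemma numExplore_le_log {n : ℕ} (hn : 3 ≤ n) (hL : 2 ≤ Real.log n) {ε : ℝ} (hε : 0 < ε) :
    (numExplore n ε : ℝ) ≤ Real.log n := by
  have h1 : numExplore n ε ≤ ⌊Real.log n⌋₊ := Nat.sInf_le (numExplore_nonempty hn hL hε)
  exact (Nat.cast_le.mpr h1).trans (Nat.floor_le (by linarith))

lemma phaseBase_numExplore {n : ℕ} (hn : 3 ≤ n) (hL : 2 ≤ Real.log n) {ε : ℝ} (hε : 0 < ε) :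
    phaseBase n (numExplore n ε) ^ 5 ≤ Real.log n * logPow n ε ^ 8 :=
  (stop_iff hn hε _).mp (Nat.sInf_mem ⟨_, numExplore_nonempty hn hL hε⟩)

lemma lt_phaseBase_of_lt_numExplore {n : ℕ} (hn : 3 ≤ n) {ε : ℝ} (hε : 0 < ε) {j : ℕ}
    (hj : j < numExplore n ε) : Real.log n * logPow n ε ^ 8 < phaseBase n j ^ 5 := by
  by_contra h
  exact Nat.notMem_of_lt_sInf hj ((stop_iff hn hε j).mpr (not_lt.mp h))

lemma gridN_lower {n : ℕ} (hn : 3 ≤ n) (ε : ℝ) (j : ℕ) :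
    phaseBase n j ^ 2 * logPow n ε ^ 3 ≤ gridN n ε j + 1 := by
  rw [gridN_eq hn]
  linarith [Nat.le_ceil (phaseBase n j ^ 2 * logPow n ε ^ 3)]

lemma gridN_upper {n : ℕ} (hn : 3 ≤ n) {ε : ℝ} (hε : 0 < ε) (j : ℕ) :
    (gridN n ε j : ℝ) + 1 ≤ 3 * (phaseBase n j ^ 2 * logPow n ε ^ 3) := by
  have hy := one_le_phaseBase hn j
  have hg := one_le_logPow hn hε
  have h1 : 1 ≤ phaseBase n j ^ 2 * logPow n ε ^ 3 :=
    one_le_mul_of_one_le_of_one_le (one_le_pow₀ hy) (one_le_pow₀ hg)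
  rw [gridN_eq hn]
  linarith [Nat.ceil_lt_add_one (by linarith : 0 ≤ phaseBase n j ^ 2 * logPow n ε ^ 3)]

lemma tau_pos {n : ℕ} (hn : 3 ≤ n) {ε : ℝ} (hε : 0 < ε) (j : ℕ) : 0 < tau n ε j := by
  have hy := one_le_phaseBase hn j
  have hg := one_le_logPow hn hε
  have hL := one_le_log hn
  rw [tau_eq hn]; positivity

/-- Before the stopping criterion holds, `y ^ 5 > (log n) g ^ 8`; its square bounds the denominator
`y ^ 10` of `τ` from below. With at most `log n` phases, exploration therefore takes total time at
most `1 / g`, which tends to `0`. -/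
lemma tau_le {n : ℕ} (hn : 3 ≤ n) {ε : ℝ} (hε : 0 < ε) {j : ℕ} (hj : j < numExplore n ε) :
    tau n ε j ≤ 1 / (Real.log n * logPow n ε) := by
  have hy := one_le_phaseBase hn j
  have hg := one_le_logPow hn hε
  have hL := one_le_log hn
  have h := lt_phaseBase_of_lt_numExplore hn hε hj
  rw [tau_eq hn, div_le_div_iff₀ (by positivity) (by positivity), one_mul]
  calc Real.log n * logPow n ε ^ 15 * (Real.log n * logPow n ε)
      = (Real.log n * logPow n ε ^ 8) ^ 2 := by ring
    _ ≤ (phaseBase n j ^ 5) ^ 2 := by gcongr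
    _ = phaseBase n j ^ 10 := by ring

lemma phaseStart_nonneg {n : ℕ} (hn : 3 ≤ n) {ε : ℝ} (hε : 0 < ε) (j : ℕ) :
    0 ≤ phaseStart n ε j := Finset.sum_nonneg fun i _ => (tau_pos hn hε i).le

lemma phaseStart_mono {n : ℕ} (hn : 3 ≤ n) {ε : ℝ} (hε : 0 < ε) : Monotone (phaseStart n ε) := by
  apply monotone_nat_of_le_succ
  intro j
  rw [phaseStart, phaseStart, Finset.sum_range_succ]
  linarith [tau_pos hn hε j]

lemma lastStart_le {n : ℕ} (hn : 3 ≤ n) (hL : 2 ≤ Real.log n) {ε : ℝ} (hε : 0 < ε) :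
    lastStart n ε ≤ 1 / logPow n ε := by
  have hg := one_le_logPow hn hε
  have h1 : lastStart n ε ≤ ∑ _i ∈ Finset.range (numExplore n ε), 1 / (Real.log n * logPow n ε) :=
    Finset.sum_le_sum fun i hi => tau_le hn hε (Finset.mem_range.mp hi)
  rw [Finset.sum_const, Finset.card_range, nsmul_eq_mul] at h1
  refine h1.trans ?_
  calc (numExplore n ε : ℝ) * (1 / (Real.log n * logPow n ε))
      ≤ Real.log n * (1 / (Real.log n * logPow n ε)) := by
        have := numExplore_le_log hn hL hε
        gcongr
    _ = 1 / logPow n ε := by field_simp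

/-- Size of the relative error of the demand estimates of a phase. -/
lemma estimation_error_le {n : ℕ} (hn : 3 ≤ n) {ε : ℝ} (hε : 0 < ε) (j : ℕ) :
    (gridN n ε j + 1) / (n * tau n ε j) *
      (√(n * (tau n ε j / (gridN n ε j + 1)) * Real.log n) + Real.log n)
      ≤ 5 * (width n (j + 1) / logPow n ε ^ 3) ^ 2 := by
  have hy := one_le_phaseBase hn j
  have hg := one_le_logPow hn hε
  have hL := one_le_log hn
  have hv := one_le_quarter hn
  have hN := gridN_upper hn hε j
  have hyv := phaseBase_pow_five_le hn j
  have hτ := tau_pos hn hε j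
  have hn0 : (0 : ℝ) < n := by positivity
  set y := phaseBase n j
  set g := logPow n ε
  set L := Real.log n
  set v := quarter n with hvdef
  have hN0 : (0 : ℝ) < gridN n ε j + 1 := by positivity
  set X : ℝ := n * (tau n ε j / (gridN n ε j + 1)) with hX
  have hX0 : 0 < X := by positivity
  have h1 : (gridN n ε j + 1) / (n * tau n ε j) = 1 / X := by rw [hX]; field_simp
  have hw : (width n (j + 1) / g ^ 3) ^ 2 = y ^ 6 / (v ^ 2 * g ^ 6) := by
    rw [width_succ_eq hn, ← hvdef]; field_simp; rfl
  -- The target accuracy. With `X` the scale of the sales in one slot, the relative error is `√(L /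
  -- X) + L / X`. The grid size bound gives `L / X ≤ 3 w²`, and `w ≤ 1` absorbs the lower-order
  -- term.
  set w := (width n (j + 1) / g ^ 3) ^ 2 with hwdef
  have hw0 : 0 < w := by rw [hw]; positivity
  have hw1 : w ≤ 1 := by
    rw [hw, div_le_one (by positivity)]
    calc y ^ 6 ≤ y ^ 10 := pow_le_pow_right₀ hy (by norm_num)
      _ = (y ^ 5) ^ 2 := by ring
      _ ≤ v ^ 2 := by gcongr
      _ ≤ v ^ 2 * g ^ 6 := le_mul_of_one_le_right (by positivity) (one_le_pow₀ hg)
  have h2 : L / X ≤ 3 * w ^ 2 := by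
    have e : L / X = (gridN n ε j + 1) * (y ^ 10 / (v ^ 4 * g ^ 15)) := by
      rw [hX, ← mul_div_assoc, mul_tau_eq hn]
      change L / (v ^ 4 * L * g ^ 15 / y ^ 10 / (gridN n ε j + 1)) = _
      field_simp
    rw [e, hw]
    calc (gridN n ε j + 1 : ℝ) * (y ^ 10 / (v ^ 4 * g ^ 15))
        ≤ 3 * (y ^ 2 * g ^ 3) * (y ^ 10 / (v ^ 4 * g ^ 15)) := by gcongr
      _ = 3 * (y ^ 6 / (v ^ 2 * g ^ 6)) ^ 2 := by field_simp
  have h3 : 1 / X * (√(X * L) + L) = √(L / X) + L / X := by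
    rw [mul_add, one_div_mul_eq_div X L]
    congr 1
    rw [show L / X = X * L / X ^ 2 by field_simp, Real.sqrt_div (by positivity),
      Real.sqrt_sq hX0.le]
    ring
  have h4 : √(L / X) ≤ 2 * w := by
    apply Real.sqrt_le_iff.mpr
    constructor
    · positivity
    · nlinarith
  rw [h1, h3]
  nlinarith

/-- Size of the accumulated deviations of a phase. -/
lemma phase_deviation_le {n : ℕ} (hn : 3 ≤ n) {ε : ℝ} (hε : 0 < ε) (j : ℕ) :
    (gridN n ε j + 1) *
      (√(n * (tau n ε j / (gridN n ε j + 1)) * Real.log n) + Real.log n)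
      ≤ 5 * (quarter n ^ 2 * Real.log n * logPow n ε ^ 9) := by
  have hy := one_le_phaseBase hn j
  have hg := one_le_logPow hn hε
  have hL := one_le_log hn
  have hv := one_le_quarter hn
  have hN := gridN_upper hn hε j
  have hyv := phaseBase_pow_five_le hn j
  have hτ := tau_pos hn hε j
  have hn0 : (0 : ℝ) < n := by positivity
  set y := phaseBase n j
  set g := logPow n ε
  set L := Real.log n
  set v := quarter n with hvdef
  have hN0 : (0 : ℝ) < gridN n ε j + 1 := by positivity
  have h1 : (gridN n ε j + 1) * √(n * (tau n ε j / (gridN n ε j + 1)) * L)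
      ≤ 2 * (v ^ 2 * L * g ^ 9) := by
    rw [← Real.sqrt_sq hN0.le, ← Real.sqrt_mul (by positivity), Real.sqrt_sq hN0.le]
    apply Real.sqrt_le_iff.mpr
    refine ⟨by positivity, ?_⟩
    have e : ((gridN n ε j : ℝ) + 1) ^ 2 * (n * (tau n ε j / (gridN n ε j + 1)) * L)
        = (gridN n ε j + 1) * (v ^ 4 * L ^ 2 * g ^ 15 / y ^ 10) := by
      rw [← mul_div_assoc, mul_tau_eq hn]
      change ((gridN n ε j : ℝ) + 1) ^ 2 * (v ^ 4 * L * g ^ 15 / y ^ 10 / (gridN n ε j + 1) * L) = _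
      field_simp
    rw [e]
    calc (gridN n ε j + 1 : ℝ) * (v ^ 4 * L ^ 2 * g ^ 15 / y ^ 10)
        ≤ 3 * (y ^ 2 * g ^ 3) * (v ^ 4 * L ^ 2 * g ^ 15 / y ^ 10) := by gcongr
      _ = 3 * (v ^ 2 * L * g ^ 9) ^ 2 / y ^ 8 := by field_simp
      _ ≤ 3 * (v ^ 2 * L * g ^ 9) ^ 2 := div_le_self (by positivity) (one_le_pow₀ hy)
      _ ≤ (2 * (v ^ 2 * L * g ^ 9)) ^ 2 := by nlinarith [sq_nonneg (v ^ 2 * L * g ^ 9)]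
  have h2 : (gridN n ε j + 1) * L ≤ 3 * (v ^ 2 * L * g ^ 9) := by
    have e1 : y ^ 2 ≤ v ^ 2 := by
      calc y ^ 2 ≤ y ^ 10 := pow_le_pow_right₀ hy (by norm_num)
        _ = (y ^ 5) ^ 2 := by ring
        _ ≤ v ^ 2 := by gcongr
    have e2 : g ^ 3 ≤ g ^ 9 := pow_le_pow_right₀ hg (by norm_num)
    calc (gridN n ε j + 1 : ℝ) * L ≤ 3 * (y ^ 2 * g ^ 3) * L := by gcongr
      _ ≤ 3 * (v ^ 2 * g ^ 9) * L := by gcongr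
      _ = _ := by ring
  rw [mul_add]; linarith

/-- The powers of `y` cancel: shorter phases are run on wider intervals in such a way that every
phase incurs the same second-order loss, `√n` up to logarithms. -/
lemma mul_tau_mul_width_sq {n : ℕ} (hn : 3 ≤ n) (ε : ℝ) (j : ℕ) :
    n * tau n ε j * width n j ^ 2 = quarter n ^ 2 * Real.log n * logPow n ε ^ 15 := by
  have hy := one_le_phaseBase hn j
  have hv := one_le_quarter hn
  rw [mul_tau_eq hn, width_eq hn]
  field_simp

/-- The first-order effect of a phase on sales. It does not have the order of the final error, but
after summation over phases it stays below `n α = v³ (log n) g ^ 9`, where `v = n ^ (1 / 4)`, and so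
the last phase can compensate for it. -/
lemma mul_tau_mul_width_le {n : ℕ} (hn : 3 ≤ n) {ε : ℝ} (hε : 0 < ε) {j : ℕ}
    (hj : j < numExplore n ε) :
    n * tau n ε j * width n j ≤ quarter n ^ 3 * logPow n ε ^ 7 := by
  have hy := one_le_phaseBase hn j
  have hv := one_le_quarter hn
  have hg := one_le_logPow hn hε
  have hL := one_le_log hn
  have h := lt_phaseBase_of_lt_numExplore hn hε hj
  rw [mul_tau_eq hn, width_eq hn]
  rw [show quarter n ^ 4 * Real.log n * logPow n ε ^ 15 / phaseBase n j ^ 10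
    * (phaseBase n j ^ 5 / quarter n)
    = quarter n ^ 3 * logPow n ε ^ 7 * (Real.log n * logPow n ε ^ 8 / phaseBase n j ^ 5) by
      field_simp]
  apply mul_le_of_le_one_right (by positivity)
  rw [div_le_one (by positivity)]
  exact h.le

lemma width_pos {n : ℕ} (hn : 3 ≤ n) (j : ℕ) : 0 < width n j := by
  have hy := one_le_phaseBase hn j
  have hv := one_le_quarter hn
  rw [width_eq hn]; positivity

lemma width_zero (n : ℕ) : width n 0 = 1 := by simp [width]

/-- The stopping rule makes the markup `α` larger than the final uncertainty by a factor `g`. Hence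
the last prices lie on known sides of the optimum at distance of order exactly `α`. -/
lemma width_numExplore_le {n : ℕ} (hn : 3 ≤ n) (hL : 2 ≤ Real.log n) {ε : ℝ} (hε : 0 < ε) :
    width n (numExplore n ε) ≤ alpha n ε / logPow n ε := by
  have hv := one_le_quarter hn
  have hg := one_le_logPow hn hε
  rw [width_eq hn, alpha_eq hn]
  calc phaseBase n (numExplore n ε) ^ 5 / quarter n
      ≤ Real.log n * logPow n ε ^ 8 / quarter n := by
        have := phaseBase_numExplore hn hL hε
        gcongr
    _ = _ := by field_simp

/-- The grid resolves distances `g³` times smaller than the next interval; these powers of `g` later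
beat the constants of the accuracy bounds. -/
lemma width_div_gridN_le {n : ℕ} (hn : 3 ≤ n) {ε : ℝ} (hε : 0 < ε) (j : ℕ) :
    width n j / (gridN n ε j + 1) ≤ width n (j + 1) / logPow n ε ^ 3 := by
  have hy := one_le_phaseBase hn j
  have hv := one_le_quarter hn
  have hg := one_le_logPow hn hε
  rw [width_eq hn, width_succ_eq hn]
  calc phaseBase n j ^ 5 / quarter n / (gridN n ε j + 1)
      ≤ phaseBase n j ^ 5 / quarter n / (phaseBase n j ^ 2 * logPow n ε ^ 3) := by
        have := gridN_lower hn ε j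
        gcongr
    _ = _ := by field_simp

lemma inv_gridZ_zero_le {n : ℕ} (hn : 3 ≤ n) {ε : ℝ} (hε : 0 < ε) :
    1 / ((gridZ n ε 0 : ℝ) + 1) ≤ width n (0 + 1) / logPow n ε ^ 3 := by
  have h := width_div_gridN_le hn hε 0
  rwa [width_zero, gridN_eq hn, ← gridZ_zero_eq hn] at h

/-- After the first phase the dual interval is narrower by `g²` and its grid has only one factor
`g`, so the resolution agrees with that of the prices. -/
lemma widthZ_div_gridZ_le {n : ℕ} (hn : 3 ≤ n) {ε : ℝ} (hε : 0 < ε) (j : ℕ) :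
    widthZ n ε (j + 1) / ((gridZ n ε (j + 1) : ℝ) + 1) ≤ width n (j + 2) / logPow n ε ^ 3 := by
  have hy := one_le_phaseBase hn (j + 1)
  have hv := one_le_quarter hn
  have hg := one_le_logPow hn hε
  rw [widthZ_eq hn, width_eq hn, width_succ_eq hn, gridZ_succ_eq]
  calc phaseBase n (j + 1) ^ 5 / quarter n / logPow n ε ^ 2 /
        (⌈phaseBase n (j + 1) ^ 2 * logPow n ε⌉₊ + 1)
      ≤ phaseBase n (j + 1) ^ 5 / quarter n / logPow n ε ^ 2 /
        (phaseBase n (j + 1) ^ 2 * logPow n ε) := by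
        have := Nat.le_ceil (phaseBase n (j + 1) ^ 2 * logPow n ε)
        gcongr
        linarith
    _ = _ := by field_simp

/-! ### Asymptotics of the parameters -/

lemma tendsto_log_natCast : Tendsto (fun n : ℕ => Real.log n) atTop atTop :=
  Real.tendsto_log_atTop.comp tendsto_natCast_atTop_atTop

lemma tendsto_logPow {ε : ℝ} (hε : 0 < ε) : Tendsto (fun n : ℕ => logPow n ε) atTop atTop :=
  (tendsto_rpow_atTop hε).comp tendsto_log_natCast

lemma tendsto_alpha (ε : ℝ) : Tendsto (fun n : ℕ => alpha n ε) atTop (nhds 0) := by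
  have h := (isLittleO_log_rpow_rpow_atTop (1 + 9 * ε) (by norm_num : (0 : ℝ) < 1 / 4)).tendsto_div_nhds_zero
  have h2 := h.comp tendsto_natCast_atTop_atTop
  refine h2.congr fun n => ?_
  simp only [Function.comp_apply]
  rw [alpha, Real.rpow_neg (Nat.cast_nonneg n), div_eq_mul_inv]

end PersonalizedPricing

namespace PersonalizedPricing

/-! ### Accuracy of the estimators of a phase -/

section MinIdx

variable {sel : Finset ℕ → ℕ} (hsel : ∀ s : Finset ℕ, s.Nonempty → sel s ∈ s) (k : ℕ) (f : ℕ → ℝ)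

include hsel

lemma minIdx_spec : minIdx sel k f ∈ Finset.range (k + 1) ∧
    ∀ i ∈ Finset.range (k + 1), f (minIdx sel k f) ≤ f i := by
  obtain ⟨i, hi, hmin⟩ := Finset.exists_min_image (Finset.range (k + 1)) f
    Finset.nonempty_range_add_one
  -- Stated for any finset with the right members, so that the decidability instance inside `minIdx`
  -- plays no role.
  have key : ∀ S : Finset ℕ,
      (∀ x, x ∈ S ↔ x ∈ Finset.range (k + 1) ∧ ∀ j ∈ Finset.range (k + 1), f x ≤ f j) →
      sel S ∈ Finset.range (k + 1) ∧ ∀ j ∈ Finset.range (k + 1), f (sel S) ≤ f j :=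
    fun S hS => (hS _).mp (hsel S ⟨i, (hS i).mpr ⟨hi, hmin⟩⟩)
  exact key _ fun x => by simp only [Finset.mem_filter]

lemma maxIdx_spec : maxIdx sel k f ∈ Finset.range (k + 1) ∧
    ∀ i ∈ Finset.range (k + 1), f i ≤ f (maxIdx sel k f) := by
  have h := minIdx_spec hsel k fun i => -f i
  exact ⟨h.1, fun i hi => neg_le_neg_iff.mp (h.2 i hi)⟩

end MinIdx

lemma exists_grid_near {lo hi x : ℝ} (hx : x ∈ Icc lo hi) (k : ℕ) :
    ∃ i ∈ Finset.range (k + 1), |lo + i * ((hi - lo) / (k + 1)) - x| ≤ (hi - lo) / (k + 1) := by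
  set δ := (hi - lo) / ((k : ℝ) + 1) with hδ
  have hk : (0 : ℝ) < (k : ℝ) + 1 := by positivity
  have hlohi : lo ≤ hi := hx.1.trans hx.2
  rcases hlohi.eq_or_lt with heq | hlt
  · refine ⟨0, by simp, ?_⟩
    have hx' : x = lo := le_antisymm (heq ▸ hx.2) hx.1
    have : δ = 0 := by rw [hδ, heq]; simp
    simp [this, hx']
  · have hδ0 : 0 < δ := div_pos (sub_pos.mpr hlt) hk
    have hδk : ((k : ℝ) + 1) * δ = hi - lo := by rw [hδ]; field_simp
    have hx0 : 0 ≤ (x - lo) / δ := div_nonneg (sub_nonneg.mpr hx.1) hδ0.le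
    have hxδ : (x - lo) / δ * δ = x - lo := by field_simp
    by_cases hle : ⌊(x - lo) / δ⌋₊ ≤ k
    · refine ⟨⌊(x - lo) / δ⌋₊, Finset.mem_range.mpr (by omega), ?_⟩
      have h1 := Nat.floor_le hx0
      have h2 := Nat.lt_floor_add_one ((x - lo) / δ)
      rw [abs_le]
      constructor <;> nlinarith
    -- The grid omits the right endpoint. This case occurs only for `x = hi`, which is exactly one
    -- step from the last grid point.
    · refine ⟨k, Finset.mem_range.mpr (by omega), ?_⟩
      have h1 : (k : ℝ) + 1 ≤ (x - lo) / δ := by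
        refine le_trans ?_ (Nat.floor_le hx0)
        exact_mod_cast not_le.mp hle
      have h2 := hx.2
      rw [abs_le]
      constructor <;> nlinarith

lemma grid_mem_Icc {lo hi : ℝ} (h : lo ≤ hi) {k i : ℕ} (hi' : i ∈ Finset.range (k + 1)) :
    lo + i * ((hi - lo) / (k + 1)) ∈ Icc lo hi := by
  have hk : (0 : ℝ) < (k : ℝ) + 1 := by positivity
  have h1 : (i : ℝ) ≤ (k : ℝ) + 1 := by exact_mod_cast (Finset.mem_range.mp hi').le
  have h2 : 0 ≤ (hi - lo) / ((k : ℝ) + 1) := div_nonneg (sub_nonneg.mpr h) hk.le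
  have h3 : ((k : ℝ) + 1) * ((hi - lo) / (k + 1)) = hi - lo := by field_simp
  have h4 := mul_le_mul_of_nonneg_right h1 h2
  have h5 : 0 ≤ (i : ℝ) * ((hi - lo) / (k + 1)) := by positivity
  constructor <;> linarith

variable {M : ℕ} {F : FirmInfo} {d : Fin M → ℝ → ℝ} {pInf zS : ℝ} {pS : Fin M → ℝ} {a b l B : ℝ}

/-- Changing the cost from `zS` to `z` adds `-(z - zS) d_m(p)`. Replacing `d_m(p)` by `d_m(pS m)`
isolates the part linear in `z`, which cancels against `c z` in the dual; the cross term comes from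
the Lipschitz bound. -/
lemma MarketBounds.profit_le (h : MarketBounds F d pInf zS pS a b l B) (m : Fin M) {p : ℝ}
    (hp : p ∈ Icc 0 pInf) (z : ℝ) :
    d m p * (p - z) ≤ d m (pS m) * (pS m - zS) - (z - zS) * d m (pS m)
      + l * |z - zS| * |p - pS m| - a * (p - pS m) ^ 2 := by
  have h1 := h.gap_lower m p hp
  have h2 : -(z - zS) * (d m p - d m (pS m)) ≤ |z - zS| * (l * |p - pS m|) := by
    calc _ ≤ |-(z - zS) * (d m p - d m (pS m))| := le_abs_self _
      _ = |z - zS| * |d m p - d m (pS m)| := by rw [abs_mul, abs_neg]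
      _ ≤ _ := by have := h.lip m p hp; gcongr
  nlinarith

lemma MarketBounds.profit_ge (h : MarketBounds F d pInf zS pS a b l B) (m : Fin M) {p : ℝ}
    (hp : p ∈ Icc 0 pInf) (z : ℝ) :
    d m (pS m) * (pS m - zS) - (z - zS) * d m (pS m)
      - l * |z - zS| * |p - pS m| - b * (p - pS m) ^ 2 ≤ d m p * (p - z) := by
  have h1 := h.gap_upper m p hp
  have h2 : (z - zS) * (d m p - d m (pS m)) ≤ |z - zS| * (l * |p - pS m|) := by
    calc _ ≤ |(z - zS) * (d m p - d m (pS m))| := le_abs_self _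
      _ = |z - zS| * |d m p - d m (pS m)| := by rw [abs_mul]
      _ ≤ _ := by have := h.lip m p hp; gcongr
  nlinarith

/-- Prices near `pS + η (z - zS)` earn more than the linearization of the dual at `zS` predicts. -/
lemma MarketBounds.profit_ge_test (h : MarketBounds F d pInf zS pS a b l B) (m : Fin M)
    {p z η δ : ℝ} (hp : p ∈ Icc 0 pInf) (hη : 0 < η) (hηb : b * (4 * l * η) ≤ 1)
    (hpδ : |p - (pS m + η * (z - zS))| ≤ δ) :
    d m (pS m) * (pS m - zS) - (z - zS) * d m (pS m)
      + η / (4 * l) * (z - zS) ^ 2 - (1 / (2 * l * η) + l ^ 3 / η) * δ ^ 2 ≤ d m p * (p - z) := by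
  have hl := h.l_pos
  set w := z - zS
  set x := p - pS m with hx
  set r := x - η * w with hr
  have hrδ : |r| ≤ δ := by rw [hr, hx]; convert hpδ using 2; ring
  have hr2 : r ^ 2 ≤ δ ^ 2 := by rw [← sq_abs]; gcongr
  have h1 := h.gap_upper m p hp
  have h2 := h.expand m p hp
  have h3 := h.lip m p hp
  rw [← hx] at h1 h2 h3
  set D := d m (pS m) - d m p with hD
  have h4 : r * D ≤ δ * (l * |x|) := by
    calc r * D ≤ |r * D| := le_abs_self _
      _ = |r| * |D| := abs_mul _ _
      _ ≤ δ * (l * |x|) := by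
        have : 0 ≤ δ := (abs_nonneg _).trans hrδ
        rw [abs_sub_comm, ← hD] at h3
        gcongr
  -- the first-order gain
  have h5 : (x ^ 2 / l - δ * (l * |x|)) / η ≤ w * D := by
    rw [div_le_iff₀ hη]
    have : w * D * η = D * x - r * D := by rw [hr]; ring
    linarith
  -- Smallness of `η` makes the curvature loss at most a quarter of the first-order gain `x² / (l
  -- η)`. Another quarter pays for the rounding term `h7`, and the remaining half is the growth in
  -- `w²` kept in `h8`.
  have h6 : b * x ^ 2 ≤ x ^ 2 / (4 * l * η) := by
    rw [le_div_iff₀ (by positivity)]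
    nlinarith [sq_nonneg x]
  have h7 : δ * (l * |x|) / η ≤ x ^ 2 / (4 * l * η) + l ^ 3 / η * δ ^ 2 := by
    rw [← sq_abs x]
    have e : |x| ^ 2 / (4 * l * η) + l ^ 3 / η * δ ^ 2 - δ * (l * |x|) / η
        = (|x| - 2 * l ^ 2 * δ) ^ 2 / (4 * l * η) := by
      field_simp; ring
    have : 0 ≤ (|x| - 2 * l ^ 2 * δ) ^ 2 / (4 * l * η) := by positivity
    linarith
  have h8 : η / (4 * l) * w ^ 2 - 1 / (2 * l * η) * δ ^ 2 ≤ x ^ 2 / (2 * l * η) := by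
    have e1 : (η * w) ^ 2 ≤ 2 * x ^ 2 + 2 * δ ^ 2 := by
      have : η * w = x - r := by rw [hr]; ring
      rw [this]
      nlinarith [sq_nonneg (x + r)]
    have e2 : η / (4 * l) * w ^ 2 - 1 / (2 * l * η) * δ ^ 2
        = ((η * w) ^ 2 - 2 * δ ^ 2) / (4 * l * η) := by field_simp; ring
    have e3 : x ^ 2 / (2 * l * η) = 2 * x ^ 2 / (4 * l * η) := by field_simp; norm_num
    rw [e2, e3]
    gcongr
    linarith
  have e4 : (x ^ 2 / l - δ * (l * |x|)) / η
      = 2 * (x ^ 2 / (4 * l * η)) + x ^ 2 / (2 * l * η) - δ * (l * |x|) / η := by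
    field_simp; ring
  have e5 : d m p * (p - z) = d m p * (p - zS) - w * d m (pS m) + w * D := by
    simp only [w, hD]; ring
  rw [e5]
  linarith

/-- Constant in the accuracy of the estimators. -/
noncomputable def accuracyConst (pInf zHi a l η : ℝ) : ℝ :=
  4 * l / η * ((1 / (2 * l * η) + l ^ 3 / η) + l ^ 2 / (4 * a) + 2 * (pInf + zHi))

lemma MarketBounds.accuracyConst_nonneg (h : MarketBounds F d pInf zS pS a b l B) {η : ℝ}
    (hη : 0 < η) (hM : Nonempty (Fin M)) : 0 ≤ accuracyConst pInf F.zHi a l η := by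
  have h1 := h.l_pos
  have h2 := h.a_pos
  have h3 := h.z_pos.trans h.z_lt
  have h4 := (h.pS_mem_Icc hM.some).1.trans (h.pS_mem_Icc hM.some).2
  unfold accuracyConst
  positivity

section Estimators

variable {sel : Finset ℕ → ℕ} {n : ℕ} {ε : ℝ} {obs : Fin M → ℝ → ℝ → ℝ → ℝ} {j : ℕ}
  {s : PhaseState M} {η e δ δz : ℝ}

/-- The information available in a phase is consistent with the optimum and the demand estimates
have error at most `e`. -/
structure PhaseHyp (F : FirmInfo) (d : Fin M → ℝ → ℝ) (zS : ℝ) (pS : Fin M → ℝ) (n : ℕ) (ε : ℝ)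
    (obs : Fin M → ℝ → ℝ → ℝ → ℝ) (j : ℕ) (s : PhaseState M) (η e δ δz : ℝ) : Prop where
  z_nonneg : 0 ≤ s.zl
  zl_le : s.zl ≤ zS
  le_zu : zS ≤ s.zu
  z_le : s.zu ≤ F.zHi
  p_ge : ∀ m, F.pLo ≤ s.pl m
  pl_le : ∀ m, s.pl m ≤ pS m - η * (s.zu - s.zl)
  le_pu : ∀ m, pS m + η * (s.zu - s.zl) ≤ s.pu m
  p_le : ∀ m, s.pu m ≤ F.pHi
  step : ∀ m, (s.pu m - s.pl m) / (gridN n ε j + 1) ≤ δ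
  stepZ : (s.zu - s.zl) / (gridZ n ε j + 1) ≤ δz
  err : ∀ m, ∀ i ∈ Finset.range (gridN n ε j + 1),
    |demandEst n ε obs j s m i - d m (gridPrice n ε j s m i)| ≤ e

variable (h : MarketBounds F d pInf zS pS a b l B)
  (H : PhaseHyp F d zS pS n ε obs j s η e δ δz) (hη : 0 < η) (hηb : b * (4 * l * η) ≤ 1)
  (hsel : ∀ s : Finset ℕ, s.Nonempty → sel s ∈ s)

lemma zEst_mem {F : FirmInfo} {s : PhaseState M}
    (hsel : ∀ s : Finset ℕ, s.Nonempty → sel s ∈ s) (hs : s.zl ≤ s.zu) :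
    zEst F sel n ε obs j s ∈ Icc s.zl s.zu :=
  grid_mem_Icc hs (minIdx_spec hsel _ _).1

lemma pEst_mem {F : FirmInfo} {s : PhaseState M}
    (hsel : ∀ s : Finset ℕ, s.Nonempty → sel s ∈ s) {m : Fin M} (hs : s.pl m ≤ s.pu m) :
    pEst F sel n ε obs j s m ∈ Icc (s.pl m) (s.pu m) :=
  grid_mem_Icc hs (maxIdx_spec hsel _ _).1

include H hη

lemma PhaseHyp.pl_le_pu (m : Fin M) : s.pl m ≤ s.pu m := by
  have h1 : 0 ≤ η * (s.zu - s.zl) := mul_nonneg hη.le (by linarith [H.zl_le, H.le_zu])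
  linarith [H.pl_le m, H.le_pu m]

include h

lemma PhaseHyp.gridPrice_mem (m : Fin M) {i : ℕ} (hi : i ∈ Finset.range (gridN n ε j + 1)) :
    gridPrice n ε j s m i ∈ Icc 0 pInf := by
  have h1 := grid_mem_Icc (H.pl_le_pu hη m) hi
  exact ⟨h.pLo_nonneg.trans ((H.p_ge m).trans h1.1), (h1.2.trans (H.p_le m)).trans h.pHi_le⟩

lemma PhaseHyp.profitEst_err (m : Fin M) {i : ℕ} (hi : i ∈ Finset.range (gridN n ε j + 1)) {z : ℝ}
    (hz : z ∈ Icc 0 F.zHi) :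
    |profitEst n ε obs j s m z i - d m (gridPrice n ε j s m i) * (gridPrice n ε j s m i - z)|
      ≤ e * (pInf + F.zHi) := by
  have h1 := H.gridPrice_mem h hη m hi
  have h2 : |gridPrice n ε j s m i - z| ≤ pInf + F.zHi := by
    rw [abs_le]; constructor <;> linarith [h1.1, h1.2, hz.1, hz.2]
  have h3 := H.err m i hi
  rw [profitEst, ← sub_mul, abs_mul]
  have : 0 ≤ e := (abs_nonneg _).trans h3
  gcongr

/-- For every price, `l |z - zS| |x| - a x²` is at most `l² (z - zS)² / (4 a)`, so the maximum over
the grid exceeds the linearization only quadratically. The slackness identity cancels the linear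
terms. -/
lemma PhaseHyp.dualEst_le {z : ℝ} (hz : z ∈ Icc 0 F.zHi) :
    dualEst F n ε obs j s z ≤ F.c * zS + F.T * ∑ m, d m (pS m) * (pS m - zS)
      + F.T * M * (l ^ 2 / (4 * a) * (z - zS) ^ 2 + e * (pInf + F.zHi)) := by
  have ha := h.a_pos
  have h1 : ∀ m, (Finset.range (gridN n ε j + 1)).sup' Finset.nonempty_range_add_one
      (profitEst n ε obs j s m z) ≤ d m (pS m) * (pS m - zS) - (z - zS) * d m (pS m)
        + (l ^ 2 / (4 * a) * (z - zS) ^ 2 + e * (pInf + F.zHi)) := by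
    intro m
    apply Finset.sup'_le
    intro i hi
    have h2 := (abs_le.mp (H.profitEst_err h hη m hi hz)).2
    have h3 := h.profit_le m (H.gridPrice_mem h hη m hi) z
    set x := gridPrice n ε j s m i - pS m
    have h4 : l * |z - zS| * |x| - a * x ^ 2 ≤ l ^ 2 / (4 * a) * (z - zS) ^ 2 := by
      rw [← sq_abs x, ← sq_abs (z - zS)]
      have e1 : l ^ 2 / (4 * a) * |z - zS| ^ 2 - (l * |z - zS| * |x| - a * |x| ^ 2)
          = (2 * a * |x| - l * |z - zS|) ^ 2 / (4 * a) := by field_simp; ring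
      have : 0 ≤ (2 * a * |x| - l * |z - zS|) ^ 2 / (4 * a) := by positivity
      linarith
    linarith
  have h2 := mul_le_mul_of_nonneg_left (Finset.sum_le_sum fun m (_ : m ∈ Finset.univ) => h1 m)
    h.T_pos.le
  rw [Finset.sum_add_distrib, Finset.sum_sub_distrib, ← Finset.mul_sum, Finset.sum_const,
    Finset.card_univ, Fintype.card_fin, nsmul_eq_mul] at h2
  rw [dualEst]
  have h3 := h.slack
  have h4 : F.c * (z - zS) = F.T * ((z - zS) * ∑ m, d m (pS m)) := by rw [h3]; ring
  nlinarith

include hηb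

/-- Quadratic growth of the dual away from `zS`, the property that identifies `zS`. The growth is
produced by the grid price nearest to `pS m + η (z - zS)`; the margins `η (zu - zl)` in `PhaseHyp`
exist to keep this test price inside the price interval. -/
lemma PhaseHyp.le_dualEst {z : ℝ} (hz : z ∈ Icc s.zl s.zu) :
    F.c * zS + F.T * ∑ m, d m (pS m) * (pS m - zS)
      + F.T * M * (η / (4 * l) * (z - zS) ^ 2 - (1 / (2 * l * η) + l ^ 3 / η) * δ ^ 2
        - e * (pInf + F.zHi)) ≤ dualEst F n ε obs j s z := by
  have hl := h.l_pos
  have h1 : ∀ m, d m (pS m) * (pS m - zS) - (z - zS) * d m (pS m)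
      + (η / (4 * l) * (z - zS) ^ 2 - (1 / (2 * l * η) + l ^ 3 / η) * δ ^ 2
        - e * (pInf + F.zHi)) ≤ (Finset.range (gridN n ε j + 1)).sup'
          Finset.nonempty_range_add_one (profitEst n ε obs j s m z) := by
    intro m
    have hmem : pS m + η * (z - zS) ∈ Icc (s.pl m) (s.pu m) := by
      have e1 : η * (z - zS) ≤ η * (s.zu - s.zl) := by
        apply mul_le_mul_of_nonneg_left _ hη.le; linarith [hz.2, H.zl_le]
      have e2 : -(η * (s.zu - s.zl)) ≤ η * (z - zS) := by
        rw [← mul_neg]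
        apply mul_le_mul_of_nonneg_left _ hη.le; linarith [hz.1, H.le_zu]
      constructor <;> linarith [H.pl_le m, H.le_pu m]
    obtain ⟨i, hi, hnear⟩ := exists_grid_near hmem (gridN n ε j)
    refine le_trans ?_ (Finset.le_sup' _ hi)
    have h2 := (abs_le.mp (H.profitEst_err h hη m hi
      ⟨H.z_nonneg.trans hz.1, hz.2.trans H.z_le⟩)).1
    have h3 := h.profit_ge_test m (H.gridPrice_mem h hη m hi) hη hηb (hnear.trans (H.step m))
    linarith
  have h2 := mul_le_mul_of_nonneg_left (Finset.sum_le_sum fun m (_ : m ∈ Finset.univ) => h1 m)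
    h.T_pos.le
  rw [Finset.sum_add_distrib, Finset.sum_sub_distrib, ← Finset.mul_sum, Finset.sum_const,
    Finset.card_univ, Fintype.card_fin, nsmul_eq_mul] at h2
  rw [dualEst]
  have h3 := h.slack
  have h4 : F.c * (z - zS) = F.T * ((z - zS) * ∑ m, d m (pS m)) := by rw [h3]; ring
  nlinarith

include hsel

/-- The estimator does no worse on the empirical dual than the grid point nearest to `zS`. Quadratic
growth from below at the former and the quadratic bound from above at the latter then bound its
squared distance to `zS`. -/
lemma PhaseHyp.zEst_accuracy :
    (zEst F sel n ε obs j s - zS) ^ 2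
      ≤ accuracyConst pInf F.zHi a l η * (e + δ ^ 2 + δz ^ 2) := by
  have hl := h.l_pos
  have ha := h.a_pos
  have hM : (0 : ℝ) < M := by exact_mod_cast h.M_pos
  have hT := h.T_pos
  have m0 : Fin M := ⟨0, h.M_pos⟩
  have hpI : 0 ≤ pInf := (h.pS_mem_Icc m0).1.trans (h.pS_mem_Icc m0).2
  have hzHi : 0 < F.zHi := h.z_pos.trans h.z_lt
  have he : 0 ≤ e := (abs_nonneg _).trans (H.err m0 0 (by simp))
  have hmem := zEst_mem (F := F) (n := n) (ε := ε) (obs := obs) (j := j) hsel (H.zl_le.trans H.le_zu)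
  obtain ⟨i, hi, hnear⟩ := exists_grid_near (x := zS) ⟨H.zl_le, H.le_zu⟩ (gridZ n ε j)
  have h1 := (minIdx_spec hsel (gridZ n ε j)
    fun i => dualEst F n ε obs j s (gridDual n ε j s i)).2 i hi
  have h2 := H.le_dualEst h hη hηb hmem
  have hi' := grid_mem_Icc (H.zl_le.trans H.le_zu) hi
  have h3 := H.dualEst_le h hη (z := gridDual n ε j s i)
    ⟨H.z_nonneg.trans hi'.1, hi'.2.trans H.z_le⟩
  have h4 : (gridDual n ε j s i - zS) ^ 2 ≤ δz ^ 2 := by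
    rw [← sq_abs]
    have := hnear.trans H.stepZ
    exact pow_le_pow_left₀ (abs_nonneg _) this 2
  have h5 := (h2.trans h1).trans h3
  have h6 : F.T * M * (η / (4 * l) * (zEst F sel n ε obs j s - zS) ^ 2
      - (1 / (2 * l * η) + l ^ 3 / η) * δ ^ 2 - e * (pInf + F.zHi)) ≤
      F.T * M * (l ^ 2 / (4 * a) * (gridDual n ε j s i - zS) ^ 2 + e * (pInf + F.zHi)) := by
    linarith
  have h7 := le_of_mul_le_mul_left h6 (by positivity)
  set w2 := (zEst F sel n ε obs j s - zS) ^ 2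
  set K := 1 / (2 * l * η) + l ^ 3 / η with hK
  have hK0 : 0 ≤ K := by positivity
  set A := l ^ 2 / (4 * a) with hA
  have hA0 : 0 ≤ A := by positivity
  have h8 : A * (gridDual n ε j s i - zS) ^ 2 ≤ A * δz ^ 2 := by gcongr
  have h9 : η / (4 * l) * w2 ≤ (K + A + 2 * (pInf + F.zHi)) * (e + δ ^ 2 + δz ^ 2) := by
    have e1 : 0 ≤ (pInf + F.zHi) * (δ ^ 2 + δz ^ 2) := by positivity
    have e2 : 0 ≤ K * (e + δz ^ 2) := by positivity
    have e3 : 0 ≤ A * (e + δ ^ 2) := by positivity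
    linarith
  rw [accuracyConst]
  calc w2 = 4 * l / η * (η / (4 * l) * w2) := by field_simp
    _ ≤ 4 * l / η * ((K + A + 2 * (pInf + F.zHi)) * (e + δ ^ 2 + δz ^ 2)) := by gcongr
    _ = _ := by rw [hK, hA]; ring

/-- The chosen price does no worse empirically than the grid price nearest to `pS m`, both evaluated
at the estimated cost. The curvature `a` converts the comparison into a bound on the distance, and
the error of the dual estimate enters only through its square. -/
lemma PhaseHyp.pEst_accuracy (m : Fin M) :
    (pEst F sel n ε obs j s m - pS m) ^ 2
      ≤ 2 / a * (l ^ 2 / (2 * a) + 1) * accuracyConst pInf F.zHi a l η * (e + δ ^ 2 + δz ^ 2)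
        + 2 / a * (b + l ^ 2 + 2 * (pInf + F.zHi)) * (e + δ ^ 2 + δz ^ 2) := by
  have hl := h.l_pos
  have ha := h.a_pos
  have hb := h.b_pos
  have hpI : 0 ≤ pInf := (h.pS_mem_Icc m).1.trans (h.pS_mem_Icc m).2
  have hzHi : 0 < F.zHi := h.z_pos.trans h.z_lt
  have he : 0 ≤ e := (abs_nonneg _).trans (H.err m 0 (by simp))
  have hzm := zEst_mem (F := F) (n := n) (ε := ε) (obs := obs) (j := j) hsel (H.zl_le.trans H.le_zu)
  have hz : zEst F sel n ε obs j s ∈ Icc 0 F.zHi :=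
    ⟨H.z_nonneg.trans hzm.1, hzm.2.trans H.z_le⟩
  have hw := H.zEst_accuracy h hη hηb hsel
  set z := zEst F sel n ε obs j s with hzdef
  have hη' : 0 ≤ η * (s.zu - s.zl) := mul_nonneg hη.le (by linarith [H.zl_le, H.le_zu])
  obtain ⟨i, hi, hnear⟩ := exists_grid_near (x := pS m) (lo := s.pl m) (hi := s.pu m)
    ⟨by linarith [H.pl_le m], by linarith [H.le_pu m]⟩ (gridN n ε j)
  have hspec := maxIdx_spec hsel (gridN n ε j) (profitEst n ε obs j s m z)
  set k := maxIdx sel (gridN n ε j) (profitEst n ε obs j s m z) with hk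
  have hpk : pEst F sel n ε obs j s m = gridPrice n ε j s m k := rfl
  have h1 := hspec.2 i hi
  have h2 := (abs_le.mp (H.profitEst_err h hη m hi hz)).1
  have h3 := (abs_le.mp (H.profitEst_err h hη m hspec.1 hz)).2
  have h4 := h.profit_le m (H.gridPrice_mem h hη m hspec.1) z
  have h5 := h.profit_ge m (H.gridPrice_mem h hη m hi) z
  rw [hpk]
  have hxi : |gridPrice n ε j s m i - pS m| ≤ δ := hnear.trans (H.step m)
  set x := gridPrice n ε j s m k - pS m
  set y := gridPrice n ε j s m i - pS m
  set w := z - zS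
  have hδ : 0 ≤ δ := (abs_nonneg _).trans hxi
  have h6 : y ^ 2 ≤ δ ^ 2 := by rw [← sq_abs]; gcongr
  have h7 : l * |w| * |y| ≤ w ^ 2 + l ^ 2 * δ ^ 2 := by
    have : l * |w| * |y| ≤ l * |w| * δ := by gcongr
    have e1 := sq_nonneg (|w| - l * δ)
    have e2 := sq_abs w
    have e3 : 0 ≤ l * |w| * δ := by positivity
    nlinarith
  have h8 : l * |w| * |x| ≤ a / 2 * x ^ 2 + l ^ 2 / (2 * a) * w ^ 2 := by
    rw [← sq_abs x, ← sq_abs w]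
    have e1 : a / 2 * |x| ^ 2 + l ^ 2 / (2 * a) * |w| ^ 2 - l * |w| * |x|
        = (a * |x| - l * |w|) ^ 2 / (2 * a) := by field_simp; ring
    have : 0 ≤ (a * |x| - l * |w|) ^ 2 / (2 * a) := by positivity
    linarith
  have h9 : b * y ^ 2 ≤ b * δ ^ 2 := by gcongr
  have h10 : a / 2 * x ^ 2 ≤ (l ^ 2 / (2 * a) + 1) * w ^ 2
      + (b + l ^ 2 + 2 * (pInf + F.zHi)) * (e + δ ^ 2 + δz ^ 2) := by
    have e1 : 0 ≤ (b + l ^ 2) * (e + δz ^ 2) := by positivity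
    have e2 : 0 ≤ (pInf + F.zHi) * (δ ^ 2 + δz ^ 2) := by positivity
    nlinarith
  calc x ^ 2 = 2 / a * (a / 2 * x ^ 2) := by field_simp
    _ ≤ 2 / a * ((l ^ 2 / (2 * a) + 1)
        * (accuracyConst pInf F.zHi a l η * (e + δ ^ 2 + δz ^ 2))
        + (b + l ^ 2 + 2 * (pInf + F.zHi)) * (e + δ ^ 2 + δz ^ 2)) := by
      refine mul_le_mul_of_nonneg_left (h10.trans ?_) (by positivity)
      gcongr
    _ = _ := by ring

end Estimators

end PersonalizedPricing

namespace PersonalizedPricing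

/-! ### Control of the interval estimators through all exploration phases -/

variable {M : ℕ}

/-- Observed sales in all windows deviate little from their means. -/
def GoodObs (F : FirmInfo) (d : Fin M → ℝ → ℝ) (C : ℝ) (n : ℕ)
    (obs : Fin M → ℝ → ℝ → ℝ → ℝ) : Prop :=
  ∀ m a b p, 0 ≤ a → a ≤ b → b ≤ F.T →
    |obs m a b p - n * d m p * (b - a)| ≤ C * (√(n * (b - a) * Real.log n) + Real.log n)

lemma IsGood.goodObs {F : FirmInfo} {d : Fin M → ℝ → ℝ} {B C : ℝ} {n : ℕ}
    {ν : Measure (Fin M × ℝ × ℝ)} (h : IsGood F.T B C n ν) (h0 : ∀ m p, 0 ≤ d m p)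
    (hB : ∀ m p, d m p ≤ B) : GoodObs F d C n (observe d n ν) := by
  intro m a b p ha hab hb
  have h1 := h.dev m a b (n * d m p) ha hab hb (mul_nonneg n.cast_nonneg (h0 m p))
    (mul_le_mul_of_nonneg_left (hB m p) n.cast_nonneg)
  rwa [mul_comm (b - a)] at h1

lemma slotTime_succ_sub (n : ℕ) (ε : ℝ) (j i : ℕ) :
    slotTime n ε j (i + 1) - slotTime n ε j i = tau n ε j / (gridN n ε j + 1) := by
  rw [slotTime, slotTime]; push_cast; ring

lemma slotTime_zero (n : ℕ) (ε : ℝ) (j : ℕ) : slotTime n ε j 0 = phaseStart n ε j := by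
  simp [slotTime]

lemma slotTime_last (n : ℕ) (ε : ℝ) (j : ℕ) :
    slotTime n ε j (gridN n ε j + 1) = phaseStart n ε (j + 1) := by
  rw [slotTime, phaseStart, phaseStart, Finset.sum_range_succ]
  have : (0 : ℝ) < (gridN n ε j : ℝ) + 1 := by positivity
  push_cast
  field_simp

lemma slotTime_mono {n : ℕ} (hn : 3 ≤ n) {ε : ℝ} (hε : 0 < ε) (j : ℕ) :
    Monotone (slotTime n ε j) := by
  intro i k hik
  have h1 := (tau_pos hn hε j).le
  have h2 : (i : ℝ) ≤ k := by exact_mod_cast hik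
  rw [slotTime, slotTime]
  gcongr

lemma slotTime_nonneg {n : ℕ} (hn : 3 ≤ n) {ε : ℝ} (hε : 0 < ε) (j i : ℕ) :
    0 ≤ slotTime n ε j i := by
  refine le_trans ?_ (slotTime_mono hn hε j (Nat.zero_le i))
  rw [slotTime_zero]
  exact phaseStart_nonneg hn hε j

lemma slotTime_succ_le_lastStart {n : ℕ} (hn : 3 ≤ n) {ε : ℝ} (hε : 0 < ε) {j i : ℕ}
    (hj : j < numExplore n ε) (hi : i ∈ Finset.range (gridN n ε j + 1)) :
    slotTime n ε j (i + 1) ≤ lastStart n ε := by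
  refine (slotTime_mono hn hε j (Nat.succ_le_of_lt (Finset.mem_range.mp hi))).trans ?_
  rw [slotTime_last]
  exact phaseStart_mono hn hε hj

/-- The invariant of the interval estimators on the good event. -/
structure PhaseInv (F : FirmInfo) (zS : ℝ) (pS : Fin M → ℝ) (n : ℕ) (ε η W : ℝ) (j : ℕ)
    (s : PhaseState M) : Prop where
  z_nonneg : 0 ≤ s.zl
  zl_le : s.zl ≤ zS
  le_zu : zS ≤ s.zu
  z_le : s.zu ≤ F.zHi
  p_ge : ∀ m, F.pLo ≤ s.pl m
  pl_le : ∀ m, s.pl m ≤ pS m - η * (s.zu - s.zl)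
  le_pu : ∀ m, pS m + η * (s.zu - s.zl) ≤ s.pu m
  p_le : ∀ m, s.pu m ≤ F.pHi
  p_width : ∀ m, s.pu m - s.pl m ≤ W * width n j
  z_width : s.zu - s.zl ≤ W * width n j
  stepZ : (s.zu - s.zl) / (gridZ n ε j + 1) ≤ W * (width n (j + 1) / logPow n ε ^ 3)

/-- The error is of the order of the squared grid resolution. Errors of values act on squared
distances of optimizers, so the statistical and the discretization error are balanced. -/
lemma demandEst_error_le {F : FirmInfo} {d : Fin M → ℝ → ℝ} {C : ℝ} {n : ℕ} (hn : 3 ≤ n)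
    {ε : ℝ} (hε : 0 < ε) {obs : Fin M → ℝ → ℝ → ℝ → ℝ} (hobs : GoodObs F d C n obs) (hC : 0 < C)
    (hT : lastStart n ε ≤ F.T) {j : ℕ} (hj : j < numExplore n ε) (s : PhaseState M) (m : Fin M)
    {i : ℕ} (hi : i ∈ Finset.range (gridN n ε j + 1)) :
    |demandEst n ε obs j s m i - d m (gridPrice n ε j s m i)|
      ≤ 5 * C * (width n (j + 1) / logPow n ε ^ 3) ^ 2 := by
  have hτ := tau_pos hn hε j
  have hn0 : (0 : ℝ) < n := by positivity
  have hN0 : (0 : ℝ) < (gridN n ε j : ℝ) + 1 := by positivity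
  have h1 := hobs m (slotTime n ε j i) (slotTime n ε j (i + 1)) (gridPrice n ε j s m i)
    (slotTime_nonneg hn hε j i) (slotTime_mono hn hε j (Nat.le_succ i))
    ((slotTime_succ_le_lastStart hn hε hj hi).trans hT)
  rw [slotTime_succ_sub] at h1
  have h2 := estimation_error_le hn hε j
  rw [demandEst, slotSales]
  set o := obs m (slotTime n ε j i) (slotTime n ε j (i + 1)) (gridPrice n ε j s m i)
  have e : (gridN n ε j + 1) / (n * tau n ε j) * o - d m (gridPrice n ε j s m i)
      = (gridN n ε j + 1) / (n * tau n ε j) *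
        (o - n * d m (gridPrice n ε j s m i) * (tau n ε j / (gridN n ε j + 1))) := by
    field_simp
  rw [e, abs_mul, abs_of_pos (by positivity)]
  calc _ ≤ (gridN n ε j + 1) / (n * tau n ε j) *
        (C * (√(n * (tau n ε j / (gridN n ε j + 1)) * Real.log n) + Real.log n)) := by gcongr
    _ = C * ((gridN n ε j + 1) / (n * tau n ε j) *
        (√(n * (tau n ε j / (gridN n ε j + 1)) * Real.log n) + Real.log n)) := by ring
    _ ≤ C * (5 * (width n (j + 1) / logPow n ε ^ 3) ^ 2) := by gcongr
    _ = _ := by ring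

lemma PhaseInv.phaseHyp {F : FirmInfo} {d : Fin M → ℝ → ℝ} {zS : ℝ} {pS : Fin M → ℝ} {C : ℝ}
    {n : ℕ} (hn : 3 ≤ n) {ε η W : ℝ} (hε : 0 < ε) {j : ℕ} {s : PhaseState M} (hW : 0 < W)
    (H : PhaseInv F zS pS n ε η W j s) {obs : Fin M → ℝ → ℝ → ℝ → ℝ}
    (hobs : GoodObs F d C n obs) (hC : 0 < C) (hT : lastStart n ε ≤ F.T)
    (hj : j < numExplore n ε) :
    PhaseHyp F d zS pS n ε obs j s η (5 * C * (width n (j + 1) / logPow n ε ^ 3) ^ 2)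
      (W * (width n (j + 1) / logPow n ε ^ 3)) (W * (width n (j + 1) / logPow n ε ^ 3)) where
  z_nonneg := H.z_nonneg
  zl_le := H.zl_le
  le_zu := H.le_zu
  z_le := H.z_le
  p_ge := H.p_ge
  pl_le := H.pl_le
  le_pu := H.le_pu
  p_le := H.p_le
  step := fun m => by
    have hN0 : (0 : ℝ) < (gridN n ε j : ℝ) + 1 := by positivity
    calc (s.pu m - s.pl m) / (gridN n ε j + 1) ≤ W * width n j / (gridN n ε j + 1) := by
          have := H.p_width m
          gcongr
      _ = W * (width n j / (gridN n ε j + 1)) := by ring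
      _ ≤ _ := by
          have := width_div_gridN_le hn hε j
          gcongr
  stepZ := H.stepZ
  err := fun m _ hi => demandEst_error_le hn hε hobs hC hT hj s m hi

variable {F : FirmInfo} {d : Fin M → ℝ → ℝ} {pInf zS : ℝ} {pS : Fin M → ℝ} {a b l B : ℝ}

/-- Three demands on `η`: `b (4 l η) ≤ 1` lets the test prices gain, the bound by the distance of
`pS` to the ends of `[pLo, pHi]` gives the margins in the first phase and after truncation, and `η ≤
1 / 4` preserves the margins when the intervals shrink. -/
lemma MarketBounds.exists_eta (h : MarketBounds F d pInf zS pS a b l B) :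
    ∃ η : ℝ, 0 < η ∧ η ≤ 1 / 4 ∧ b * (4 * l * η) ≤ 1 ∧
      ∀ m, η * F.zHi ≤ pS m - F.pLo ∧ η * F.zHi ≤ F.pHi - pS m := by
  have hne : (Finset.univ : Finset (Fin M)).Nonempty := ⟨⟨0, h.M_pos⟩, Finset.mem_univ _⟩
  have hz : 0 < F.zHi := h.z_pos.trans h.z_lt
  have hb := h.b_pos
  have hl := h.l_pos
  set κ := Finset.univ.inf' hne fun m => min (pS m - F.pLo) (F.pHi - pS m) with hκ
  have hκ0 : 0 < κ := by
    rw [hκ, Finset.lt_inf'_iff]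
    exact fun m _ => lt_min (sub_pos.mpr (h.pS_mem m).1) (sub_pos.mpr (h.pS_mem m).2)
  have hκm : ∀ m, κ ≤ min (pS m - F.pLo) (F.pHi - pS m) := fun m =>
    Finset.inf'_le _ (Finset.mem_univ m)
  refine ⟨min (1 / 4) (min (1 / (4 * b * l)) (κ / F.zHi)), by positivity, min_le_left _ _, ?_, ?_⟩
  · have : min (1 / 4) (min (1 / (4 * b * l)) (κ / F.zHi)) ≤ 1 / (4 * b * l) :=
      (min_le_right _ _).trans (min_le_left _ _)
    calc b * (4 * l * min (1 / 4) (min (1 / (4 * b * l)) (κ / F.zHi)))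
        ≤ b * (4 * l * (1 / (4 * b * l))) := by gcongr
      _ = 1 := by field_simp
  · intro m
    have h1 : min (1 / 4) (min (1 / (4 * b * l)) (κ / F.zHi)) * F.zHi ≤ κ := by
      calc _ ≤ κ / F.zHi * F.zHi := by
            have : min (1 / 4) (min (1 / (4 * b * l)) (κ / F.zHi)) ≤ κ / F.zHi :=
              (min_le_right _ _).trans (min_le_right _ _)
            gcongr
        _ = κ := by field_simp
    exact ⟨h1.trans ((hκm m).trans (min_le_left _ _)), h1.trans ((hκm m).trans (min_le_right _ _))⟩

lemma abs_le_of_sq_le_mul_sq {x A ρ : ℝ} (hA : 0 ≤ A) (hρ : 0 ≤ ρ) (h : x ^ 2 ≤ A * ρ ^ 2) :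
    |x| ≤ (A + 1) * ρ := by
  apply abs_le_of_sq_le_sq _ (by positivity)
  nlinarith [sq_nonneg ρ, mul_nonneg hA (sq_nonneg ρ), mul_nonneg (mul_nonneg hA hA) (sq_nonneg ρ)]

/-- On the good event the interval estimators contain the optimum in all phases. -/
theorem MarketBounds.exists_phaseInv (h : MarketBounds F d pInf zS pS a b l B)
    {sel : Finset ℕ → ℕ} (hsel : ∀ s : Finset ℕ, s.Nonempty → sel s ∈ s) {C : ℝ} (hC : 0 < C) :
    ∃ η W G : ℝ, 0 < η ∧ 1 ≤ W ∧ ∀ (n : ℕ) (ε : ℝ) (obs : Fin M → ℝ → ℝ → ℝ → ℝ),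
      3 ≤ n → 0 < ε → G ≤ logPow n ε → lastStart n ε ≤ F.T → GoodObs F d C n obs →
      ∀ j ≤ numExplore n ε, PhaseInv F zS pS n ε η W j (phaseState F sel n ε obs j) := by
  obtain ⟨η, hη, hη4, hηb, hηz⟩ := h.exists_eta
  have m0 : Fin M := ⟨0, h.M_pos⟩
  have hz : 0 < F.zHi := h.z_pos.trans h.z_lt
  have hlohi : F.pLo < F.pHi := (h.pS_mem m0).1.trans (h.pS_mem m0).2
  have ha := h.a_pos
  have hb := h.b_pos
  have hl := h.l_pos
  have hpI : 0 ≤ pInf := (h.pS_mem_Icc m0).1.trans (h.pS_mem_Icc m0).2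
  set W := F.pHi - F.pLo + F.zHi + 1 with hW
  have hW1 : 1 ≤ W := by linarith
  set K := 5 * C + W ^ 2 + W ^ 2 with hK
  have hK0 : 0 ≤ K := by positivity
  set A₁ := accuracyConst pInf F.zHi a l η * K with hA₁
  have hac : 0 ≤ accuracyConst pInf F.zHi a l η := h.accuracyConst_nonneg hη ⟨m0⟩
  set A₂ := 2 / a * (l ^ 2 / (2 * a) + 1) * accuracyConst pInf F.zHi a l η * K
    + 2 / a * (b + l ^ 2 + 2 * (pInf + F.zHi)) * K with hA₂
  have hA₁0 : 0 ≤ A₁ := by positivity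
  have hA₂0 : 0 ≤ A₂ := by positivity
  -- The threshold on `g` that keeps both estimators within a quarter of the new widths.
  refine ⟨η, W, 4 * (A₁ + 1) + 4 * (A₂ + 1), hη, hW1, ?_⟩
  intro n ε obs hn hε hG hT hobs j
  induction j with
  | zero =>
    intro _
    exact
    { z_nonneg := le_rfl
      zl_le := h.z_pos.le
      le_zu := h.z_lt.le
      z_le := le_rfl
      p_ge := fun m => le_rfl
      pl_le := fun m => by
        have := (hηz m).1
        simp only [phaseState, sub_zero]; linarith
      le_pu := fun m => by
        have := (hηz m).2
        simp only [phaseState, sub_zero]; linarith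
      p_le := fun m => le_rfl
      p_width := fun m => by
        rw [width_zero]; simp only [phaseState]; linarith
      z_width := by rw [width_zero]; simp only [phaseState]; linarith
      stepZ := by
        have h1 := inv_gridZ_zero_le hn hε
        simp only [phaseState, sub_zero]
        rw [div_eq_mul_one_div]
        have : F.zHi ≤ W := by linarith
        gcongr }
  | succ j ih =>
    intro hj
    have hj' : j < numExplore n ε := hj
    have Hinv := ih hj'.le
    have H := Hinv.phaseHyp hn hε (by linarith) hobs hC hT hj'
    set s := phaseState F sel n ε obs j with hs
    have hg := one_le_logPow hn hε
    have hw := width_pos hn (j + 1)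
    set g := logPow n ε with hgdef
    set ρ := width n (j + 1) / g ^ 3 with hρ
    have hρ0 : 0 ≤ ρ := by positivity
    have hz1 := abs_le_of_sq_le_mul_sq hA₁0 hρ0 (by
      refine (H.zEst_accuracy (sel := sel) h hη hηb hsel).trans_eq ?_
      rw [hA₁, hK]; ring)
    have hp1 : ∀ m, |pEst F sel n ε obs j s m - pS m| ≤ (A₂ + 1) * ρ := fun m =>
      abs_le_of_sq_le_mul_sq hA₂0 hρ0 (by
        refine (H.pEst_accuracy (sel := sel) h hη hηb hsel m).trans_eq ?_
        rw [hA₂, hK]; ring)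
    have hwZ : widthZ n ε (j + 1) = width n (j + 1) / g ^ 2 := widthZ_eq hn ε (j + 1)
    have hwZle : widthZ n ε (j + 1) ≤ width n (j + 1) := by
      rw [hwZ]; exact div_le_self hw.le (one_le_pow₀ hg)
    have hwZ0 : 0 < widthZ n ε (j + 1) := by rw [hwZ]; positivity
    -- The estimator is accurate to a constant times `width / g³`, the new interval has width `width
    -- / g²`; the spare factor `g` absorbs the constant.
    have hz2 : |zEst F sel n ε obs j s - zS| ≤ widthZ n ε (j + 1) / 4 := by
      refine hz1.trans ?_
      rw [hwZ, hρ, show (A₁ + 1) * (width n (j + 1) / g ^ 3)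
        = 4 * (A₁ + 1) * (width n (j + 1) / g ^ 3) / 4 by ring]
      have e : width n (j + 1) / g ^ 2 = g * (width n (j + 1) / g ^ 3) := by field_simp
      rw [e]
      have : 4 * (A₁ + 1) ≤ g := by linarith
      gcongr
    have hp2 : ∀ m, |pEst F sel n ε obs j s m - pS m| ≤ width n (j + 1) / 4 := by
      intro m
      refine (hp1 m).trans ?_
      rw [hρ, show (A₂ + 1) * (width n (j + 1) / g ^ 3)
        = 4 * (A₂ + 1) / g ^ 3 * width n (j + 1) / 4 by ring]
      have e : 4 * (A₂ + 1) / g ^ 3 ≤ 1 := by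
        rw [div_le_one (by positivity)]
        calc 4 * (A₂ + 1) ≤ g := by linarith
          _ = g ^ 1 := (pow_one g).symm
          _ ≤ g ^ 3 := pow_le_pow_right₀ hg (by norm_num)
      have := mul_le_mul_of_nonneg_right e hw.le
      linarith
    have hz3 := abs_le.mp hz2
    have hstate : phaseState F sel n ε obs (j + 1) =
      { pl := fun m => max F.pLo (pEst F sel n ε obs j s m - width n (j + 1) / 2)
        pu := fun m => min F.pHi (pEst F sel n ε obs j s m + width n (j + 1) / 2)
        zl := max 0 (zEst F sel n ε obs j s - widthZ n ε (j + 1) / 2)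
        zu := min F.zHi (zEst F sel n ε obs j s + widthZ n ε (j + 1) / 2) } := rfl
    rw [hstate]
    set zl' := max 0 (zEst F sel n ε obs j s - widthZ n ε (j + 1) / 2) with hzl'
    set zu' := min F.zHi (zEst F sel n ε obs j s + widthZ n ε (j + 1) / 2) with hzu'
    have h1 : 0 ≤ zl' := le_max_left _ _
    have h2 : zu' ≤ F.zHi := min_le_left _ _
    have h3 : zl' ≤ zS := max_le h.z_pos.le (by linarith)
    have h4 : zS ≤ zu' := le_min h.z_lt.le (by linarith)
    have h5 : zu' - zl' ≤ widthZ n ε (j + 1) := by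
      have e1 : zu' ≤ zEst F sel n ε obs j s + widthZ n ε (j + 1) / 2 := min_le_right _ _
      have e2 : zEst F sel n ε obs j s - widthZ n ε (j + 1) / 2 ≤ zl' := le_max_right _ _
      linarith
    have h6 : η * (zu' - zl') ≤ η * F.zHi := by gcongr; linarith
    -- A quarter of the width for the margin and a quarter for the error of the price estimator add
    -- up to the half-width of the new price interval.
    have h7 : η * (zu' - zl') ≤ width n (j + 1) / 4 := by
      calc η * (zu' - zl') ≤ 1 / 4 * width n (j + 1) := by
            apply mul_le_mul hη4 (h5.trans hwZle) (by linarith) (by norm_num)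
        _ = _ := by ring
    exact
    { z_nonneg := h1
      zl_le := h3
      le_zu := h4
      z_le := h2
      p_ge := fun m => le_max_left _ _
      pl_le := fun m => by
        have := abs_le.mp (hp2 m)
        exact max_le (by linarith [(hηz m).1]) (by linarith)
      le_pu := fun m => by
        have := abs_le.mp (hp2 m)
        exact le_min (by linarith [(hηz m).2]) (by linarith)
      p_le := fun m => min_le_left _ _
      p_width := fun m => by
        have e1 := min_le_right F.pHi (pEst F sel n ε obs j s m + width n (j + 1) / 2)
        have e2 := le_max_right F.pLo (pEst F sel n ε obs j s m - width n (j + 1) / 2)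
        have e3 : width n (j + 1) ≤ W * width n (j + 1) := le_mul_of_one_le_left hw.le hW1
        simp only
        linarith
      z_width := by
        have e3 : width n (j + 1) ≤ W * width n (j + 1) := le_mul_of_one_le_left hw.le hW1
        simp only
        linarith
      stepZ := by
        have e1 := widthZ_div_gridZ_le hn hε j
        have e2 : (zu' - zl') / (gridZ n ε (j + 1) + 1)
            ≤ widthZ n ε (j + 1) / (gridZ n ε (j + 1) + 1) := by gcongr
        refine (e2.trans e1).trans ?_
        have : 0 ≤ width n (j + 2) / logPow n ε ^ 3 := by
          have := width_pos hn (j + 2)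
          positivity
        exact le_mul_of_one_le_left this hW1 }

end PersonalizedPricing

namespace PersonalizedPricing

/-! ### Sales and Lagrangian on the good event -/

variable {M : ℕ}

/-- The exploration phases' sales, weighted by a function of the price. -/
noncomputable def exploreValue (F : FirmInfo) (sel : Finset ℕ → ℕ) (n : ℕ) (ε : ℝ)
    (obs : Fin M → ℝ → ℝ → ℝ → ℝ) (φ : ℝ → ℝ) : ℝ :=
  ∑ j ∈ Finset.range (numExplore n ε), ∑ i ∈ Finset.range (gridN n ε j + 1), ∑ m,
    φ (gridPrice n ε j (phaseState F sel n ε obs j) m i) *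
      slotSales n ε obs j (phaseState F sel n ε obs j) m i

lemma exploreSales_eq (F : FirmInfo) (sel : Finset ℕ → ℕ) (n : ℕ) (ε : ℝ)
    (obs : Fin M → ℝ → ℝ → ℝ → ℝ) :
    exploreSales F sel n ε obs = exploreValue F sel n ε obs fun _ => 1 := by
  simp [exploreSales, exploreValue]

/-- The last phase's sales, weighted by a function of the price, when the prices are tested. -/
noncomputable def lastValue (F : FirmInfo) (sel : Finset ℕ → ℕ) (n : ℕ) (ε : ℝ)
    (obs : Fin M → ℝ → ℝ → ℝ → ℝ) (φ : ℝ → ℝ) : ℝ :=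
  (∑ m, φ (lowPrice F sel n ε obs m) * obs m (lastStart n ε) (lastStart n ε + testLength n ε)
      (lowPrice F sel n ε obs m))
    + (∑ m, φ (highPrice F sel n ε obs m) * obs m (lastStart n ε + testLength n ε)
      (lastStart n ε + 2 * testLength n ε) (highPrice F sel n ε obs m))
    + (∑ m, φ (lowPrice F sel n ε obs m) * obs m (lastStart n ε + 2 * testLength n ε)
      (switchTime F sel n ε obs) (lowPrice F sel n ε obs m))
    + ∑ m, φ (highPrice F sel n ε obs m) * obs m (switchTime F sel n ε obs) F.T
      (highPrice F sel n ε obs m)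

/-- The deviation allowed for a window of length `x`. -/
noncomputable def devBound (C : ℝ) (n : ℕ) (x : ℝ) : ℝ :=
  C * (√(n * x * Real.log n) + Real.log n)

lemma devBound_le {C : ℝ} (hC : 0 ≤ C) {n : ℕ} (hn : 3 ≤ n) {x T : ℝ} (hx : x ≤ T) (hT : 0 ≤ T) :
    devBound C n x ≤ C * (T + 2) * (quarter n ^ 2 * Real.log n) := by
  have hL := one_le_log hn
  have hv := one_le_quarter hn
  have h1 : √(n * x * Real.log n) ≤ (T + 1) * (quarter n ^ 2 * Real.log n) := by
    apply Real.sqrt_le_iff.mpr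
    refine ⟨by positivity, ?_⟩
    calc n * x * Real.log n ≤ n * T * Real.log n := by gcongr
      _ = quarter n ^ 4 * (T * Real.log n) := by rw [quarter_pow_four]; ring
      _ ≤ quarter n ^ 4 * ((T + 1) ^ 2 * Real.log n ^ 2) := by
        gcongr
        · nlinarith
        · nlinarith
      _ = _ := by ring
  have h2 : Real.log n ≤ quarter n ^ 2 * Real.log n :=
    le_mul_of_one_le_left (by linarith) (one_le_pow₀ hv)
  rw [devBound, mul_assoc C]
  gcongr
  linarith

section Window

variable {F : FirmInfo} {d : Fin M → ℝ → ℝ} {pInf zS : ℝ} {pS : Fin M → ℝ} {a b l B : ℝ}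
  (h : MarketBounds F d pInf zS pS a b l B) {C : ℝ} {n : ℕ} {obs : Fin M → ℝ → ℝ → ℝ → ℝ}
  (hobs : GoodObs F d C n obs) {p : Fin M → ℝ} {s t : ℝ} (hs : 0 ≤ s) (hst : s ≤ t) (ht : t ≤ F.T)

include hobs hs hst ht

lemma GoodObs.window_total : |∑ m, obs m s t (p m) - n * (∑ m, d m (p m)) * (t - s)|
    ≤ M * devBound C n (t - s) := by
  rw [Finset.mul_sum, Finset.sum_mul, ← Finset.sum_sub_distrib]
  refine (Finset.abs_sum_le_sum_abs _ _).trans ?_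
  refine (Finset.sum_le_card_nsmul _ _ _ fun m _ => hobs m s t (p m) hs hst ht).trans_eq ?_
  rw [Finset.card_univ, Fintype.card_fin, nsmul_eq_mul]; rfl

include h

/-- Sales feel a price error to first order, in contrast to the Lagrangian below. This is why
exploration throws the inventory off course and a steering phase is needed. -/
lemma GoodObs.window_sales {r : ℝ} (hp : ∀ m, p m ∈ Icc 0 pInf) (hr : ∀ m, |p m - pS m| ≤ r) :
    |∑ m, obs m s t (p m) - n * (∑ m, d m (pS m)) * (t - s)|
      ≤ M * (n * (t - s) * (l * r) + devBound C n (t - s)) := by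
  have hl := h.l_pos
  rw [Finset.mul_sum, Finset.sum_mul, ← Finset.sum_sub_distrib]
  refine (Finset.abs_sum_le_sum_abs _ _).trans ?_
  refine (Finset.sum_le_card_nsmul _ _ (n * (t - s) * (l * r) + devBound C n (t - s))
    fun m _ => ?_).trans_eq ?_
  · have h1 := hobs m s t (p m) hs hst ht
    have h2 := h.lip m (p m) (hp m)
    have h3 : |n * (t - s) * (d m (p m) - d m (pS m))| ≤ n * (t - s) * (l * r) := by
      have h4 : (0 : ℝ) ≤ n * (t - s) := mul_nonneg n.cast_nonneg (by linarith)
      rw [abs_mul, abs_of_nonneg h4]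
      have := hr m
      gcongr
      exact h2.trans (by gcongr)
    calc _ = |(obs m s t (p m) - n * d m (p m) * (t - s))
          + n * (t - s) * (d m (p m) - d m (pS m))| := by congr 1; ring
      _ ≤ _ := (abs_add_le _ _).trans (by rw [devBound]; linarith)
  · rw [Finset.card_univ, Fintype.card_fin, nsmul_eq_mul]

/-- The price error enters squared because `pS` maximizes the Lagrangian profit. This is where the
regret becomes second order. -/
lemma GoodObs.window_lagrangian {r : ℝ} (hp : ∀ m, p m ∈ Icc 0 pInf)
    (hr : ∀ m, |p m - pS m| ≤ r) :
    |∑ m, (p m - zS) * obs m s t (p m) - n * (∑ m, d m (pS m) * (pS m - zS)) * (t - s)|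
      ≤ M * (n * (t - s) * (b * r ^ 2) + (pInf + F.zHi) * devBound C n (t - s)) := by
  have hb := h.b_pos
  rw [Finset.mul_sum, Finset.sum_mul, ← Finset.sum_sub_distrib]
  refine (Finset.abs_sum_le_sum_abs _ _).trans ?_
  refine (Finset.sum_le_card_nsmul _ _
    (n * (t - s) * (b * r ^ 2) + (pInf + F.zHi) * devBound C n (t - s)) fun m _ => ?_).trans_eq ?_
  · have h1 := hobs m s t (p m) hs hst ht
    have h2 := h.gap_lower m (p m) (hp m)
    have h2' : 0 ≤ a * (p m - pS m) ^ 2 := mul_nonneg h.a_pos.le (sq_nonneg _)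
    have h3 := h.gap_upper m (p m) (hp m)
    have h4 : |n * (t - s) * (d m (p m) * (p m - zS) - d m (pS m) * (pS m - zS))|
        ≤ n * (t - s) * (b * r ^ 2) := by
      have h5 : (0 : ℝ) ≤ n * (t - s) := mul_nonneg n.cast_nonneg (by linarith)
      rw [abs_mul, abs_of_nonneg h5]
      have h6 : (p m - pS m) ^ 2 ≤ r ^ 2 := by
        rw [← sq_abs]
        have := hr m
        gcongr
      gcongr
      rw [abs_of_nonpos (by linarith)]
      have : b * (p m - pS m) ^ 2 ≤ b * r ^ 2 := by gcongr
      linarith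
    have h5 : |(p m - zS) * (obs m s t (p m) - n * d m (p m) * (t - s))|
        ≤ (pInf + F.zHi) * devBound C n (t - s) := by
      have h6 : |p m - zS| ≤ pInf + F.zHi := by
        have := hp m
        rw [abs_le]; constructor <;> linarith [this.1, this.2, h.z_pos, h.z_lt]
      rw [abs_mul]
      have : 0 ≤ pInf + F.zHi := (abs_nonneg _).trans h6
      rw [devBound]
      gcongr
    calc _ = |(p m - zS) * (obs m s t (p m) - n * d m (p m) * (t - s))
          + n * (t - s) * (d m (p m) * (p m - zS) - d m (pS m) * (pS m - zS))| := by
            congr 1; ring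
      _ ≤ _ := (abs_add_le _ _).trans (by linarith)
  · rw [Finset.card_univ, Fintype.card_fin, nsmul_eq_mul]

end Window

/-- The sample size is large: `g = (log n) ^ ε` and `1 / α` exceed a constant. -/
structure IsLarge (n : ℕ) (ε G : ℝ) : Prop where
  three_le : 3 ≤ n
  two_le_log : 2 ≤ Real.log n
  le_logPow : G ≤ logPow n ε
  alpha_le : alpha n ε * G ≤ 1

lemma IsLarge.mono {n : ℕ} {ε G G' : ℝ} (h : IsLarge n ε G) (hG : G' ≤ G) : IsLarge n ε G' where
  three_le := h.three_le
  two_le_log := h.two_le_log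
  le_logPow := hG.trans h.le_logPow
  alpha_le := by
    have hL := h.two_le_log
    have h1 : 0 ≤ alpha n ε := by unfold alpha; positivity
    exact (mul_le_mul_of_nonneg_left hG h1).trans h.alpha_le

lemma eventually_isLarge {ε : ℝ} (hε : 0 < ε) (G : ℝ) : ∀ᶠ n : ℕ in atTop, IsLarge n ε G := by
  have h4 : Tendsto (fun n : ℕ => alpha n ε * G) atTop (nhds (0 * G)) :=
    (tendsto_alpha ε).mul_const G
  rw [zero_mul] at h4
  filter_upwards [eventually_ge_atTop 3, tendsto_log_natCast.eventually_ge_atTop 2,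
    (tendsto_logPow hε).eventually_ge_atTop G, h4.eventually_le_const one_pos] with n h1 h2 h3 h4
  exact ⟨h1, h2, h3, h4⟩

lemma alpha_pos {n : ℕ} (hn : 3 ≤ n) {ε : ℝ} (hε : 0 < ε) : 0 < alpha n ε := by
  have hL := one_le_log hn
  have hg := one_le_logPow hn hε
  have hv := one_le_quarter hn
  rw [alpha_eq hn]; positivity

section Explore

variable {F : FirmInfo} {d : Fin M → ℝ → ℝ} {pInf zS : ℝ} {pS : Fin M → ℝ} {a b l B : ℝ}
  {sel : Finset ℕ → ℕ} {C : ℝ} {n : ℕ} {ε η W : ℝ} {obs : Fin M → ℝ → ℝ → ℝ → ℝ}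

lemma PhaseInv.gridPrice_mem {j : ℕ} {s : PhaseState M} (h : MarketBounds F d pInf zS pS a b l B)
    (H : PhaseInv F zS pS n ε η W j s) (hη : 0 < η) (m : Fin M) {i : ℕ}
    (hi : i ∈ Finset.range (gridN n ε j + 1)) :
    gridPrice n ε j s m i ∈ Icc 0 pInf ∧ |gridPrice n ε j s m i - pS m| ≤ W * width n j := by
  have h0 : 0 ≤ η * (s.zu - s.zl) := mul_nonneg hη.le (by linarith [H.zl_le, H.le_zu])
  have h1 := H.pl_le m
  have h2 := H.le_pu m
  have h3 := grid_mem_Icc (by linarith : s.pl m ≤ s.pu m) hi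
  have h4 := H.p_width m
  refine ⟨⟨h.pLo_nonneg.trans ((H.p_ge m).trans h3.1), (h3.2.trans (H.p_le m)).trans h.pHi_le⟩, ?_⟩
  rw [gridPrice, abs_le]
  constructor <;> linarith [h3.1, h3.2]

/-- Sum over windows of deviations that are uniform within each phase. -/
lemma explore_sum_le {x E : ℝ} {f : ℕ → ℕ → ℝ} (hn : 3 ≤ n) (hL : 2 ≤ Real.log n) (hε : 0 < ε)
    (hE : 0 ≤ E)
    (hf : ∀ j < numExplore n ε, ∀ i ∈ Finset.range (gridN n ε j + 1),
      |f j i - x * (tau n ε j / (gridN n ε j + 1))| ≤ E / (gridN n ε j + 1)) :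
    |∑ j ∈ Finset.range (numExplore n ε), ∑ i ∈ Finset.range (gridN n ε j + 1), f j i
      - x * lastStart n ε| ≤ Real.log n * E := by
  rw [lastStart, phaseStart, Finset.mul_sum, ← Finset.sum_sub_distrib]
  refine (Finset.abs_sum_le_sum_abs _ _).trans ?_
  have h1 : ∀ j ∈ Finset.range (numExplore n ε),
      |∑ i ∈ Finset.range (gridN n ε j + 1), f j i - x * tau n ε j| ≤ E := by
    intro j hj
    have hN0 : (0 : ℝ) < (gridN n ε j : ℝ) + 1 := by positivity
    have h2 : x * tau n ε j = ∑ _i ∈ Finset.range (gridN n ε j + 1),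
        x * (tau n ε j / (gridN n ε j + 1)) := by
      rw [Finset.sum_const, Finset.card_range, nsmul_eq_mul]
      push_cast
      field_simp
    rw [h2, ← Finset.sum_sub_distrib]
    refine (Finset.abs_sum_le_sum_abs _ _).trans ?_
    refine (Finset.sum_le_card_nsmul _ _ _ fun i hi => hf j (Finset.mem_range.mp hj) i hi).trans_eq
      ?_
    rw [Finset.card_range, nsmul_eq_mul]
    push_cast
    field_simp
  refine (Finset.sum_le_card_nsmul _ _ _ h1).trans ?_
  rw [Finset.card_range, nsmul_eq_mul]
  have := numExplore_le_log hn hL hε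
  gcongr

/-- The first-order effect of the price errors dominates the statistical fluctuations, once `α ≤ 1`.
What matters is `g⁷`, two powers below the leverage `n α` of the last phase. -/
lemma explore_sales_le (h : MarketBounds F d pInf zS pS a b l B) (hη : 0 < η) (hW : 1 ≤ W)
    (hC : 0 < C) (hε : 0 < ε) (hlarge : IsLarge n ε 1) (hT : lastStart n ε ≤ F.T)
    (hobs : GoodObs F d C n obs)
    (H : ∀ j ≤ numExplore n ε, PhaseInv F zS pS n ε η W j (phaseState F sel n ε obs j)) :
    |exploreValue F sel n ε obs (fun _ => 1) - n * (∑ m, d m (pS m)) * lastStart n ε|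
      ≤ M * (l * W + 5 * C) * (quarter n ^ 3 * Real.log n * logPow n ε ^ 7) := by
  have hn := hlarge.three_le
  have hL := one_le_log hn
  have hg := one_le_logPow hn hε
  have hv := one_le_quarter hn
  have hl := h.l_pos
  have key := explore_sum_le (ε := ε) (n := n) (x := n * ∑ m, d m (pS m))
    (E := M * ((l * W + 5 * C) * (quarter n ^ 3 * logPow n ε ^ 7)))
    (f := fun j i => ∑ m, (1 : ℝ) * slotSales n ε obs j (phaseState F sel n ε obs j) m i)
    hn hlarge.two_le_log hε (by positivity) (by
      intro j hj i hi
      have Hj := H j hj.le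
      have hτ := tau_pos hn hε j
      have hN0 : (0 : ℝ) < (gridN n ε j : ℝ) + 1 := by positivity
      have h1 := GoodObs.window_sales h hobs (slotTime_nonneg hn hε j i)
        (slotTime_mono hn hε j (Nat.le_succ i))
        ((slotTime_succ_le_lastStart hn hε hj hi).trans hT)
        (fun m => (Hj.gridPrice_mem h hη m hi).1) (fun m => (Hj.gridPrice_mem h hη m hi).2)
      rw [Nat.succ_eq_add_one, slotTime_succ_sub] at h1
      simp only [one_mul]
      refine h1.trans ?_
      rw [mul_div_assoc]
      refine mul_le_mul_of_nonneg_left ?_ (Nat.cast_nonneg M)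
      rw [le_div_iff₀ hN0]
      have e1 := mul_tau_mul_width_le hn hε hj
      have e2 := phase_deviation_le hn hε j
      have e3 : quarter n ^ 2 * Real.log n * logPow n ε ^ 9 ≤ quarter n ^ 3 * logPow n ε ^ 7 := by
        have h5 : Real.log n * logPow n ε ^ 9 ≤ quarter n := by
          have := hlarge.alpha_le
          rwa [mul_one, alpha_eq hn, div_le_one (by positivity)] at this
        have h6 : (1 : ℝ) ≤ logPow n ε ^ 7 := one_le_pow₀ hg
        calc quarter n ^ 2 * Real.log n * logPow n ε ^ 9
            = quarter n ^ 2 * (Real.log n * logPow n ε ^ 9) := by ring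
          _ ≤ quarter n ^ 2 * quarter n := by gcongr
          _ = quarter n ^ 3 := by ring
          _ ≤ _ := le_mul_of_one_le_right (by positivity) h6
      calc (n * (tau n ε j / (gridN n ε j + 1)) * (l * (W * width n j))
            + devBound C n (tau n ε j / (gridN n ε j + 1))) * (gridN n ε j + 1)
          = l * W * (n * tau n ε j * width n j) + C * ((gridN n ε j + 1) *
            (√(n * (tau n ε j / (gridN n ε j + 1)) * Real.log n) + Real.log n)) := by
            rw [devBound]; field_simp
        _ ≤ l * W * (quarter n ^ 3 * logPow n ε ^ 7)
            + C * (5 * (quarter n ^ 3 * logPow n ε ^ 7)) := by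
            have := e2.trans (mul_le_mul_of_nonneg_left e3 (by norm_num : (0 : ℝ) ≤ 5))
            gcongr
        _ = _ := by ring)
  refine key.trans_eq ?_
  ring

/-- The constant loss per phase, summed over at most `log n` phases, accounts for one of the two
logarithms; the power `g ^ 15` is below the `g ^ 18` of the last phase. -/
lemma explore_lagrangian_le (h : MarketBounds F d pInf zS pS a b l B) (hη : 0 < η) (hW : 1 ≤ W)
    (hC : 0 < C) (hε : 0 < ε) (hlarge : IsLarge n ε 1) (hT : lastStart n ε ≤ F.T)
    (hobs : GoodObs F d C n obs)
    (H : ∀ j ≤ numExplore n ε, PhaseInv F zS pS n ε η W j (phaseState F sel n ε obs j)) :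
    |exploreValue F sel n ε obs (fun p => p - zS)
        - n * (∑ m, d m (pS m) * (pS m - zS)) * lastStart n ε|
      ≤ M * (b * W ^ 2 + 5 * C * (pInf + F.zHi))
        * (quarter n ^ 2 * Real.log n ^ 2 * logPow n ε ^ 18) := by
  have hn := hlarge.three_le
  have hL := one_le_log hn
  have hg := one_le_logPow hn hε
  have hv := one_le_quarter hn
  have hb := h.b_pos
  have hP : 0 ≤ pInf + F.zHi := by
    have := h.pS_mem_Icc ⟨0, h.M_pos⟩
    linarith [this.1, this.2, h.z_pos, h.z_lt]
  have key := explore_sum_le (ε := ε) (n := n) (x := n * ∑ m, d m (pS m) * (pS m - zS))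
    (E := M * ((b * W ^ 2 + 5 * C * (pInf + F.zHi))
      * (quarter n ^ 2 * Real.log n * logPow n ε ^ 15)))
    (f := fun j i => ∑ m, (gridPrice n ε j (phaseState F sel n ε obs j) m i - zS) *
      slotSales n ε obs j (phaseState F sel n ε obs j) m i)
    hn hlarge.two_le_log hε (by positivity) (by
      intro j hj i hi
      have Hj := H j hj.le
      have hτ := tau_pos hn hε j
      have hN0 : (0 : ℝ) < (gridN n ε j : ℝ) + 1 := by positivity
      have h1 := GoodObs.window_lagrangian h hobs (slotTime_nonneg hn hε j i)
        (slotTime_mono hn hε j (Nat.le_succ i))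
        ((slotTime_succ_le_lastStart hn hε hj hi).trans hT)
        (fun m => (Hj.gridPrice_mem h hη m hi).1) (fun m => (Hj.gridPrice_mem h hη m hi).2)
      rw [Nat.succ_eq_add_one, slotTime_succ_sub] at h1
      refine h1.trans ?_
      rw [mul_div_assoc]
      refine mul_le_mul_of_nonneg_left ?_ (Nat.cast_nonneg M)
      rw [le_div_iff₀ hN0]
      have e1 := mul_tau_mul_width_sq hn ε j
      have e2 := phase_deviation_le hn hε j
      have e3 : quarter n ^ 2 * Real.log n * logPow n ε ^ 9
          ≤ quarter n ^ 2 * Real.log n * logPow n ε ^ 15 := by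
        have : logPow n ε ^ 9 ≤ logPow n ε ^ 15 := pow_le_pow_right₀ hg (by norm_num)
        gcongr
      calc (n * (tau n ε j / (gridN n ε j + 1)) * (b * (W * width n j) ^ 2)
            + (pInf + F.zHi) * devBound C n (tau n ε j / (gridN n ε j + 1))) * (gridN n ε j + 1)
          = b * W ^ 2 * (n * tau n ε j * width n j ^ 2)
            + C * (pInf + F.zHi) * ((gridN n ε j + 1) *
            (√(n * (tau n ε j / (gridN n ε j + 1)) * Real.log n) + Real.log n)) := by
            rw [devBound]; field_simp
        _ ≤ b * W ^ 2 * (quarter n ^ 2 * Real.log n * logPow n ε ^ 15)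
            + C * (pInf + F.zHi) * (5 * (quarter n ^ 2 * Real.log n * logPow n ε ^ 15)) := by
            have := e2.trans (mul_le_mul_of_nonneg_left e3 (by norm_num : (0 : ℝ) ≤ 5))
            rw [e1]
            gcongr
        _ = _ := by ring)
  refine key.trans ?_
  have e4 : logPow n ε ^ 15 ≤ logPow n ε ^ 18 := pow_le_pow_right₀ hg (by norm_num)
  calc _ = M * (b * W ^ 2 + 5 * C * (pInf + F.zHi))
        * (quarter n ^ 2 * Real.log n ^ 2 * logPow n ε ^ 15) := by ring
    _ ≤ _ := by gcongr

end Explore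

end PersonalizedPricing

namespace PersonalizedPricing

/-! ### The last phase on the good event -/

variable {M : ℕ}

/-- The projection in the definition of `θ` is inactive if the target rate is well between the
two observed rates. -/
lemma projection_inactive {T' R rL rH x k k' : ℝ} (hT : 0 < T') (hx : 0 < x) (hk : 0 < k)
    (h1 : k * x ≤ rL - R / T') (h2 : rL - R / T' ≤ k' * x)
    (h3 : k * x ≤ R / T' - rH) (h4 : R / T' - rH ≤ k' * x) :
    ∃ θ, θ = max 0 (min 1 ((R - T' * rH) / (T' * (rL - rH)))) ∧
      k / (2 * k') ≤ θ ∧ θ ≤ 1 - k / (2 * k') ∧ R = T' * (θ * rL + (1 - θ) * rH) := by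
  have hkx : 0 < k * x := mul_pos hk hx
  have hden : 0 < rL - rH := by linarith
  have hk' : 0 < k' := by
    have : 0 < k' * x := by linarith
    exact pos_of_mul_pos_left this hx.le
  set q := R / T' with hq
  have hR : R = T' * q := by rw [hq]; field_simp
  set θ := (q - rH) / (rL - rH) with hθ
  have e1 : (R - T' * rH) / (T' * (rL - rH)) = θ := by
    rw [hR, hθ, ← mul_sub]
    exact mul_div_mul_left _ _ hT.ne'
  have hlow : k / (2 * k') ≤ θ := by
    rw [hθ, div_le_div_iff₀ (by positivity) hden]
    calc k * (rL - rH) ≤ k * (2 * (k' * x)) := by gcongr; linarith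
      _ = k * x * (2 * k') := by ring
      _ ≤ (q - rH) * (2 * k') := by gcongr
  have hhigh : θ ≤ 1 - k / (2 * k') := by
    have e2 : 1 - θ = (rL - q) / (rL - rH) := by rw [hθ]; field_simp; ring
    have : k / (2 * k') ≤ 1 - θ := by
      rw [e2, div_le_div_iff₀ (by positivity) hden]
      calc k * (rL - rH) ≤ k * (2 * (k' * x)) := by gcongr; linarith
        _ = k * x * (2 * k') := by ring
        _ ≤ (rL - q) * (2 * k') := by gcongr
    linarith
  have hpos : 0 < k / (2 * k') := by positivity
  refine ⟨θ, ?_, hlow, hhigh, ?_⟩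
  · rw [e1, min_eq_right (by linarith), max_eq_right (by linarith)]
  · rw [hR, hθ]; field_simp; ring

section Last

variable {F : FirmInfo} {d : Fin M → ℝ → ℝ} {pInf zS : ℝ} {pS : Fin M → ℝ} {a b l B : ℝ}
  {sel : Finset ℕ → ℕ} {C : ℝ} {n : ℕ} {ε η W G : ℝ} {obs : Fin M → ℝ → ℝ → ℝ → ℝ}

/-- The prices of the last phase deviate by one to two markups from the optimal prices. -/
lemma PhaseInv.last_prices (hη : 0 < η) (hε : 0 < ε) (hlarge : IsLarge n ε W)
    (H : PhaseInv F zS pS n ε η W (numExplore n ε) (lastState F sel n ε obs)) (m : Fin M) :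
    (alpha n ε ≤ pS m - lowPrice F sel n ε obs m ∧
      pS m - lowPrice F sel n ε obs m ≤ 2 * alpha n ε) ∧
    (alpha n ε ≤ highPrice F sel n ε obs m - pS m ∧
      highPrice F sel n ε obs m - pS m ≤ 2 * alpha n ε) := by
  have hn := hlarge.three_le
  have hg := one_le_logPow hn hε
  have h0 : 0 ≤ η * ((lastState F sel n ε obs).zu - (lastState F sel n ε obs).zl) :=
    mul_nonneg hη.le (by linarith [H.zl_le, H.le_zu])
  have h1 := H.pl_le m
  have h2 := H.le_pu m
  have h3 := H.p_width m
  have h4 : W * width n (numExplore n ε) ≤ alpha n ε := by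
    have h5 := width_numExplore_le hn hlarge.two_le_log hε
    have h6 := hlarge.le_logPow
    have hα := alpha_pos hn hε
    calc W * width n (numExplore n ε) ≤ logPow n ε * (alpha n ε / logPow n ε) := by
          have := (width_pos hn (numExplore n ε)).le
          gcongr
      _ = alpha n ε := by field_simp
  rw [lowPrice, highPrice]
  exact ⟨⟨by linarith, by linarith⟩, ⟨by linarith, by linarith⟩⟩

lemma last_prices_mem {p q : ℝ} (h1 : 0 ≤ alpha n ε)
    (h : (alpha n ε ≤ p - q ∧ p - q ≤ 2 * alpha n ε) ∨ (alpha n ε ≤ q - p ∧ q - p ≤ 2 * alpha n ε))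
    (h2 : 2 * alpha n ε ≤ p) (h3 : 2 * alpha n ε ≤ pInf - p) :
    q ∈ Icc 0 pInf ∧ |q - p| ≤ 2 * alpha n ε := by
  refine ⟨⟨?_, ?_⟩, abs_le.mpr ⟨?_, ?_⟩⟩ <;> rcases h with h | h <;> linarith [h.1, h.2]

lemma lastStart_add_le (hε : 0 < ε) (hT : 0 < F.T) (hlarge : IsLarge n ε (3 / F.T)) :
    lastStart n ε + 2 * testLength n ε ≤ F.T := by
  have hn := hlarge.three_le
  have hg := one_le_logPow hn hε
  have h1 := lastStart_le hn hlarge.two_le_log hε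
  have h2 := hlarge.le_logPow
  rw [testLength_eq hn]
  have h3 : 1 / logPow n ε ≤ F.T / 3 := by
    rw [div_le_div_iff₀ (by positivity) (by norm_num)]
    rw [div_le_iff₀ hT] at h2
    linarith
  linarith

lemma testLength_pos (hn : 3 ≤ n) (hε : 0 < ε) : 0 < testLength n ε := by
  have hg := one_le_logPow hn hε
  rw [testLength_eq hn]; positivity

lemma lastStart_nonneg (hn : 3 ≤ n) (hε : 0 < ε) : 0 ≤ lastStart n ε := phaseStart_nonneg hn hε _

lemma switchTime_mem (hT : lastStart n ε + 2 * testLength n ε ≤ F.T) :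
    switchTime F sel n ε obs ∈ Icc (lastStart n ε + 2 * testLength n ε) F.T :=
  ⟨le_max_left _ _, max_le hT (min_le_left _ _)⟩

/-- Accuracy of the observed sales rates in the tests. -/
lemma test_rate_le (hn : 3 ≤ n) (hε : 0 < ε) (hC : 0 < C) (hobs : GoodObs F d C n obs)
    {p : Fin M → ℝ} {s : ℝ} (hs : 0 ≤ s) (ht : s + testLength n ε ≤ F.T) :
    |logPow n ε * ∑ m, obs m s (s + testLength n ε) (p m) - n * ∑ m, d m (p m)|
      ≤ 2 * M * C * (quarter n ^ 2 * Real.log n * logPow n ε) := by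
  have hg := one_le_logPow hn hε
  have hL := one_le_log hn
  have hv := one_le_quarter hn
  have hh := testLength_pos hn hε
  have h1 := GoodObs.window_total hobs (p := p) hs (by linarith : s ≤ s + testLength n ε) ht
  rw [add_sub_cancel_left] at h1
  have hgh : logPow n ε * testLength n ε = 1 := by rw [testLength_eq hn]; field_simp
  have e : logPow n ε * ∑ m, obs m s (s + testLength n ε) (p m) - n * ∑ m, d m (p m)
      = logPow n ε * (∑ m, obs m s (s + testLength n ε) (p m)
        - n * (∑ m, d m (p m)) * testLength n ε) := by
    linear_combination (n * ∑ m, d m (p m)) * hgh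
  rw [e, abs_mul, abs_of_pos (by positivity)]
  have h2 : logPow n ε * √(n * testLength n ε * Real.log n)
      ≤ quarter n ^ 2 * Real.log n * logPow n ε := by
    have h3 : √(n * testLength n ε * Real.log n) ≤ quarter n ^ 2 * Real.log n := by
      apply Real.sqrt_le_iff.mpr
      refine ⟨by positivity, ?_⟩
      have h4 : testLength n ε ≤ 1 := by
        rw [testLength_eq hn, div_le_one (by positivity)]; exact hg
      rw [← quarter_pow_four n]
      have h5 : Real.log ((quarter n) ^ 4) = Real.log n := by rw [quarter_pow_four]
      rw [h5]
      calc quarter n ^ 4 * testLength n ε * Real.log n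
          ≤ quarter n ^ 4 * 1 * Real.log n ^ 2 := by
            gcongr
            nlinarith
        _ = _ := by ring
    calc _ ≤ logPow n ε * (quarter n ^ 2 * Real.log n) := by gcongr
      _ = _ := by ring
  have h3 : logPow n ε * Real.log n ≤ quarter n ^ 2 * Real.log n * logPow n ε := by
    have : 1 ≤ quarter n ^ 2 := one_le_pow₀ hv
    calc logPow n ε * Real.log n = 1 * Real.log n * logPow n ε := by ring
      _ ≤ _ := by gcongr
  calc logPow n ε * |_| ≤ logPow n ε * (M * devBound C n (testLength n ε)) := by gcongr
    _ = M * C * (logPow n ε * √(n * testLength n ε * Real.log n) + logPow n ε * Real.log n) := by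
        rw [devBound]; ring
    _ ≤ M * C * (quarter n ^ 2 * Real.log n * logPow n ε
          + quarter n ^ 2 * Real.log n * logPow n ε) := by gcongr
    _ = _ := by ring

/-- The Lagrangian collected in the last phase. -/
lemma last_lagrangian_le (h : MarketBounds F d pInf zS pS a b l B) (hC : 0 < C) (hε : 0 < ε)
    (hn : 3 ≤ n) (hT : lastStart n ε + 2 * testLength n ε ≤ F.T) (hobs : GoodObs F d C n obs)
    (hlow : ∀ m, lowPrice F sel n ε obs m ∈ Icc 0 pInf ∧
      |lowPrice F sel n ε obs m - pS m| ≤ 2 * alpha n ε)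
    (hhigh : ∀ m, highPrice F sel n ε obs m ∈ Icc 0 pInf ∧
      |highPrice F sel n ε obs m - pS m| ≤ 2 * alpha n ε) :
    |lastValue F sel n ε obs (fun p => p - zS)
        - n * (∑ m, d m (pS m) * (pS m - zS)) * (F.T - lastStart n ε)|
      ≤ 4 * (M * (4 * F.T * b + (pInf + F.zHi) * (C * (F.T + 2))))
        * (quarter n ^ 2 * Real.log n ^ 2 * logPow n ε ^ 18) := by
  have hL := one_le_log hn
  have hg := one_le_logPow hn hε
  have hv := one_le_quarter hn
  have hb := h.b_pos
  have hTpos := h.T_pos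
  have hP : 0 ≤ pInf + F.zHi := by
    have := h.pS_mem_Icc ⟨0, h.M_pos⟩
    linarith [this.1, this.2, h.z_pos, h.z_lt]
  have hsw := switchTime_mem (F := F) (sel := sel) (obs := obs) hT
  have hh := testLength_pos hn hε
  have htK := lastStart_nonneg hn hε
  have hwin : ∀ (p : Fin M → ℝ) (s t : ℝ), 0 ≤ s → s ≤ t → t ≤ F.T →
      (∀ m, p m ∈ Icc 0 pInf ∧ |p m - pS m| ≤ 2 * alpha n ε) →
      |∑ m, (p m - zS) * obs m s t (p m) - n * (∑ m, d m (pS m) * (pS m - zS)) * (t - s)|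
        ≤ M * (4 * F.T * b + (pInf + F.zHi) * (C * (F.T + 2)))
          * (quarter n ^ 2 * Real.log n ^ 2 * logPow n ε ^ 18) := by
    intro p s t hs hst ht hp
    refine (GoodObs.window_lagrangian h hobs hs hst ht (fun m => (hp m).1)
      (fun m => (hp m).2)).trans ?_
    rw [mul_assoc (M : ℝ)]
    refine mul_le_mul_of_nonneg_left ?_ (Nat.cast_nonneg M)
    have h1 : devBound C n (t - s) ≤ C * (F.T + 2)
        * (quarter n ^ 2 * Real.log n ^ 2 * logPow n ε ^ 18) := by
      refine (devBound_le hC.le hn (by linarith : t - s ≤ F.T) hTpos.le).trans ?_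
      have h2 : Real.log n ≤ Real.log n ^ 2 * logPow n ε ^ 18 := by
        have h3 : (1 : ℝ) ≤ logPow n ε ^ 18 := one_le_pow₀ hg
        nlinarith
      rw [mul_assoc (quarter n ^ 2)]
      gcongr
    have h2 : n * (t - s) * (b * (2 * alpha n ε) ^ 2)
        ≤ 4 * F.T * b * (quarter n ^ 2 * Real.log n ^ 2 * logPow n ε ^ 18) := by
      -- The markup is the term that determines the final rate.
      have e1 : n * alpha n ε ^ 2 = quarter n ^ 2 * Real.log n ^ 2 * logPow n ε ^ 18 := by
        rw [alpha_eq hn]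
        nth_rewrite 1 [← quarter_pow_four n]
        field_simp
      rw [← e1]
      calc n * (t - s) * (b * (2 * alpha n ε) ^ 2) = (t - s) * (4 * b * (n * alpha n ε ^ 2)) := by
            ring
        _ ≤ F.T * (4 * b * (n * alpha n ε ^ 2)) := by gcongr; linarith
        _ = _ := by ring
    calc _ ≤ 4 * F.T * b * (quarter n ^ 2 * Real.log n ^ 2 * logPow n ε ^ 18)
          + (pInf + F.zHi) * (C * (F.T + 2)
            * (quarter n ^ 2 * Real.log n ^ 2 * logPow n ε ^ 18)) := by gcongr
      _ = _ := by ring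
  have w1 := hwin _ (lastStart n ε) (lastStart n ε + testLength n ε) htK (by linarith)
    (by linarith) hlow
  have w2 := hwin _ (lastStart n ε + testLength n ε) (lastStart n ε + 2 * testLength n ε)
    (by linarith) (by linarith) hT hhigh
  have w3 := hwin _ (lastStart n ε + 2 * testLength n ε) (switchTime F sel n ε obs)
    (by linarith) hsw.1 hsw.2 hlow
  have w4 := hwin _ (switchTime F sel n ε obs) F.T (by linarith [hsw.1]) hsw.2 le_rfl hhigh
  rw [abs_le] at w1 w2 w3 w4 ⊢
  rw [lastValue]
  constructor <;> nlinarith [w1.1, w1.2, w2.1, w2.2, w3.1, w3.2, w4.1, w4.2]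

end Last

end PersonalizedPricing

namespace PersonalizedPricing

/-! ### Steering the sales to the inventory level. -/

variable {M : ℕ} {F : FirmInfo} {d : Fin M → ℝ → ℝ} {pInf zS : ℝ} {pS : Fin M → ℝ} {a b l B : ℝ}

/-- Demand at prices at distance between `x` and `2 x` above (or below) the optimal prices. -/
lemma MarketBounds.total_demand_shift (h : MarketBounds F d pInf zS pS a b l B) {q : Fin M → ℝ}
    {x : ℝ} (hx : 0 < x) (hq : ∀ m, q m ∈ Icc 0 pInf) :
    ((∀ m, x ≤ pS m - q m ∧ pS m - q m ≤ 2 * x) →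
      M / l * x ≤ ∑ m, d m (q m) - ∑ m, d m (pS m) ∧
      ∑ m, d m (q m) - ∑ m, d m (pS m) ≤ 2 * l * M * x) ∧
    ((∀ m, x ≤ q m - pS m ∧ q m - pS m ≤ 2 * x) →
      M / l * x ≤ ∑ m, d m (pS m) - ∑ m, d m (q m) ∧
      ∑ m, d m (pS m) - ∑ m, d m (q m) ≤ 2 * l * M * x) := by
  have hl := h.l_pos
  have hcard : ∀ y : ℝ, ∑ _m : Fin M, y = M * y := fun y => by
    rw [Finset.sum_const, Finset.card_univ, Fintype.card_fin, nsmul_eq_mul]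
  constructor <;> intro hd
  · rw [← Finset.sum_sub_distrib]
    constructor
    · calc M / l * x = ∑ _m : Fin M, x / l := by rw [hcard]; ring
        _ ≤ _ := Finset.sum_le_sum fun m _ => by
          have h1 := h.expand m (q m) (hq m)
          have h2 := hd m
          rw [div_le_iff₀ hl] at h1 ⊢
          have h3 : 0 < pS m - q m := by linarith
          have h4 : (pS m - q m) * (pS m - q m) ≤ (d m (q m) - d m (pS m)) * l * (pS m - q m) := by
            nlinarith
          linarith [le_of_mul_le_mul_right h4 h3]
    · calc _ ≤ ∑ _m : Fin M, l * (2 * x) := Finset.sum_le_sum fun m _ => by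
            have h1 := h.lip m (q m) (hq m)
            have h2 := hd m
            refine (le_abs_self _).trans (h1.trans ?_)
            rw [abs_sub_comm, abs_of_pos (by linarith)]
            gcongr
            exact h2.2
        _ = _ := by rw [hcard]; ring
  · rw [← Finset.sum_sub_distrib]
    constructor
    · calc M / l * x = ∑ _m : Fin M, x / l := by rw [hcard]; ring
        _ ≤ _ := Finset.sum_le_sum fun m _ => by
          have h1 := h.expand m (q m) (hq m)
          have h2 := hd m
          rw [div_le_iff₀ hl] at h1 ⊢
          have h3 : 0 < q m - pS m := by linarith
          have h4 : (q m - pS m) * (q m - pS m) ≤ (d m (pS m) - d m (q m)) * l * (q m - pS m) := by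
            nlinarith
          linarith [le_of_mul_le_mul_right h4 h3]
    · calc _ ≤ ∑ _m : Fin M, l * (2 * x) := Finset.sum_le_sum fun m _ => by
            have h1 := h.lip m (q m) (hq m)
            have h2 := hd m
            rw [abs_sub_comm] at h1
            refine (le_abs_self _).trans (h1.trans ?_)
            rw [abs_of_pos (by linarith)]
            gcongr
            exact h2.2
        _ = _ := by rw [hcard]; ring

set_option maxHeartbeats 1000000 in
/-- In the last phase the sales use up the inventory, up to a small error. -/
theorem MarketBounds.exists_last_sales (h : MarketBounds F d pInf zS pS a b l B) {C : ℝ}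
    (hC : 0 < C) {K : ℝ} (hK : 0 ≤ K) :
    ∃ G : ℝ, ∀ (n : ℕ) (ε : ℝ) (obs : Fin M → ℝ → ℝ → ℝ → ℝ) (sel : Finset ℕ → ℕ),
      0 < ε → IsLarge n ε G → GoodObs F d C n obs →
      |exploreValue F sel n ε obs (fun _ => 1) - n * (∑ m, d m (pS m)) * lastStart n ε|
        ≤ K * (quarter n ^ 3 * Real.log n * logPow n ε ^ 7) →
      (∀ m, lowPrice F sel n ε obs m ∈ Icc 0 pInf ∧ highPrice F sel n ε obs m ∈ Icc 0 pInf) →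
      (∀ m, alpha n ε ≤ pS m - lowPrice F sel n ε obs m ∧
        pS m - lowPrice F sel n ε obs m ≤ 2 * alpha n ε) →
      (∀ m, alpha n ε ≤ highPrice F sel n ε obs m - pS m ∧
        highPrice F sel n ε obs m - pS m ≤ 2 * alpha n ε) →
      |exploreValue F sel n ε obs (fun _ => 1) + lastValue F sel n ε obs (fun _ => 1) - n * F.c|
        ≤ (4 * (M * (C * (F.T + 2))) + F.T * (2 * M * C))
          * (quarter n ^ 2 * Real.log n ^ 2 * logPow n ε ^ 18) := by
  have hl := h.l_pos
  have hM : (0 : ℝ) < M := by exact_mod_cast h.M_pos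
  have hTpos := h.T_pos
  -- The total demand shifts by at least `κ α` at the last prices. Half of it is sacrificed to the
  -- errors of the tests and of the exploration, hence `k = κ / 2`, and the same half is added to
  -- the upper bound in `k'`.
  set κ : ℝ := M / l with hκ
  have hκ0 : 0 < κ := by positivity
  set k : ℝ := κ / 2 with hk
  set k' : ℝ := 2 * l * M + κ / 2 with hk'
  have hk0 : 0 < k := by positivity
  have hk'0 : 0 < k' := by positivity
  set θ₀ : ℝ := k / (2 * k') with hθ₀
  have hθ₀0 : 0 < θ₀ := by positivity
  set Q : ℝ := 2 * M * C + 2 * K / F.T with hQ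
  have hQ0 : 0 < Q := by positivity
  refine ⟨1 + 3 / F.T + 2 / (θ₀ * F.T) + 2 * Q / κ, ?_⟩
  intro n ε obs sel hε hlarge hobs hS hmem hlow hhigh
  have hn := hlarge.three_le
  have hL := one_le_log hn
  have hg := one_le_logPow hn hε
  have hv := one_le_quarter hn
  have hα := alpha_pos hn hε
  have p1 : 0 < 3 / F.T := by positivity
  have p2 : 0 < 2 / (θ₀ * F.T) := by positivity
  have p3 : 0 < 2 * Q / κ := by positivity
  have hTend := lastStart_add_le (ε := ε) (F := F) hε hTpos (hlarge.mono (by linarith))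
  have hh := testLength_pos hn hε
  have htK := lastStart_nonneg hn hε
  have hgG := hlarge.le_logPow
  have hh1 : testLength n ε = 1 / logPow n ε := testLength_eq hn ε
  have htK2 := lastStart_le hn hlarge.two_le_log hε
  have hT3 : 1 / logPow n ε ≤ F.T / 3 := by
    rw [div_le_div_iff₀ (by positivity) (by norm_num)]
    have : 3 / F.T ≤ logPow n ε := by linarith
    rw [div_le_iff₀ hTpos] at this
    linarith
  -- abbreviations
  set D := ∑ m, d m (pS m) with hD
  set Dl := ∑ m, d m (lowPrice F sel n ε obs m) with hDl
  set Du := ∑ m, d m (highPrice F sel n ε obs m) with hDu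
  set Se := exploreValue F sel n ε obs (fun _ => 1) with hSe
  set tK := lastStart n ε with htKdef
  set hh' := testLength n ε with hhdef
  set E₁ := 2 * M * C * (quarter n ^ 2 * Real.log n * logPow n ε) with hE₁
  have hE₁0 : 0 ≤ E₁ := by positivity
  set T' := F.T - tK with hT'
  have hT'0 : 0 < T' := by linarith
  have hT'2 : F.T / 2 ≤ T' := by linarith
  set rL := rateLow F sel n ε obs with hrL
  set rH := rateHigh F sel n ε obs with hrH
  have hrL1 : |rL - n * Dl| ≤ E₁ := test_rate_le hn hε hC hobs htK (by linarith)
  have hrH1 : |rH - n * Du| ≤ E₁ := by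
    have := test_rate_le (p := highPrice F sel n ε obs) hn hε hC hobs
      (s := tK + hh') (by linarith) (by linarith)
    rw [show tK + hh' + testLength n ε = tK + 2 * hh' by rw [← hhdef]; ring] at this
    exact this
  set R := n * F.c - Se with hR
  set u := n * alpha n ε with hu
  have hn0 : (0 : ℝ) < n := by positivity
  have hu0 : 0 < u := by positivity
  have hu_eq : u = quarter n ^ 3 * Real.log n * logPow n ε ^ 9 := by
    rw [hu, alpha_eq hn]
    nth_rewrite 1 [← quarter_pow_four n]
    field_simp
  have hE₁u : E₁ ≤ 2 * M * C / logPow n ε * u := by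
    rw [hE₁, hu_eq]
    have e : quarter n ^ 2 * Real.log n * logPow n ε
        ≤ quarter n ^ 3 * Real.log n * logPow n ε ^ 8 := by
      have : logPow n ε ≤ logPow n ε ^ 8 := le_self_pow₀ hg (by norm_num)
      have : quarter n ^ 2 ≤ quarter n ^ 3 := pow_le_pow_right₀ hv (by norm_num)
      gcongr
    calc _ ≤ 2 * M * C * (quarter n ^ 3 * Real.log n * logPow n ε ^ 8) := by gcongr
      _ = _ := by field_simp
  -- By slackness, `n D` is the rate that would exhaust the inventory over the season, so the target
  -- rate for the remaining time differs from it only by the exploration's deviation spread over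
  -- `T'`.
  have hq : R / T' - n * D = -(Se - n * D * tK) / T' := by
    rw [hR, h.slack, ← hD]
    field_simp
    rw [hT']; ring
  have hq1 : |R / T' - n * D| ≤ 2 * K / F.T / logPow n ε * u := by
    rw [hq, abs_div, abs_neg, abs_of_pos hT'0, div_le_iff₀ hT'0]
    refine hS.trans ?_
    rw [hu_eq]
    calc K * (quarter n ^ 3 * Real.log n * logPow n ε ^ 7)
        ≤ K * (quarter n ^ 3 * Real.log n * logPow n ε ^ 8) := by
          have : logPow n ε ^ 7 ≤ logPow n ε ^ 8 := pow_le_pow_right₀ hg (by norm_num)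
          gcongr
      _ = 2 * K / F.T / logPow n ε * (quarter n ^ 3 * Real.log n * logPow n ε ^ 9) * (F.T / 2) := by
          field_simp
      _ ≤ _ := by gcongr
  -- Both errors are smaller than the leverage `u = n α` by a factor of order `1 / g`.
  have herr : E₁ + |R / T' - n * D| ≤ κ / 2 * u := by
    calc _ ≤ 2 * M * C / logPow n ε * u + 2 * K / F.T / logPow n ε * u := add_le_add hE₁u hq1
      _ = Q / logPow n ε * u := by rw [hQ]; ring
      _ ≤ κ / 2 * u := by
        refine mul_le_mul_of_nonneg_right ?_ hu0.le
        rw [div_le_div_iff₀ (by positivity) (by norm_num)]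
        have : 2 * Q / κ ≤ logPow n ε := by linarith
        rw [div_le_iff₀ hκ0] at this
        linarith
  obtain ⟨hl1, hl2⟩ := (h.total_demand_shift hα fun m => (hmem m).1).1 hlow
  obtain ⟨hu1, hu2⟩ := (h.total_demand_shift hα fun m => (hmem m).2).2 hhigh
  rw [← hD, ← hDl] at hl1 hl2
  rw [← hD, ← hDu] at hu1 hu2
  have hl1' : κ * u ≤ n * Dl - n * D := by
    have := mul_le_mul_of_nonneg_left hl1 hn0.le
    rw [hu]; linarith
  have hl2' : n * Dl - n * D ≤ 2 * l * M * u := by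
    have := mul_le_mul_of_nonneg_left hl2 hn0.le
    rw [hu]; linarith
  have hu1' : κ * u ≤ n * D - n * Du := by
    have := mul_le_mul_of_nonneg_left hu1 hn0.le
    rw [hu]; linarith
  have hu2' : n * D - n * Du ≤ 2 * l * M * u := by
    have := mul_le_mul_of_nonneg_left hu2 hn0.le
    rw [hu]; linarith
  have b1 := abs_le.mp hrL1
  have b2 := abs_le.mp hrH1
  have b3 := abs_le.mp (le_refl |R / T' - n * D|)
  have hku : k * u = κ * u - κ / 2 * u := by rw [hk]; ring
  have hk'u : k' * u = 2 * l * M * u + κ / 2 * u := by rw [hk']; ring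
  obtain ⟨θ, hθ, hθ1, hθ2, hRθ⟩ := projection_inactive (R := R) (rL := rL) (rH := rH) hT'0 hu0 hk0
    (k' := k') (by rw [hku]; linarith only [herr, hl1', b1.1, b3.2, b3.1, b1.2])
    (by rw [hk'u]; linarith only [herr, hl2', b1.1, b3.2, b3.1, b1.2])
    (by rw [hku]; linarith only [herr, hu1', b2.1, b3.2, b3.1, b2.2])
    (by rw [hk'u]; linarith only [herr, hu2', b2.1, b3.2, b3.1, b2.2])
  rw [← hθ₀] at hθ1 hθ2
  have hθdef : theta F sel n ε obs = θ := by
    rw [theta, hθ, exploreSales_eq]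
  -- `θ` stays away from `0` and `1`, while the test length `1 / g` tends to `0`; so the projection
  -- in the switch time is inactive as well.
  have hθT : hh' ≤ θ₀ * T' := by
    rw [hh1]
    calc 1 / logPow n ε ≤ θ₀ * (F.T / 2) := by
          rw [div_le_iff₀ (by positivity)]
          have : 2 / (θ₀ * F.T) ≤ logPow n ε := by linarith only [hgG, p1, p2, p3]
          rw [div_le_iff₀ (by positivity)] at this
          linarith only [this]
      _ ≤ θ₀ * T' := by gcongr
  have hθT1 : hh' ≤ θ * T' := hθT.trans (by gcongr)
  have hθT2 : hh' ≤ (1 - θ) * T' := hθT.trans (by gcongr; linarith only [hθ2])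
  have hsw : switchTime F sel n ε obs = tK + θ * T' + hh' := by
    rw [switchTime, hθdef, ← htKdef, ← hhdef, ← hT', min_eq_right (by linarith only [hθT2, hT']),
      max_eq_right (by linarith only [hθT1])]
  have hswm := switchTime_mem (F := F) (sel := sel) (obs := obs) hTend
  rw [← htKdef, ← hhdef] at hswm
  have hwin : ∀ (p : Fin M → ℝ) (s t : ℝ), 0 ≤ s → s ≤ t → t ≤ F.T →
      |∑ m, obs m s t (p m) - n * (∑ m, d m (p m)) * (t - s)|
        ≤ M * (C * (F.T + 2) * (quarter n ^ 2 * Real.log n)) := by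
    intro p s t hs hst ht
    refine (GoodObs.window_total hobs hs hst ht).trans ?_
    have := devBound_le hC.le hn (by linarith only [hs, ht] : t - s ≤ F.T) hTpos.le
    gcongr
  have w1 := abs_le.mp (hwin (lowPrice F sel n ε obs) tK (tK + hh') htK (by linarith only [hh]) (by linarith only [hh, hTend]))
  have w2 := abs_le.mp (hwin (highPrice F sel n ε obs) (tK + hh') (tK + 2 * hh') (by linarith only [hh, htK])
    (by linarith only [hh]) hTend)
  have w3 := abs_le.mp (hwin (lowPrice F sel n ε obs) (tK + 2 * hh') (switchTime F sel n ε obs)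
    (by linarith only [hh, htK]) hswm.1 hswm.2)
  have w4 := abs_le.mp (hwin (highPrice F sel n ε obs) (switchTime F sel n ε obs) F.T
    (by linarith only [hswm.1, hh, htK]) hswm.2 le_rfl)
  set Wd := M * (C * (F.T + 2) * (quarter n ^ 2 * Real.log n)) with hWd
  rw [← hDl] at w1 w3
  rw [← hDu] at w2 w4
  have hlast : lastValue F sel n ε obs (fun _ => 1)
      = ∑ m, obs m tK (tK + hh') (lowPrice F sel n ε obs m)
        + ∑ m, obs m (tK + hh') (tK + 2 * hh') (highPrice F sel n ε obs m)
        + ∑ m, obs m (tK + 2 * hh') (switchTime F sel n ε obs) (lowPrice F sel n ε obs m)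
        + ∑ m, obs m (switchTime F sel n ε obs) F.T (highPrice F sel n ε obs m) := by
    simp only [lastValue, one_mul]; rfl
  -- The tests count: the extra test length in the switch time makes the lower prices active for
  -- exactly `θ T'` and the upper ones for `(1 - θ) T'`.
  have hmean : n * Dl * (tK + hh' - tK) + n * Du * (tK + 2 * hh' - (tK + hh'))
      + n * Dl * (switchTime F sel n ε obs - (tK + 2 * hh'))
      + n * Du * (F.T - switchTime F sel n ε obs)
      = T' * (θ * (n * Dl) + (1 - θ) * (n * Du)) := by
    rw [hsw, hT']; ring
  have hθ0 : 0 ≤ θ := by linarith only [hθ1, hθ₀0]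
  have hθ1' : 0 ≤ 1 - θ := by linarith only [hθ2, hθ₀0]
  -- `θ` solves the equation exactly for the observed rates, and the true mixture is a convex
  -- combination, so only the test error `E₁` survives, not the leverage.
  have hmix : |T' * (θ * (n * Dl) + (1 - θ) * (n * Du)) - R| ≤ F.T * E₁ := by
    rw [hRθ]
    have e1 : |θ * (n * Dl - rL) + (1 - θ) * (n * Du - rH)| ≤ E₁ := by
      refine (abs_add_le _ _).trans ?_
      rw [abs_mul, abs_mul, abs_of_nonneg hθ0, abs_of_nonneg hθ1', abs_sub_comm, abs_sub_comm _ rH]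
      calc _ ≤ θ * E₁ + (1 - θ) * E₁ := by gcongr
        _ = E₁ := by ring
    rw [show T' * (θ * (n * Dl) + (1 - θ) * (n * Du)) - T' * (θ * rL + (1 - θ) * rH)
      = T' * (θ * (n * Dl - rL) + (1 - θ) * (n * Du - rH)) by ring, abs_mul, abs_of_pos hT'0]
    have : T' ≤ F.T := by linarith only [hT', htK]
    gcongr
  have b4 := abs_le.mp hmix
  have hfinal : 4 * Wd + F.T * E₁ ≤ (4 * (M * (C * (F.T + 2))) + F.T * (2 * M * C))
      * (quarter n ^ 2 * Real.log n ^ 2 * logPow n ε ^ 18) := by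
    have e1 : Real.log n ≤ Real.log n ^ 2 * logPow n ε ^ 18 := by
      have h3 : (1 : ℝ) ≤ logPow n ε ^ 18 := one_le_pow₀ hg
      nlinarith only [h3, hL]
    have e2 : Real.log n * logPow n ε ≤ Real.log n ^ 2 * logPow n ε ^ 18 := by
      have h3 : logPow n ε ≤ logPow n ε ^ 18 := le_self_pow₀ hg (by norm_num)
      have h4 : Real.log n ≤ Real.log n ^ 2 := le_self_pow₀ hL (by norm_num)
      gcongr
    calc 4 * Wd + F.T * E₁
        = 4 * (M * (C * (F.T + 2))) * (quarter n ^ 2 * Real.log n)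
          + F.T * (2 * M * C) * (quarter n ^ 2 * (Real.log n * logPow n ε)) := by
          rw [hWd, hE₁]; ring
      _ ≤ 4 * (M * (C * (F.T + 2))) * (quarter n ^ 2 * (Real.log n ^ 2 * logPow n ε ^ 18))
          + F.T * (2 * M * C) * (quarter n ^ 2 * (Real.log n ^ 2 * logPow n ε ^ 18)) := by
          gcongr
      _ = _ := by ring
  refine le_trans ?_ hfinal
  rw [hlast, show Se = n * F.c - R by rw [hR]; ring, abs_le]
  constructor <;> linarith only [hmean, w1.1, w1.2, w2.1, w2.2, w3.1, w3.2, w4.1, w4.2, b4.1, b4.2]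

/-- Everything that is needed about the algorithm on the good event. -/
structure GoodPath (F : FirmInfo) (d : Fin M → ℝ → ℝ) (pInf zS : ℝ) (pS : Fin M → ℝ)
    (sel : Finset ℕ → ℕ) (n : ℕ) (ε E : ℝ) (obs : Fin M → ℝ → ℝ → ℝ → ℝ) : Prop where
  not_zero : ¬ (0 : ℝ) ∈ Icc (lastState F sel n ε obs).zl (lastState F sel n ε obs).zu
  grid_mem : ∀ j < numExplore n ε, ∀ i ∈ Finset.range (gridN n ε j + 1), ∀ m,
    gridPrice n ε j (phaseState F sel n ε obs j) m i ∈ Icc 0 pInf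
  low_mem : ∀ m, lowPrice F sel n ε obs m ∈ Icc 0 pInf
  high_mem : ∀ m, highPrice F sel n ε obs m ∈ Icc 0 pInf
  sales : |exploreValue F sel n ε obs (fun _ => 1) + lastValue F sel n ε obs (fun _ => 1)
    - n * F.c| ≤ E
  lagrangian : |exploreValue F sel n ε obs (fun p => p - zS)
    + lastValue F sel n ε obs (fun p => p - zS)
    - n * (F.T * ∑ m, d m (pS m) * (pS m - zS))| ≤ E

/-- The end of the deterministic analysis. The threshold `G` also makes `α` small enough for the
last prices to stay inside the price domain and for the dual interval to exclude `0`. -/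
theorem MarketBounds.exists_goodPath (h : MarketBounds F d pInf zS pS a b l B)
    {sel : Finset ℕ → ℕ} (hsel : ∀ s : Finset ℕ, s.Nonempty → sel s ∈ s) {C : ℝ} (hC : 0 < C) :
    ∃ G K : ℝ, 0 ≤ K ∧ ∀ (n : ℕ) (ε : ℝ) (obs : Fin M → ℝ → ℝ → ℝ → ℝ),
      0 < ε → IsLarge n ε G → GoodObs F d C n obs →
      GoodPath F d pInf zS pS sel n ε
        (K * (quarter n ^ 2 * Real.log n ^ 2 * logPow n ε ^ 18)) obs := by
  obtain ⟨η, W, G₁, hη, hW, hinv⟩ := h.exists_phaseInv hsel hC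
  obtain ⟨γ, hγ, -, -, hγz⟩ := h.exists_eta
  have hzHi : 0 < F.zHi := h.z_pos.trans h.z_lt
  have hl := h.l_pos
  have hb := h.b_pos
  have hTpos := h.T_pos
  have hzS := h.z_pos
  have hP : 0 ≤ pInf + F.zHi := by
    have := h.pS_mem_Icc ⟨0, h.M_pos⟩
    linarith [this.1, this.2]
  obtain ⟨G₂, hlast⟩ := h.exists_last_sales hC (K := M * (l * W + 5 * C)) (by positivity)
  set K₁ := (4 * (M * (C * (F.T + 2))) + F.T * (2 * M * C)) with hK₁
  set K₂ := M * (b * W ^ 2 + 5 * C * (pInf + F.zHi)) with hK₂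
  set K₃ := 4 * (M * (4 * F.T * b + (pInf + F.zHi) * (C * (F.T + 2)))) with hK₃
  have hK₁0 : 0 ≤ K₁ := by positivity
  have hK₂0 : 0 ≤ K₂ := by positivity
  have hK₃0 : 0 ≤ K₃ := by positivity
  refine ⟨|G₁| + |G₂| + W + 3 / F.T + 2 / (γ * F.zHi) + 2 / zS, K₁ + K₂ + K₃, by positivity, ?_⟩
  intro n ε obs hε hlarge hobs
  have q1 : 0 ≤ |G₁| := abs_nonneg _
  have q2 : 0 ≤ |G₂| := abs_nonneg _
  have q3 : 0 ≤ 3 / F.T := by positivity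
  have q4 : 0 ≤ 2 / (γ * F.zHi) := by positivity
  have q5 : 0 ≤ 2 / zS := by positivity
  have hlarge₂ : IsLarge n ε G₂ := hlarge.mono (by linarith [le_abs_self G₂])
  have hlargeW : IsLarge n ε W := hlarge.mono (by linarith)
  have hlarge1 : IsLarge n ε 1 := hlarge.mono (by linarith)
  have hn := hlarge.three_le
  have hα := alpha_pos hn hε
  have hL := one_le_log hn
  have hg := one_le_logPow hn hε
  have hv := one_le_quarter hn
  have hTend := lastStart_add_le (F := F) hε hTpos (hlarge.mono (by linarith))
  have hh := testLength_pos hn hε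
  have htT : lastStart n ε ≤ F.T := by linarith
  have H := hinv n ε obs hn hε (by linarith [hlarge.le_logPow, le_abs_self G₁]) htT hobs
  have HK := H _ le_rfl
  have hprices := PhaseInv.last_prices (sel := sel) (F := F) (obs := obs) hη hε hlargeW HK
  have hα2 : 2 * alpha n ε ≤ γ * F.zHi := by
    have h1 := (hlarge.mono (G' := 2 / (γ * F.zHi)) (by linarith)).alpha_le
    rw [mul_div_assoc', div_le_one (by positivity)] at h1
    linarith
  have hpS1 : ∀ m, 2 * alpha n ε ≤ pS m := fun m => by
    linarith [(hγz m).1, h.pLo_nonneg]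
  have hpS2 : ∀ m, 2 * alpha n ε ≤ pInf - pS m := fun m => by
    linarith [(hγz m).2, h.pHi_le]
  have hlowm : ∀ m, lowPrice F sel n ε obs m ∈ Icc 0 pInf ∧
      |lowPrice F sel n ε obs m - pS m| ≤ 2 * alpha n ε := fun m =>
    last_prices_mem hα.le (Or.inl (hprices m).1) (hpS1 m) (hpS2 m)
  have hhighm : ∀ m, highPrice F sel n ε obs m ∈ Icc 0 pInf ∧
      |highPrice F sel n ε obs m - pS m| ≤ 2 * alpha n ε := fun m =>
    last_prices_mem hα.le (Or.inr (hprices m).2) (hpS1 m) (hpS2 m)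
  have hSe := explore_sales_le (sel := sel) h hη hW hC hε hlarge1 htT hobs H
  have hYe := explore_lagrangian_le (sel := sel) h hη hW hC hε hlarge1 htT hobs H
  have hS := hlast n ε obs sel hε hlarge₂ hobs hSe (fun m => ⟨(hlowm m).1, (hhighm m).1⟩)
    (fun m => (hprices m).1) (fun m => (hprices m).2)
  have hYl := last_lagrangian_le (sel := sel) h hC hε hn hTend hobs hlowm hhighm
  set E := quarter n ^ 2 * Real.log n ^ 2 * logPow n ε ^ 18 with hE
  have hE0 : 0 ≤ E := by positivity
  exact
  { not_zero := by
      intro h0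
      have h1 : (lastState F sel n ε obs).zu - (lastState F sel n ε obs).zl
          ≤ W * width n (numExplore n ε) := HK.z_width
      have h2 : zS ≤ (lastState F sel n ε obs).zu := HK.le_zu
      have h3 : W * width n (numExplore n ε) ≤ alpha n ε := by
        have h5 := width_numExplore_le hn hlarge.two_le_log hε
        have h6 := hlargeW.le_logPow
        calc W * width n (numExplore n ε) ≤ logPow n ε * (alpha n ε / logPow n ε) := by
              have := (width_pos hn (numExplore n ε)).le
              gcongr
          _ = alpha n ε := by field_simp
      have h4 : 2 * alpha n ε ≤ zS := by
        have h1 := (hlarge.mono (G' := 2 / zS) (by linarith)).alpha_le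
        rw [mul_div_assoc', div_le_one (by positivity)] at h1
        linarith
      linarith [h0.1]
    grid_mem := fun j hj i hi m => ((H j hj.le).gridPrice_mem h hη m hi).1
    low_mem := fun m => (hlowm m).1
    high_mem := fun m => (hhighm m).1
    sales := hS.trans (by nlinarith)
    lagrangian := by
      rw [show exploreValue F sel n ε obs (fun p => p - zS)
          + lastValue F sel n ε obs (fun p => p - zS)
          - n * (F.T * ∑ m, d m (pS m) * (pS m - zS))
        = (exploreValue F sel n ε obs (fun p => p - zS)
          - n * (∑ m, d m (pS m) * (pS m - zS)) * lastStart n ε)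
          + (lastValue F sel n ε obs (fun p => p - zS)
          - n * (∑ m, d m (pS m) * (pS m - zS)) * (F.T - lastStart n ε)) by ring]
      refine (abs_add_le _ _).trans ((add_le_add hYe hYl).trans ?_)
      nlinarith }

end PersonalizedPricing

/-! ### Price paths as step functions of time. -/

namespace PersonalizedPricing

section Step

variable {α β γ : Type*} [MeasurableSpace α]

/-- A measurable function with finitely many values. -/
def IsStep (f : α → β) : Prop := (range f).Finite ∧ ∀ y, MeasurableSet (f ⁻¹' {y})

/-- Preimages of arbitrary sets are measurable, so a step function may be composed with any
function. This is needed because nothing makes `d` measurable outside the price domain. -/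
lemma IsStep.measurableSet_preimage {f : α → β} (hf : IsStep f) (s : Set β) :
    MeasurableSet (f ⁻¹' s) := by
  have : f ⁻¹' s = ⋃ y ∈ s ∩ range f, f ⁻¹' {y} := by
    ext x
    simp
  rw [this]
  exact (hf.1.subset inter_subset_right).measurableSet_biUnion fun y _ => hf.2 y

lemma IsStep.measurable [MeasurableSpace β] {f : α → β} (hf : IsStep f) : Measurable f :=
  fun s _ => hf.measurableSet_preimage s

lemma IsStep.comp {f : α → β} (hf : IsStep f) (g : β → γ) : IsStep fun x => g (f x) :=
  ⟨(hf.1.image g).subset (by rintro _ ⟨x, rfl⟩; exact ⟨f x, ⟨x, rfl⟩, rfl⟩),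
    fun y => hf.measurableSet_preimage (g ⁻¹' {y})⟩

lemma IsStep.prodMk {f : α → β} {g : α → γ} (hf : IsStep f) (hg : IsStep g) :
    IsStep fun x => (f x, g x) := by
  refine ⟨(hf.1.prod hg.1).subset ?_, fun y => ?_⟩
  · rintro _ ⟨x, rfl⟩
    exact ⟨⟨x, rfl⟩, ⟨x, rfl⟩⟩
  · convert (hf.2 y.1).inter (hg.2 y.2) using 1
    ext x
    simp [Prod.ext_iff]

lemma IsStep.const (y : β) : IsStep fun _ : α => y :=
  ⟨(finite_singleton y).subset (by rintro _ ⟨x, rfl⟩; rfl), fun _ => MeasurableSet.const _⟩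

lemma IsStep.add {f g : α → ℝ} (hf : IsStep f) (hg : IsStep g) : IsStep fun x => f x + g x :=
  (hf.prodMk hg).comp fun p => p.1 + p.2

lemma IsStep.sum {ι : Type*} (s : Finset ι) {f : ι → α → ℝ} (hf : ∀ i, IsStep (f i)) :
    IsStep fun x => ∑ i ∈ s, f i x := by
  classical
  induction s using Finset.induction_on with
  | empty => simpa using IsStep.const (0 : ℝ)
  | insert i s hi ih => simpa [Finset.sum_insert hi] using (hf i).add ih

lemma IsStep.indicator {s : Set α} (hs : MeasurableSet s) (y : ℝ) :
    IsStep (s.indicator fun _ => y) := by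
  refine ⟨((finite_singleton y).insert 0).subset ?_, fun z => ?_⟩
  · rintro _ ⟨x, rfl⟩
    by_cases hx : x ∈ s <;> simp [hx]
  · classical
    rw [indicator_const_preimage_eq_union]
    refine MeasurableSet.union ?_ ?_ <;> split_ifs
    exacts [hs, MeasurableSet.empty, hs.compl, MeasurableSet.empty]

end Step

variable {M : ℕ} {F : FirmInfo} {d : Fin M → ℝ → ℝ} {pInf zS : ℝ} {pS : Fin M → ℝ} {a b l B : ℝ}
  {sel : Finset ℕ → ℕ} {n : ℕ} {ε : ℝ} {obs : Fin M → ℝ → ℝ → ℝ → ℝ}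

lemma isStep_lastPrice (m : Fin M) : IsStep (lastPrice F sel n ε obs m) := by
  unfold lastPrice
  split_ifs
  · exact IsStep.indicator measurableSet_Ioc _
  · exact (((IsStep.indicator measurableSet_Ioc _).add (IsStep.indicator measurableSet_Ioc _)).add
      (IsStep.indicator measurableSet_Ioc _)).add (IsStep.indicator measurableSet_Ioc _)

lemma isStep_policyPrice (m : Fin M) : IsStep (policyPrice F sel n ε obs m) := by
  unfold policyPrice
  exact (IsStep.sum _ fun _ => IsStep.sum _ fun _ =>
    IsStep.indicator measurableSet_Ioc _).add (isStep_lastPrice m)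

/-! ### Evaluation of the price path -/

lemma lastPrice_of_le (hn : 3 ≤ n) (hε : 0 < ε) (m : Fin M) {t : ℝ} (ht : t ≤ lastStart n ε) :
    lastPrice F sel n ε obs m t = 0 := by
  have hh := testLength_pos hn hε
  have hsw : lastStart n ε + 2 * testLength n ε ≤ switchTime F sel n ε obs := le_max_left _ _
  have h : ∀ {u v y : ℝ}, lastStart n ε ≤ u → (Ioc u v).indicator (fun _ => y) t = 0 :=
    fun hu => indicator_of_notMem (fun h => absurd h.1 (by linarith)) _
  simp only [lastPrice]
  rw [h le_rfl, h (by linarith), h (by linarith), h (by linarith), h (by linarith)]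
  simp

lemma slot_sum_eq (hn : 3 ≤ n) (hε : 0 < ε) {j i : ℕ} (hj : j < numExplore n ε)
    (hi : i ∈ Finset.range (gridN n ε j + 1)) {t : ℝ}
    (ht : t ∈ Ioc (slotTime n ε j i) (slotTime n ε j (i + 1))) (f : ℕ → ℕ → ℝ) :
    ∑ j ∈ Finset.range (numExplore n ε), ∑ i ∈ Finset.range (gridN n ε j + 1),
      (Ioc (slotTime n ε j i) (slotTime n ε j (i + 1))).indicator (fun _ => f j i) t = f j i := by
  have hstart : ∀ j i, phaseStart n ε j ≤ slotTime n ε j i := fun j i => by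
    rw [← slotTime_zero]
    exact slotTime_mono hn hε j (Nat.zero_le i)
  have hend : ∀ j, ∀ i ∈ Finset.range (gridN n ε j + 1),
      slotTime n ε j (i + 1) ≤ phaseStart n ε (j + 1) := fun j i hi => by
    rw [← slotTime_last]
    exact slotTime_mono hn hε j (by have := Finset.mem_range.mp hi; omega)
  rw [Finset.sum_eq_single_of_mem j (Finset.mem_range.mpr hj),
    Finset.sum_eq_single_of_mem i hi, indicator_of_mem ht]
  · intro i' hi' hne
    refine indicator_of_notMem (fun h => ?_) _
    rcases lt_or_gt_of_ne hne with hlt | hlt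
    · have := slotTime_mono hn hε j (show i' + 1 ≤ i by omega)
      linarith [h.2, ht.1]
    · have := slotTime_mono hn hε j (show i + 1 ≤ i' by omega)
      linarith [h.1, ht.2]
  · intro j' _ hne
    refine Finset.sum_eq_zero fun i' hi' => indicator_of_notMem (fun h => ?_) _
    rcases lt_or_gt_of_ne hne with hlt | hlt
    · have := phaseStart_mono hn hε (show j' + 1 ≤ j by omega)
      linarith [h.2, ht.1, hstart j i, hend j' i' hi']
    · have := phaseStart_mono hn hε (show j + 1 ≤ j' by omega)
      linarith [h.1, ht.2, hstart j' i', hend j i hi]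

lemma policyPrice_of_mem_slot (hn : 3 ≤ n) (hε : 0 < ε) (m : Fin M) {j i : ℕ}
    (hj : j < numExplore n ε) (hi : i ∈ Finset.range (gridN n ε j + 1)) {t : ℝ}
    (ht : t ∈ Ioc (slotTime n ε j i) (slotTime n ε j (i + 1))) :
    policyPrice F sel n ε obs m t = gridPrice n ε j (phaseState F sel n ε obs j) m i := by
  rw [policyPrice, slot_sum_eq hn hε hj hi ht
    (fun j i => gridPrice n ε j (phaseState F sel n ε obs j) m i),
    lastPrice_of_le hn hε m (ht.2.trans (slotTime_succ_le_lastStart hn hε hj hi)), add_zero]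

lemma policyPrice_of_lastStart_lt (hn : 3 ≤ n) (hε : 0 < ε) (m : Fin M) {t : ℝ}
    (ht : lastStart n ε < t) : policyPrice F sel n ε obs m t = lastPrice F sel n ε obs m t := by
  rw [policyPrice, Finset.sum_eq_zero, zero_add]
  intro j hj
  refine Finset.sum_eq_zero fun i hi => indicator_of_notMem (fun h => ?_) _
  linarith [h.2, slotTime_succ_le_lastStart hn hε (Finset.mem_range.mp hj) hi]

/-- The windows of the last phase and the prices charged there. -/
lemma lastPrice_eq (hn : 3 ≤ n) (hε : 0 < ε) (m : Fin M)
    (h0 : ¬ (0 : ℝ) ∈ Icc (lastState F sel n ε obs).zl (lastState F sel n ε obs).zu) (t : ℝ) :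
    (t ∈ Ioc (lastStart n ε) (lastStart n ε + testLength n ε) →
      lastPrice F sel n ε obs m t = lowPrice F sel n ε obs m) ∧
    (t ∈ Ioc (lastStart n ε + testLength n ε) (lastStart n ε + 2 * testLength n ε) →
      lastPrice F sel n ε obs m t = highPrice F sel n ε obs m) ∧
    (t ∈ Ioc (lastStart n ε + 2 * testLength n ε) (switchTime F sel n ε obs) →
      lastPrice F sel n ε obs m t = lowPrice F sel n ε obs m) ∧
    (t ∈ Ioc (switchTime F sel n ε obs) F.T →
      lastPrice F sel n ε obs m t = highPrice F sel n ε obs m) := by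
  have hh := testLength_pos hn hε
  have hsw : lastStart n ε + 2 * testLength n ε ≤ switchTime F sel n ε obs := le_max_left _ _
  have hl : ∀ {u v y : ℝ}, t ≤ u → (Ioc u v).indicator (fun _ => y) t = 0 :=
    fun hu => indicator_of_notMem (fun h => absurd h.1 (by linarith)) _
  have hr : ∀ {u v y : ℝ}, v < t → (Ioc u v).indicator (fun _ => y) t = 0 :=
    fun hu => indicator_of_notMem (fun h => absurd h.2 (by linarith)) _
  simp only [lastPrice, if_neg h0]
  refine ⟨fun ht => ?_, fun ht => ?_, fun ht => ?_, fun ht => ?_⟩ <;> have h1 := ht.1 <;>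
    have h2 := ht.2
  · rw [indicator_of_mem ht, hl (by linarith), hl (by linarith), hl (by linarith)]
    ring
  · rw [indicator_of_mem ht, hr (by linarith), hl (by linarith), hl (by linarith)]
    ring
  · rw [indicator_of_mem ht, hr (by linarith), hr (by linarith), hl (by linarith)]
    ring
  · rw [indicator_of_mem ht, hr (by linarith), hr (by linarith), hr (by linarith)]
    ring

lemma lastPrice_mem (hn : 3 ≤ n) (hε : 0 < ε) (m : Fin M) {S : Set ℝ} (h0 : 0 ∈ S)
    (hlow : lowPrice F sel n ε obs m ∈ S) (hhigh : highPrice F sel n ε obs m ∈ S) (t : ℝ) :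
    lastPrice F sel n ε obs m t ∈ S := by
  by_cases hz : (0 : ℝ) ∈ Icc (lastState F sel n ε obs).zl (lastState F sel n ε obs).zu
  · simp only [lastPrice, if_pos hz]
    by_cases ht : t ∈ Ioc (lastStart n ε) F.T
    · rwa [indicator_of_mem ht]
    · rwa [indicator_of_notMem ht]
  · obtain ⟨h1, h2, h3, h4⟩ := lastPrice_eq hn hε m hz t
    by_cases t1 : t ∈ Ioc (lastStart n ε) (lastStart n ε + testLength n ε)
    · rwa [h1 t1]
    by_cases t2 : t ∈ Ioc (lastStart n ε + testLength n ε) (lastStart n ε + 2 * testLength n ε)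
    · rwa [h2 t2]
    by_cases t3 : t ∈ Ioc (lastStart n ε + 2 * testLength n ε) (switchTime F sel n ε obs)
    · rwa [h3 t3]
    by_cases t4 : t ∈ Ioc (switchTime F sel n ε obs) F.T
    · rwa [h4 t4]
    simp only [lastPrice, if_neg hz]
    rw [indicator_of_notMem t1, indicator_of_notMem t2, indicator_of_notMem t3,
      indicator_of_notMem t4]
    simpa using h0

lemma policyPrice_mem (hn : 3 ≤ n) (hε : 0 < ε) (m : Fin M) {S : Set ℝ} (h0 : 0 ∈ S)
    (hgrid : ∀ j < numExplore n ε, ∀ i ∈ Finset.range (gridN n ε j + 1),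
      gridPrice n ε j (phaseState F sel n ε obs j) m i ∈ S)
    (hlow : lowPrice F sel n ε obs m ∈ S) (hhigh : highPrice F sel n ε obs m ∈ S) (t : ℝ) :
    policyPrice F sel n ε obs m t ∈ S := by
  by_cases ht : ∃ j < numExplore n ε, ∃ i ∈ Finset.range (gridN n ε j + 1),
      t ∈ Ioc (slotTime n ε j i) (slotTime n ε j (i + 1))
  · obtain ⟨j, hj, i, hi, hji⟩ := ht
    rw [policyPrice_of_mem_slot hn hε m hj hi hji]
    exact hgrid j hj i hi
  · rw [policyPrice, Finset.sum_eq_zero, zero_add]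
    · exact lastPrice_mem hn hε m h0 hlow hhigh t
    · exact fun j hj => Finset.sum_eq_zero fun i hi => indicator_of_notMem
        (fun h => ht ⟨j, Finset.mem_range.mp hj, i, hi, h⟩) _

/-- Whatever is observed, the interval estimators are intervals within the initial ranges. -/
lemma phaseState_bounds (hsel : ∀ s : Finset ℕ, s.Nonempty → sel s ∈ s) (hn : 3 ≤ n)
    (hp : F.pLo ≤ F.pHi) (hz : 0 ≤ F.zHi) (j : ℕ) :
    (0 ≤ (phaseState F sel n ε obs j).zl ∧
      (phaseState F sel n ε obs j).zl ≤ (phaseState F sel n ε obs j).zu ∧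
      (phaseState F sel n ε obs j).zu ≤ F.zHi) ∧
    ∀ m, F.pLo ≤ (phaseState F sel n ε obs j).pl m ∧
      (phaseState F sel n ε obs j).pl m ≤ (phaseState F sel n ε obs j).pu m ∧
      (phaseState F sel n ε obs j).pu m ≤ F.pHi := by
  induction j with
  | zero => exact ⟨⟨le_rfl, hz, le_rfl⟩, fun m => ⟨le_rfl, hp, le_rfl⟩⟩
  | succ j ih =>
    obtain ⟨⟨z1, z2, z3⟩, ihp⟩ := ih
    have hw := width_pos hn (j + 1)
    have hwz : 0 < widthZ n ε (j + 1) :=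
      mul_pos hw (Real.rpow_pos_of_pos (by linarith [one_le_log hn]) _)
    constructor
    · have h := zEst_mem (F := F) (n := n) (ε := ε) (obs := obs) (j := j) hsel z2
      refine ⟨le_max_left _ _, max_le (le_min hz ?_) (le_min ?_ ?_), min_le_left _ _⟩ <;>
        linarith [h.1, h.2]
    · intro m
      obtain ⟨p1, p2, p3⟩ := ihp m
      have h := pEst_mem (F := F) (n := n) (ε := ε) (obs := obs) (j := j) hsel p2
      refine ⟨le_max_left _ _, max_le (le_min hp ?_) (le_min ?_ ?_), min_le_left _ _⟩ <;>
        linarith [h.1, h.2]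

/-- A bound that holds for every observation, used on the bad event where the last prices may leave
the price domain by up to `α ≤ 1`. -/
lemma abs_policyPrice_le (hsel : ∀ s : Finset ℕ, s.Nonempty → sel s ∈ s) (hlarge : IsLarge n ε 1)
    (hε : 0 < ε) (hp0 : 0 ≤ F.pLo) (hp : F.pLo ≤ F.pHi) (hz : 0 ≤ F.zHi) (m : Fin M) (t : ℝ) :
    |policyPrice F sel n ε obs m t| ≤ F.pHi + 1 := by
  have hn := hlarge.three_le
  have hα := alpha_pos hn hε
  have hα1 := hlarge.alpha_le
  have hb := phaseState_bounds (F := F) (n := n) (ε := ε) (obs := obs) hsel hn hp hz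
  refine abs_le.mpr (policyPrice_mem hn hε m (S := Icc (-(F.pHi + 1)) (F.pHi + 1)) ?_ ?_ ?_ ?_ t)
  · constructor <;> linarith
  · intro j _ i hi
    obtain ⟨h1, h2, h3⟩ := (hb j).2 m
    have := grid_mem_Icc h2 hi
    simp only [gridPrice]
    constructor <;> linarith [this.1, this.2]
  · obtain ⟨h1, h2, h3⟩ := (hb (numExplore n ε)).2 m
    simp only [lowPrice, lastState]
    constructor <;> linarith
  · obtain ⟨h1, h2, h3⟩ := (hb (numExplore n ε)).2 m
    simp only [highPrice, lastState]
    constructor <;> linarith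

end PersonalizedPricing

/-! ### Sales and revenue along a price path as integrals against the point measure. -/

namespace PersonalizedPricing

variable {M : ℕ}

/-- The sales during `(s, t]` when type `m` is charged the price `q m r` at time `r`. -/
def pathSales (d : Fin M → ℝ → ℝ) (n : ℕ) (q : Fin M → ℝ → ℝ) (s t : ℝ) :
    Set (Fin M × ℝ × ℝ) :=
  {x | x.2.1 ∈ Ioc s t ∧ x.2.2 ∈ Ioc 0 (n * d x.1 (q x.1 x.2.1))}

/-- The sum of `φ(price)` over the sales during `(s, t]`. -/
noncomputable def pathValue (d : Fin M → ℝ → ℝ) (n : ℕ) (ν : Measure (Fin M × ℝ × ℝ))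
    (q : Fin M → ℝ → ℝ) (φ : ℝ → ℝ) (s t : ℝ) : ℝ :=
  ∫ x in pathSales d n q s t, φ (q x.1 x.2.1) ∂ν

variable {d : Fin M → ℝ → ℝ} {n : ℕ} {q : Fin M → ℝ → ℝ} {B T : ℝ}
  {ν : Measure (Fin M × ℝ × ℝ)} {φ : ℝ → ℝ}

lemma isStep_path (hq : ∀ m, IsStep (q m)) :
    IsStep fun x : Fin M × ℝ × ℝ => (x.1, q x.1 x.2.1) := by
  constructor
  · refine ((finite_univ (α := Fin M)).prod (finite_iUnion fun m => (hq m).1)).subset ?_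
    rintro _ ⟨x, rfl⟩
    exact ⟨mem_univ _, mem_iUnion.mpr ⟨x.1, ⟨x.2.1, rfl⟩⟩⟩
  · rintro ⟨m, y⟩
    have : (fun x : Fin M × ℝ × ℝ => (x.1, q x.1 x.2.1)) ⁻¹' {(m, y)}
        = {m} ×ˢ ((q m ⁻¹' {y}) ×ˢ univ) := by
      ext ⟨k, t, u⟩
      simp only [mem_preimage, mem_singleton_iff, Prod.mk.injEq, mem_prod, mem_univ, and_true]
      constructor <;> rintro ⟨rfl, h⟩ <;> exact ⟨rfl, h⟩
    rw [this]
    exact (measurableSet_singleton m).prod (((hq m).2 y).prod MeasurableSet.univ)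

lemma measurable_path (hq : ∀ m, IsStep (q m)) (φ : ℝ → ℝ) :
    Measurable fun x : Fin M × ℝ × ℝ => φ (q x.1 x.2.1) :=
  ((isStep_path hq).comp fun y => φ y.2).measurable

lemma measurableSet_pathSales (hq : ∀ m, IsStep (q m)) (s t : ℝ) :
    MeasurableSet (pathSales d n q s t) := by
  have h1 : Measurable fun x : Fin M × ℝ × ℝ => x.2.1 := by fun_prop
  have h2 : Measurable fun x : Fin M × ℝ × ℝ => x.2.2 := by fun_prop
  have h3 : Measurable fun x : Fin M × ℝ × ℝ => n * d x.1 (q x.1 x.2.1) :=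
    ((isStep_path hq).comp fun y => n * d y.1 y.2).measurable
  exact (h1 measurableSet_Ioc).inter
    ((measurableSet_lt measurable_const h2).inter (measurableSet_le h2 h3))

lemma pathSales_subset_slab (hB : ∀ m p, d m p ≤ B) {s t : ℝ} (hs : 0 ≤ s) (ht : t ≤ T) :
    pathSales d n q s t ⊆ slab M 0 T (n * B) := by
  rintro ⟨m, r, u⟩ ⟨h1, h2⟩
  refine ⟨mem_univ _, ⟨hs.trans_lt h1.1, h1.2.trans ht⟩, ⟨h2.1, h2.2.trans ?_⟩⟩
  exact mul_le_mul_of_nonneg_left (hB _ _) (Nat.cast_nonneg n)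

lemma pathSales_mono {s s' t t' : ℝ} (hs : s' ≤ s) (ht : t ≤ t') :
    pathSales d n q s t ⊆ pathSales d n q s' t' :=
  fun _ h => ⟨⟨hs.trans_lt h.1.1, h.1.2.trans ht⟩, h.2⟩

lemma pathSales_union {s t u : ℝ} (hst : s ≤ t) (htu : t ≤ u) :
    pathSales d n q s t ∪ pathSales d n q t u = pathSales d n q s u := by
  ext x
  simp only [pathSales, mem_union, mem_ofPred_eq, ← or_and_right, ← Ioc_union_Ioc_eq_Ioc hst htu]

lemma disjoint_pathSales {s t u : ℝ} :
    Disjoint (pathSales d n q s t) (pathSales d n q t u) :=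
  Set.disjoint_left.mpr fun _ h h' => absurd h.1.2 (not_le.mpr h'.1.1)

lemma integrableOn_path (hq : ∀ m, IsStep (q m)) (φ : ℝ → ℝ) {A : Set (Fin M × ℝ × ℝ)}
    (hA : ν A ≠ ∞) : IntegrableOn (fun x => φ (q x.1 x.2.1)) A ν := by
  have hfin := ((isStep_path hq).comp fun y => φ y.2).1
  obtain ⟨C, hC⟩ := hfin.isBounded.exists_norm_le
  exact Measure.integrableOn_of_bounded hA (measurable_path hq φ).aestronglyMeasurable
    (ae_of_all _ fun x => hC _ ⟨x, rfl⟩)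

section Window

variable (hq : ∀ m, IsStep (q m)) (hB : ∀ m p, d m p ≤ B) (hfin : ν (slab M 0 T (n * B)) ≠ ∞)
  {s t u : ℝ}
include hq hB hfin

omit hq in
lemma measure_pathSales_ne_top (hs : 0 ≤ s) (ht : t ≤ T) : ν (pathSales d n q s t) ≠ ∞ :=
  measure_ne_top_of_subset (pathSales_subset_slab hB hs ht) hfin

lemma pathValue_add (hs : 0 ≤ s) (hst : s ≤ t) (htu : t ≤ u) (hu : u ≤ T) :
    pathValue d n ν q φ s u = pathValue d n ν q φ s t + pathValue d n ν q φ t u := by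
  rw [pathValue, ← pathSales_union hst htu, setIntegral_union disjoint_pathSales
    (measurableSet_pathSales hq _ _)]
  · rfl
  · exact integrableOn_path hq φ (measure_pathSales_ne_top hB hfin hs (htu.trans hu))
  · exact integrableOn_path hq φ (measure_pathSales_ne_top hB hfin (hs.trans hst) hu)

/-- With constant prices the sale set is a disjoint union of cells, one per type, whose masses are
the observations of the algorithm. This links the system to the deterministic analysis. -/
lemma pathValue_const {p : Fin M → ℝ} (hs : 0 ≤ s) (ht : t ≤ T)
    (hp : ∀ m, ∀ r ∈ Ioc s t, q m r = p m) :
    pathValue d n ν q φ s t = ∑ m, φ (p m) * observe d n ν m s t (p m) := by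
  have hset : pathSales d n q s t = ⋃ m ∈ Finset.univ, cell m s t (n * d m (p m)) := by
    ext ⟨m, r, u⟩
    simp only [pathSales, cell, mem_ofPred_eq, Finset.mem_univ, iUnion_true, mem_iUnion, mem_prod,
      mem_singleton_iff]
    constructor
    · rintro ⟨h1, h2⟩
      rw [hp m r h1] at h2
      exact ⟨m, rfl, h1, h2⟩
    · rintro ⟨m, rfl, h1, h2⟩
      rw [← hp m r h1] at h2
      exact ⟨h1, h2⟩
  have hsub : ∀ m, cell m s t (n * d m (p m)) ⊆ pathSales d n q s t := fun m => by
    rw [hset]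
    exact subset_biUnion_of_mem (u := fun m => cell m s t (n * d m (p m))) (Finset.mem_univ m)
  have hfin' := measure_pathSales_ne_top (q := q) hB hfin hs ht
  rw [pathValue]
  conv_lhs => rw [hset]
  rw [integral_biUnion_finset]
  · refine Finset.sum_congr rfl fun m _ => ?_
    rw [setIntegral_congr_fun (g := fun _ => φ (p m)) (measurableSet_cell _ _ _ _)]
    · rw [setIntegral_const, smul_eq_mul, mul_comm]
      rfl
    · rintro ⟨k, r, u⟩ ⟨h1, h2, -⟩
      obtain rfl : k = m := h1
      simp only [hp k r h2]
  · exact fun m _ => measurableSet_cell _ _ _ _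
  · intro m _ k _ hmk
    refine Set.disjoint_left.mpr fun x hx hx' => hmk ?_
    exact (show x.1 = m from hx.1).symm.trans hx'.1
  · exact fun m _ => integrableOn_path hq φ (measure_ne_top_of_subset (hsub m) hfin')

lemma pathValue_steps {k : ℕ} {v : ℕ → ℝ} (hv : Monotone v) (h0 : 0 ≤ v 0) (hT : v k ≤ T) :
    pathValue d n ν q φ (v 0) (v k)
      = ∑ i ∈ Finset.range k, pathValue d n ν q φ (v i) (v (i + 1)) := by
  induction k with
  | zero => simp [pathValue, pathSales]
  | succ k ih =>
    rw [Finset.sum_range_succ, ← ih ((hv k.le_succ).trans hT)]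
    exact pathValue_add hq hB hfin h0 (hv (Nat.zero_le k)) (hv k.le_succ) hT

end Window

variable {F : FirmInfo} {sel : Finset ℕ → ℕ} {ε : ℝ}

lemma isStep_pricePath (m : Fin M) : IsStep (pricePath F d sel n ε ν m) := isStep_policyPrice m

/-- The season is the disjoint union of the exploration slots and the four windows of the last
phase, on each of which prices are constant. One identity for all `φ` serves both sales and
Lagrangian revenue. -/
theorem pathValue_pricePath (hn : 3 ≤ n) (hε : 0 < ε) (hB : ∀ m p, d m p ≤ B)
    (hfin : ν (slab M 0 F.T (n * B)) ≠ ∞) (hT : lastStart n ε + 2 * testLength n ε ≤ F.T)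
    (h0 : ¬ (0 : ℝ) ∈ Icc (lastState F sel n ε (observe d n ν)).zl
      (lastState F sel n ε (observe d n ν)).zu) (φ : ℝ → ℝ) :
    pathValue d n ν (pricePath F d sel n ε ν) φ 0 F.T
      = exploreValue F sel n ε (observe d n ν) φ + lastValue F sel n ε (observe d n ν) φ := by
  have hq : ∀ m, IsStep (pricePath F d sel n ε ν m) := fun m => isStep_pricePath m
  have hh := testLength_pos hn hε
  have htK := lastStart_nonneg hn hε
  have hsw := switchTime_mem (sel := sel) (obs := observe d n ν) hT
  have hadd := fun s t u => pathValue_add (φ := φ) (s := s) (t := t) (u := u) hq hB hfin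
  rw [hadd 0 (lastStart n ε) F.T le_rfl htK (by linarith) le_rfl,
    hadd (lastStart n ε) (lastStart n ε + testLength n ε) F.T htK (by linarith) (by linarith) le_rfl,
    hadd (lastStart n ε + testLength n ε) (lastStart n ε + 2 * testLength n ε) F.T (by linarith)
      (by linarith) (by linarith) le_rfl,
    hadd (lastStart n ε + 2 * testLength n ε) (switchTime F sel n ε (observe d n ν)) F.T
      (by linarith) hsw.1 hsw.2 le_rfl]
  have hlast : ∀ m r, lastStart n ε < r → pricePath F d sel n ε ν m r
      = lastPrice F sel n ε (observe d n ν) m r :=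
    fun m r hr => policyPrice_of_lastStart_lt hn hε m hr
  have e1 := pathValue_const (φ := φ) (s := lastStart n ε) (t := lastStart n ε + testLength n ε)
    (p := lowPrice F sel n ε (observe d n ν)) hq hB hfin htK (by linarith) fun m r hr => by
      rw [hlast m r hr.1]
      exact (lastPrice_eq hn hε m h0 r).1 hr
  have e2 := pathValue_const (φ := φ) (s := lastStart n ε + testLength n ε)
    (t := lastStart n ε + 2 * testLength n ε)
    (p := highPrice F sel n ε (observe d n ν)) hq hB hfin (by linarith) (by linarith)
    fun m r hr => by
      rw [hlast m r (by linarith [hr.1])]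
      exact (lastPrice_eq hn hε m h0 r).2.1 hr
  have e3 := pathValue_const (φ := φ) (s := lastStart n ε + 2 * testLength n ε)
    (t := switchTime F sel n ε (observe d n ν))
    (p := lowPrice F sel n ε (observe d n ν)) hq hB hfin (by linarith) hsw.2 fun m r hr => by
      rw [hlast m r (by linarith [hr.1])]
      exact (lastPrice_eq hn hε m h0 r).2.2.1 hr
  have e4 := pathValue_const (φ := φ) (s := switchTime F sel n ε (observe d n ν)) (t := F.T)
    (p := highPrice F sel n ε (observe d n ν)) hq hB hfin (by linarith [hsw.1]) le_rfl
    fun m r hr => by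
      rw [hlast m r (by linarith [hr.1, hsw.1])]
      exact (lastPrice_eq hn hε m h0 r).2.2.2 hr
  rw [e1, e2, e3, e4, lastValue]
  have hexp : pathValue d n ν (pricePath F d sel n ε ν) φ 0 (lastStart n ε)
      = exploreValue F sel n ε (observe d n ν) φ := by
    have h1 := pathValue_steps (φ := φ) (k := numExplore n ε) hq hB hfin (phaseStart_mono hn hε)
      (phaseStart_nonneg hn hε 0) (show lastStart n ε ≤ F.T by linarith)
    rw [show phaseStart n ε 0 = 0 by simp [phaseStart]] at h1
    rw [lastStart, h1, exploreValue]
    refine Finset.sum_congr rfl fun j hj => ?_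
    have hj' := Finset.mem_range.mp hj
    have hend : slotTime n ε j (gridN n ε j + 1) ≤ F.T := by
      have := slotTime_succ_le_lastStart hn hε hj' (Finset.self_mem_range_succ (gridN n ε j))
      linarith
    have h2 := pathValue_steps (φ := φ) (k := gridN n ε j + 1) hq hB hfin (slotTime_mono hn hε j)
      (slotTime_nonneg hn hε j 0) hend
    rw [slotTime_zero, slotTime_last] at h2
    rw [h2]
    refine Finset.sum_congr rfl fun i hi => ?_
    have := slotTime_succ_le_lastStart hn hε hj' hi
    exact pathValue_const (p := fun m => gridPrice n ε j
        (phaseState F sel n ε (observe d n ν) j) m i) hq hB hfin (slotTime_nonneg hn hε j i)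
      (by linarith) fun m r hr => policyPrice_of_mem_slot hn hε m hj' hi hr
  rw [hexp]
  ring

lemma saleSet_eq (t : ℝ) :
    saleSet F d sel n ε ν t = pathSales d n (pricePath F d sel n ε ν) 0 t := rfl

lemma grossRevenue_eq :
    grossRevenue F d sel n ε ν = pathValue d n ν (pricePath F d sel n ε ν) (fun p => p) 0 F.T := rfl

lemma cumSales_eq (t : ℝ) :
    cumSales F d sel n ε ν t = pathValue d n ν (pricePath F d sel n ε ν) (fun _ => 1) 0 t := by
  rw [cumSales, saleSet_eq, pathValue, setIntegral_const, smul_eq_mul, mul_one]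
  rfl

end PersonalizedPricing

/-! ### From the good event to revenues, with and without the inventory constraint. -/

namespace PersonalizedPricing

variable {M : ℕ} {F : FirmInfo} {d : Fin M → ℝ → ℝ} {pInf zS : ℝ} {pS : Fin M → ℝ} {a b l B : ℝ}
  {sel : Finset ℕ → ℕ} {n : ℕ} {ε E C : ℝ} {ν : Measure (Fin M × ℝ × ℝ)}

section General

variable {q : Fin M → ℝ → ℝ} (hq : ∀ m, IsStep (q m)) (hB : ∀ m p, d m p ≤ B)
  (hfin : ν (slab M 0 F.T (n * B)) ≠ ∞)

lemma pathValue_one (s t : ℝ) : pathValue d n ν q (fun _ => 1) s t = ν.real (pathSales d n q s t) := by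
  rw [pathValue, setIntegral_const, smul_eq_mul, mul_one]

include hB hfin

lemma pathValue_one_le {s t : ℝ} (hs : 0 ≤ s) (ht : t ≤ F.T) :
    pathValue d n ν q (fun _ => 1) s t ≤ ν.real (slab M 0 F.T (n * B)) := by
  rw [pathValue_one]
  exact measureReal_mono (pathSales_subset_slab hB hs ht) hfin

lemma monotone_pathValue_one :
    Monotone fun t => pathValue d n ν q (fun _ => 1) 0 (min t F.T) := by
  intro s t hst
  simp only [pathValue_one]
  exact measureReal_mono (pathSales_mono le_rfl (min_le_min_right _ hst))
    (measure_pathSales_ne_top hB hfin le_rfl (min_le_right _ _))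

/-- Cumulative sales are monotone in time and hence measurable. Capping time at `T` keeps all sets
inside the slab of finite mass without changing anything on the sale set. -/
lemma measurableSet_covered (hq : ∀ m, IsStep (q m)) (x₀ : ℝ) :
    MeasurableSet (pathSales d n q 0 F.T ∩
      {x | pathValue d n ν q (fun _ => 1) 0 x.2.1 ≤ x₀}) := by
  have : pathSales d n q 0 F.T ∩ {x | pathValue d n ν q (fun _ => 1) 0 x.2.1 ≤ x₀}
      = pathSales d n q 0 F.T ∩
        {x | pathValue d n ν q (fun _ => 1) 0 (min x.2.1 F.T) ≤ x₀} := by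
    ext x
    refine and_congr_right fun hx => ?_
    simp only [mem_ofPred_eq, min_eq_left hx.1.2]
  rw [this]
  refine (measurableSet_pathSales hq _ _).inter (measurableSet_le ?_ measurable_const)
  have h2 : Measurable fun x : Fin M × ℝ × ℝ => x.2.1 := by fun_prop
  exact (monotone_pathValue_one hB hfin).measurable.comp h2

include hq

lemma pathValue_sub {s t z : ℝ} (hs : 0 ≤ s) (ht : t ≤ F.T) :
    pathValue d n ν q (fun p => p - z) s t
      = pathValue d n ν q (fun p => p) s t - z * pathValue d n ν q (fun _ => 1) s t := by
  have hf := measure_pathSales_ne_top (q := q) hB hfin hs ht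
  simp only [pathValue]
  rw [← integral_const_mul, ← integral_sub (integrableOn_path hq (fun p => p) hf)
    (integrableOn_path hq (fun _ => z * 1) hf)]
  simp

/-- The sales that the inventory does not cover. -/
lemma measureReal_uncovered_le {x₀ D : ℝ} (hx : 0 ≤ x₀) (hn : 0 < n) (hT : 0 ≤ F.T)
    (hD : ∀ i < n, pathValue d n ν q (fun _ => 1) (i * (F.T / n)) ((i + 1 : ℕ) * (F.T / n)) ≤ D) :
    ν.real (pathSales d n q 0 F.T \
        (pathSales d n q 0 F.T ∩ {x | pathValue d n ν q (fun _ => 1) 0 x.2.1 ≤ x₀}))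
      ≤ max (pathValue d n ν q (fun _ => 1) 0 F.T - x₀) 0 + max D 0 := by
  set S := fun t => pathValue d n ν q (fun _ => 1) 0 t with hS
  have hmono : ∀ {s t}, s ≤ t → t ≤ F.T → S s ≤ S t := fun {s t} hst ht => by
    have := monotone_pathValue_one (q := q) hB hfin hst
    simpa only [min_eq_left ht, min_eq_left (hst.trans ht)] using this
  have hn0 : (0 : ℝ) < n := by exact_mod_cast hn
  by_cases hST : S F.T ≤ x₀
  · have : pathSales d n q 0 F.T \ (pathSales d n q 0 F.T ∩ {x | S x.2.1 ≤ x₀}) = ∅ := by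
      rw [sdiff_eq_empty]
      exact fun x hx' => ⟨hx', (hmono hx'.1.2 le_rfl).trans hST⟩
    rw [this, measureReal_empty]
    positivity
  -- At the first point of the mesh `T / n` where sales exceed `x₀`, all uncovered sales lie after
  -- the preceding mesh point. They number at most the final excess plus the sales `D` of one mesh
  -- window; no simplicity of the point process is needed.
  · have hex : ∃ k : ℕ, x₀ < S (k * (F.T / n)) :=
      ⟨n, by rw [mul_div_cancel₀ _ hn0.ne']; exact not_le.mp hST⟩
    classical
    have hk := Nat.find_spec hex
    have hkn : Nat.find hex ≤ n := Nat.find_min' hex (by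
      rw [mul_div_cancel₀ _ hn0.ne']; exact not_le.mp hST)
    have hk0 : Nat.find hex ≠ 0 := by
      intro h0
      rw [h0] at hk
      have : S ((0 : ℕ) * (F.T / n)) = 0 := by
        rw [Nat.cast_zero, zero_mul, hS]
        simp only [pathValue, pathSales, Ioc_self, mem_empty_iff_false, false_and]
        exact setIntegral_empty
      linarith
    obtain ⟨i, hi⟩ := Nat.exists_eq_succ_of_ne_zero hk0
    have hpred : S (i * (F.T / n)) ≤ x₀ := not_lt.mp (Nat.find_min hex (by omega))
    rw [hi, Nat.succ_eq_add_one] at hk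
    have hin : i < n := by omega
    have h1 : (0 : ℝ) ≤ i * (F.T / n) := by positivity
    have h2 : (i : ℝ) * (F.T / n) ≤ (i + 1 : ℕ) * (F.T / n) := by
      gcongr
      simp
    have h3 : ((i + 1 : ℕ) : ℝ) * (F.T / n) ≤ F.T := by
      have : ((i + 1 : ℕ) : ℝ) ≤ n := by exact_mod_cast hin
      calc ((i + 1 : ℕ) : ℝ) * (F.T / n) ≤ n * (F.T / n) := by gcongr
        _ = F.T := mul_div_cancel₀ _ hn0.ne'
    have hsub : pathSales d n q 0 F.T \ (pathSales d n q 0 F.T ∩ {x | S x.2.1 ≤ x₀})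
        ⊆ pathSales d n q (i * (F.T / n)) F.T := by
      rintro x ⟨hx1, hx2⟩
      refine ⟨⟨lt_of_not_ge fun hle => hx2 ⟨hx1, ?_⟩, hx1.1.2⟩, hx1.2⟩
      exact (hmono hle (h2.trans h3)).trans hpred
    refine (measureReal_mono hsub (measure_pathSales_ne_top hB hfin h1 le_rfl)).trans ?_
    rw [← pathValue_one, pathValue_add hq hB hfin h1 h2 h3 le_rfl]
    have h4 := pathValue_add (φ := fun _ => 1) hq hB hfin le_rfl (h1.trans h2) h3 le_rfl
    have h5 := hD i hin
    have h6 : x₀ < pathValue d n ν q (fun _ => 1) 0 ((i + 1 : ℕ) * (F.T / n)) := hk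
    linarith [le_max_left (pathValue d n ν q (fun _ => 1) 0 F.T - x₀) 0, le_max_left D 0]

end General

lemma constrainedRevenue_eq :
    constrainedRevenue F d sel n ε ν = ∫ x in pathSales d n (pricePath F d sel n ε ν) 0 F.T ∩
      {x | pathValue d n ν (pricePath F d sel n ε ν) (fun _ => 1) 0 x.2.1 ≤ n * F.c},
      pricePath F d sel n ε ν x.1 x.2.1 ∂ν := by
  simp only [constrainedRevenue, cumSales_eq, saleSet_eq]

lemma abs_grossRevenue_le (hB : ∀ m p, d m p ≤ B) (hfin : ν (slab M 0 F.T (n * B)) ≠ ∞) {c : ℝ}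
    (hc : 0 ≤ c) (h : ∀ m t, |pricePath F d sel n ε ν m t| ≤ c) :
    |grossRevenue F d sel n ε ν| ≤ c * ν.real (slab M 0 F.T (n * B)) := by
  have hsub := pathSales_subset_slab (d := d) (n := n) (q := pricePath F d sel n ε ν) hB le_rfl
    (le_refl F.T)
  rw [grossRevenue_eq, pathValue]
  refine (norm_setIntegral_le_of_norm_le_const (C := c)
    (f := fun x : Fin M × ℝ × ℝ => pricePath F d sel n ε ν x.1 x.2.1) (measure_ne_top_of_subset hsub hfin).lt_top
    fun x _ => h x.1 x.2.1).trans ?_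
  exact mul_le_mul_of_nonneg_left (measureReal_mono hsub hfin) hc

lemma abs_constrainedRevenue_le (hB : ∀ m p, d m p ≤ B) (hfin : ν (slab M 0 F.T (n * B)) ≠ ∞)
    {c : ℝ} (hc : 0 ≤ c) (h : ∀ m t, |pricePath F d sel n ε ν m t| ≤ c) :
    |constrainedRevenue F d sel n ε ν| ≤ c * ν.real (slab M 0 F.T (n * B)) := by
  have hsub := pathSales_subset_slab (d := d) (n := n) (q := pricePath F d sel n ε ν) hB le_rfl
    (le_refl F.T)
  rw [constrainedRevenue_eq]
  refine (norm_setIntegral_le_of_norm_le_const (C := c)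
    (f := fun x : Fin M × ℝ × ℝ => pricePath F d sel n ε ν x.1 x.2.1) (measure_ne_top_of_subset
    (inter_subset_left.trans hsub) hfin).lt_top fun x _ => h x.1 x.2.1).trans ?_
  exact mul_le_mul_of_nonneg_left (measureReal_mono (inter_subset_left.trans hsub) hfin) hc

/-- On the good event both the sales and the revenues are close to those of the fluid problem. -/
theorem GoodPath.values (h : MarketBounds F d pInf zS pS a b l B) (hC : 0 < C) (hn : 3 ≤ n)
    (hε : 0 < ε) (hT : lastStart n ε + 2 * testLength n ε ≤ F.T) (hν : IsGood F.T B C n ν)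
    (hg : GoodPath F d pInf zS pS sel n ε E (observe d n ν)) :
    |cumSales F d sel n ε ν F.T - n * F.c| ≤ E ∧
    |grossRevenue F d sel n ε ν - n * fluidRevenue F d pS| ≤ (1 + zS) * E ∧
    |constrainedRevenue F d sel n ε ν - n * fluidRevenue F d pS| ≤ (1 + zS) * E
      + pInf * (E + M * (F.T * B + C * (F.T + 2)) * (quarter n ^ 2 * Real.log n)) := by
  set q := pricePath F d sel n ε ν with hqdef
  have hq : ∀ m, IsStep (q m) := fun m => isStep_pricePath m
  have hfin := hν.finite
  have hz := h.z_pos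
  have hTpos := h.T_pos
  have hval := pathValue_pricePath (sel := sel) hn hε h.le_B hfin hT hg.not_zero
  have hn0 : (0 : ℝ) < n := by positivity
  have hpInf : 0 ≤ pInf := by
    have := h.pS_mem_Icc ⟨0, h.M_pos⟩
    linarith [this.1, this.2]
  have hS : |pathValue d n ν q (fun _ => 1) 0 F.T - n * F.c| ≤ E := by
    rw [hval]; exact hg.sales
  have hY : |pathValue d n ν q (fun p => p - zS) 0 F.T
      - n * (F.T * ∑ m, d m (pS m) * (pS m - zS))| ≤ E := by
    rw [hval]; exact hg.lagrangian
  have hE : 0 ≤ E := (abs_nonneg _).trans hS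
  -- The decomposition of revenue into Lagrangian part and `zS` times sales, compared with the same
  -- decomposition of the fluid revenue.
  have hgross : |grossRevenue F d sel n ε ν - n * fluidRevenue F d pS| ≤ (1 + zS) * E := by
    rw [pathValue_sub hq h.le_B hfin le_rfl le_rfl] at hY
    rw [grossRevenue_eq, h.fluidRevenue_eq]
    have h1 := abs_le.mp hS
    have h2 := abs_le.mp hY
    rw [abs_le]
    constructor <;> nlinarith [mul_le_mul_of_nonneg_left h1.1 hz.le,
      mul_le_mul_of_nonneg_left h1.2 hz.le]
  refine ⟨by rw [cumSales_eq]; exact hS, hgross, ?_⟩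
  -- The lost revenue comes from uncovered sales, each at a price in `[0, pInf]`. In a window of
  -- length `T / n` even the largest marks produce a bounded mean number of sales, so the mesh term
  -- is just a deviation bound.
  have hdiff : |grossRevenue F d sel n ε ν - constrainedRevenue F d sel n ε ν|
      ≤ pInf * (E + M * (F.T * B + C * (F.T + 2)) * (quarter n ^ 2 * Real.log n)) := by
    have hAfin := measure_pathSales_ne_top (q := q) h.le_B hfin le_rfl le_rfl
    rw [grossRevenue_eq, constrainedRevenue_eq, pathValue, ← setIntegral_sdiff
      (measurableSet_covered h.le_B hfin hq _) (integrableOn_path hq (fun p => p) hAfin)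
      inter_subset_left]
    refine (norm_setIntegral_le_of_norm_le_const (C := pInf)
      (f := fun x : Fin M × ℝ × ℝ => q x.1 x.2.1)
      (measure_ne_top_of_subset sdiff_subset hAfin).lt_top fun x _ => ?_).trans ?_
    · have : q x.1 x.2.1 ∈ Icc 0 pInf :=
        policyPrice_mem hn hε x.1 (S := Icc 0 pInf) ⟨le_rfl, hpInf⟩ (fun j hj i hi => hg.grid_mem j hj i hi x.1)
          (hg.low_mem x.1) (hg.high_mem x.1) x.2.1
      rw [Real.norm_eq_abs, abs_of_nonneg this.1]
      exact this.2
    · refine mul_le_mul_of_nonneg_left ?_ hpInf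
      have hv := one_le_quarter hn
      have hL := one_le_log hn
      have hBpos := h.B_pos
      refine (measureReal_uncovered_le hq h.le_B hfin (x₀ := n * F.c)
        (D := M * (F.T * B + C * (F.T + 2)) * (quarter n ^ 2 * Real.log n)) ?_ (by omega) hTpos.le
        ?_).trans ?_
      · rw [h.slack]
        exact mul_nonneg hn0.le (mul_nonneg hTpos.le (Finset.sum_nonneg fun m _ => h.nonneg m _))
      · intro i hi
        have h1 : (0 : ℝ) ≤ i * (F.T / n) := by positivity
        have h2 : ((i + 1 : ℕ) : ℝ) * (F.T / n) ≤ F.T := by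
          have : ((i + 1 : ℕ) : ℝ) ≤ n := by exact_mod_cast hi
          calc ((i + 1 : ℕ) : ℝ) * (F.T / n) ≤ n * (F.T / n) := by gcongr
            _ = F.T := mul_div_cancel₀ _ hn0.ne'
        have h3 : ((i + 1 : ℕ) : ℝ) * (F.T / n) - i * (F.T / n) = F.T / n := by
          push_cast; ring
        have hcell : ∀ m, cell m (i * (F.T / n)) ((i + 1 : ℕ) * (F.T / n)) (n * B)
            ⊆ slab M 0 F.T (n * B) := fun m =>
          (cell_subset_slab _ _ _ _).trans (slab_mono h1 h2 le_rfl)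
        have hsub : pathSales d n q (i * (F.T / n)) ((i + 1 : ℕ) * (F.T / n))
            ⊆ ⋃ m ∈ (Finset.univ : Finset (Fin M)),
              cell m (i * (F.T / n)) ((i + 1 : ℕ) * (F.T / n)) (n * B) := by
          rintro x ⟨hx1, hx2⟩
          simp only [Finset.mem_univ, iUnion_true, mem_iUnion]
          exact ⟨x.1, rfl, hx1, hx2.1, hx2.2.trans
            (mul_le_mul_of_nonneg_left (h.le_B _ _) hn0.le)⟩
        rw [pathValue_one]
        have hUfin : ν (⋃ m ∈ (Finset.univ : Finset (Fin M)),
              cell m (i * (F.T / n)) ((i + 1 : ℕ) * (F.T / n)) (n * B)) ≠ ∞ :=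
          measure_ne_top_of_subset (iUnion₂_subset fun m _ => hcell m) hfin
        refine (measureReal_mono hsub hUfin).trans
          ((measureReal_biUnion_finset_le _ _).trans ?_)
        calc _ ≤ ∑ _m : Fin M, (F.T * B + C * (F.T + 2)) * (quarter n ^ 2 * Real.log n) := by
              refine Finset.sum_le_sum fun m _ => ?_
              have hdev := hν.dev m (i * (F.T / n)) ((i + 1 : ℕ) * (F.T / n)) (n * B) h1
                (by linarith [div_nonneg hTpos.le hn0.le]) h2 (by positivity) le_rfl
              rw [h3] at hdev
              have h4 : C * (√(n * (F.T / n) * Real.log n) + Real.log n)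
                  ≤ C * (F.T + 2) * (quarter n ^ 2 * Real.log n) :=
                devBound_le hC.le hn (div_le_self hTpos.le
                  (by exact_mod_cast (by omega : 1 ≤ n))) hTpos.le
              have h5 : F.T / n * (n * B) = F.T * B := by field_simp
              have h6 : 1 ≤ quarter n ^ 2 * Real.log n := one_le_mul_of_one_le_of_one_le
                (one_le_pow₀ hv) hL
              have h7 : F.T * B ≤ F.T * B * (quarter n ^ 2 * Real.log n) :=
                le_mul_of_one_le_right (by positivity) h6
              have h8 := (abs_le.mp hdev).2
              rw [h5] at h8
              change (ν _).toReal ≤ _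
              rw [add_mul]
              linarith
          _ = _ := by
            rw [Finset.sum_const, Finset.card_univ, Fintype.card_fin, nsmul_eq_mul, mul_assoc]
      · gcongr
        · exact max_le ((le_abs_self _).trans hS) hE
        · exact max_le le_rfl (by positivity)
  rw [abs_sub_comm] at hdiff
  calc _ ≤ |constrainedRevenue F d sel n ε ν - grossRevenue F d sel n ε ν|
        + |grossRevenue F d sel n ε ν - n * fluidRevenue F d pS| := abs_sub_le _ _ _
    _ ≤ _ := by rw [add_comm]; exact add_le_add hgross hdiff

end PersonalizedPricing

/-! ### Countably valued random elements and adaptive choice. -/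

namespace PersonalizedPricing

section Discrete

variable {Ω : Type*} [MeasurableSpace Ω] {P : Measure Ω} {α β γ : Type*}

/-- A random element with countably many values almost surely, and measurable fibres up to null
sets. -/
structure IsDiscrete (P : Measure Ω) (f : Ω → α) : Prop where
  countable : ∃ S : Set α, S.Countable ∧ ∀ᵐ ω ∂P, f ω ∈ S
  fibre : ∀ y, NullMeasurableSet (f ⁻¹' {y}) P

lemma IsDiscrete.const (y : α) : IsDiscrete P fun _ => y :=
  ⟨⟨{y}, countable_singleton y, ae_of_all _ fun _ => rfl⟩,
    fun _ => (MeasurableSet.const _).nullMeasurableSet⟩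

/-- A discrete random element may be chosen adaptively, depending on another one. -/
lemma IsDiscrete.bind {f : Ω → α} {X : α → Ω → β} (hf : IsDiscrete P f)
    (hX : ∀ a, IsDiscrete P (X a)) : IsDiscrete P fun ω => X (f ω) ω := by
  obtain ⟨S, hS, hfS⟩ := hf.countable
  choose R hR hXR using fun a => (hX a).countable
  refine ⟨⟨⋃ a ∈ S, R a, hS.biUnion fun a _ => hR a, ?_⟩, fun y => ?_⟩
  · filter_upwards [hfS, (ae_ball_iff hS).mpr fun a _ => hXR a] with ω h1 h2
    exact mem_biUnion h1 (h2 _ h1)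
  · have hnull : NullMeasurableSet (⋃ a ∈ S, f ⁻¹' {a} ∩ X a ⁻¹' {y}) P :=
      NullMeasurableSet.biUnion hS fun a _ => (hf.fibre a).inter ((hX a).fibre y)
    refine hnull.congr ?_
    filter_upwards [hfS] with ω hω
    refine propext ⟨fun h => ?_, fun h => ?_⟩
    · obtain ⟨a, -, h1, h2⟩ := mem_iUnion₂.mp h
      obtain rfl : f ω = a := h1
      exact h2
    · exact mem_iUnion₂.mpr ⟨f ω, hω, rfl, h⟩

lemma IsDiscrete.comp {f : Ω → α} (hf : IsDiscrete P f) (g : α → β) :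
    IsDiscrete P fun ω => g (f ω) :=
  hf.bind fun a => IsDiscrete.const (g a)

lemma IsDiscrete.prodMk {f : Ω → α} {g : Ω → β} (hf : IsDiscrete P f) (hg : IsDiscrete P g) :
    IsDiscrete P fun ω => (f ω, g ω) :=
  hf.bind (X := fun a ω => (a, g ω)) fun a => hg.comp fun b => (a, b)

lemma IsDiscrete.pi {ι : Type*} [Finite ι] {f : Ω → ι → α}
    (hf : ∀ i, IsDiscrete P fun ω => f ω i) : IsDiscrete P f := by
  choose S hS hfS using fun i => (hf i).countable
  refine ⟨⟨{g | ∀ i, g i ∈ S i}, countable_pi hS, ae_all_iff.mpr hfS⟩, fun y => ?_⟩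
  have : f ⁻¹' {y} = ⋂ i, (fun ω => f ω i) ⁻¹' {y i} := by
    ext ω
    simp [funext_iff]
  rw [this]
  exact NullMeasurableSet.iInter fun i => (hf i).fibre (y i)

lemma IsDiscrete.sum {ι : Type*} (s : Finset ι) {f : ι → Ω → ℝ} (hf : ∀ i, IsDiscrete P (f i)) :
    IsDiscrete P fun ω => ∑ i ∈ s, f i ω := by
  classical
  induction s using Finset.induction_on with
  | empty => simpa using IsDiscrete.const (0 : ℝ)
  | insert i s hi ih =>
    simpa [Finset.sum_insert hi] using ((hf i).prodMk ih).comp fun p => p.1 + p.2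

/-- A function of an observation that depends only on a discrete part of it is discrete. -/
lemma IsDiscrete.of_factors {f : Ω → α} {V : α → β} {G : α → γ}
    (hV : IsDiscrete P fun ω => V (f ω)) (h : ∀ x y, V x = V y → G x = G y) :
    IsDiscrete P fun ω => G (f ω) := by
  rcases isEmpty_or_nonempty Ω with hΩ | ⟨⟨ω₀⟩⟩
  · exact ⟨⟨∅, countable_empty, ae_of_all _ fun ω => hΩ.elim ω⟩, fun y => by
      rw [Set.eq_empty_of_isEmpty ((fun ω => G (f ω)) ⁻¹' {y})]
      exact nullMeasurableSet_empty⟩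
  · have hfac : Function.FactorsThrough G V := fun x y hxy => h x y hxy
    have := hV.comp (Function.extend V G fun _ => G (f ω₀))
    simpa only [hfac.extend_apply] using this

/-- On each of countably many fibres of `f` the composite is a fixed measurable function. No
structure on `α` is required, and only attained values matter; for price paths only these are known
to be step functions. -/
lemma IsDiscrete.aemeasurable {f : Ω → α} {X : α → Ω → ℝ} (hf : IsDiscrete P f)
    (hX : ∀ ω, AEMeasurable (X (f ω)) P) : AEMeasurable (fun ω => X (f ω) ω) P := by
  obtain ⟨S, hS, hfS⟩ := hf.countable
  have := hS.to_subtype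
  have hcover : P.restrict (⋃ a : S, f ⁻¹' {(a : α)}) = P := by
    rw [Measure.restrict_eq_self_of_ae_mem]
    filter_upwards [hfS] with ω hω
    exact mem_iUnion.mpr ⟨⟨f ω, hω⟩, rfl⟩
  rw [← hcover, aemeasurable_iUnion_iff]
  rintro ⟨a, ha⟩
  by_cases hne : ∃ ω, f ω = a
  · obtain ⟨ω₀, rfl⟩ := hne
    refine ((hX ω₀).restrict).congr ?_
    filter_upwards [ae_restrict_mem₀ (hf.fibre (f ω₀))] with ω hω
    have : f ω = f ω₀ := hω
    rw [this]
  · have : f ⁻¹' {a} = ∅ := by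
      ext ω
      simpa using fun h => hne ⟨ω, h⟩
    simp [this]

end Discrete

variable {M : ℕ} {F : FirmInfo} {sel : Finset ℕ → ℕ} {n : ℕ} {ε : ℝ}

lemma minIdx_congr {k : ℕ} {f g : ℕ → ℝ} (h : ∀ i ∈ Finset.range (k + 1), f i = g i) :
    minIdx sel k f = minIdx sel k g := by
  rw [minIdx, minIdx]
  congr 1
  ext i
  simp only [Finset.mem_filter]
  refine and_congr_right fun hi => ?_
  exact forall₂_congr fun j hj => by rw [h i hi, h j hj]

/-- Given the state, the estimators depend on finitely many counts only. This makes the next state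
discrete although the observation, as a function of all windows and prices, is not. -/
lemma estimators_congr {o o' : Fin M → ℝ → ℝ → ℝ → ℝ} {j : ℕ} {s : PhaseState M}
    (h : ∀ m, ∀ i ∈ Finset.range (gridN n ε j + 1),
      slotSales n ε o j s m i = slotSales n ε o' j s m i) :
    zEst F sel n ε o j s = zEst F sel n ε o' j s ∧
      ∀ m, pEst F sel n ε o j s m = pEst F sel n ε o' j s m := by
  have hp : ∀ m z, ∀ i ∈ Finset.range (gridN n ε j + 1),
      profitEst n ε o j s m z i = profitEst n ε o' j s m z i := fun m z i hi => by
    rw [profitEst, profitEst, demandEst, demandEst, h m i hi]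
  have hd : dualEst F n ε o j s = dualEst F n ε o' j s := by
    funext z
    rw [dualEst, dualEst]
    congr 2
    exact Finset.sum_congr rfl fun m _ => Finset.sup'_congr _ rfl (hp m z)
  have hz : zEst F sel n ε o j s = zEst F sel n ε o' j s := by rw [zEst, zEst, hd]
  refine ⟨hz, fun m => ?_⟩
  rw [pEst, pEst, hz, maxIdx, maxIdx]
  congr 1
  exact minIdx_congr fun i hi => by rw [hp m _ i hi]

/-- The interval estimators of the phase that follows phase `j`. -/
noncomputable def nextState (F : FirmInfo) (sel : Finset ℕ → ℕ) (n : ℕ) (ε : ℝ) (j : ℕ)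
    (s : PhaseState M) (o : Fin M → ℝ → ℝ → ℝ → ℝ) : PhaseState M where
  pl m := max F.pLo (pEst F sel n ε o j s m - width n (j + 1) / 2)
  pu m := min F.pHi (pEst F sel n ε o j s m + width n (j + 1) / 2)
  zl := max 0 (zEst F sel n ε o j s - widthZ n ε (j + 1) / 2)
  zu := min F.zHi (zEst F sel n ε o j s + widthZ n ε (j + 1) / 2)

variable {Ω : Type*} [MeasurableSpace Ω] {P : Measure Ω} {obs : Ω → Fin M → ℝ → ℝ → ℝ → ℝ}
  (hobs : ∀ m s t p, IsDiscrete P fun ω => obs ω m s t p)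
include hobs

lemma isDiscrete_phaseState (j : ℕ) :
    IsDiscrete P fun ω => phaseState F sel n ε (obs ω) j := by
  induction j with
  | zero => exact IsDiscrete.const _
  | succ j ih =>
    refine ih.bind (X := fun s ω => nextState F sel n ε j s (obs ω)) fun s => ?_
    have hV : IsDiscrete P fun ω => fun x : Fin M × Fin (gridN n ε j + 1) =>
        slotSales n ε (obs ω) j s x.1 x.2 := IsDiscrete.pi fun x => hobs _ _ _ _
    refine hV.of_factors (V := fun o => fun x : Fin M × Fin (gridN n ε j + 1) =>
      slotSales n ε o j s x.1 x.2) (G := nextState F sel n ε j s) fun o o' h => ?_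
    obtain ⟨h1, h2⟩ := estimators_congr (F := F) (sel := sel) (n := n) (ε := ε) (j := j) (s := s)
      (o := o) (o' := o') fun m i hi => congrFun h (m, ⟨i, Finset.mem_range.mp hi⟩)
    simp only [nextState, h1, h2]

lemma isDiscrete_switchTime : IsDiscrete P fun ω => switchTime F sel n ε (obs ω) := by
  have hS : IsDiscrete P fun ω => exploreSales F sel n ε (obs ω) :=
    IsDiscrete.sum _ fun j => IsDiscrete.sum _ fun i => IsDiscrete.sum _ fun m =>
      (isDiscrete_phaseState hobs j).bind (X := fun s ω => slotSales n ε (obs ω) j s m i)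
        fun s => hobs _ _ _ _
  have hlast : IsDiscrete P fun ω => lastState F sel n ε (obs ω) := isDiscrete_phaseState hobs _
  have hl : IsDiscrete P fun ω => rateLow F sel n ε (obs ω) :=
    hlast.bind (X := fun s ω => Real.log n ^ ε * ∑ m, obs ω m (lastStart n ε)
      (lastStart n ε + testLength n ε) (s.pl m - alpha n ε)) fun s =>
      (IsDiscrete.sum _ fun m => hobs _ _ _ _).comp fun x => Real.log n ^ ε * x
  have hh : IsDiscrete P fun ω => rateHigh F sel n ε (obs ω) :=
    hlast.bind (X := fun s ω => Real.log n ^ ε * ∑ m, obs ω m (lastStart n ε + testLength n ε)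
      (lastStart n ε + 2 * testLength n ε) (s.pu m + alpha n ε)) fun s =>
      (IsDiscrete.sum _ fun m => hobs _ _ _ _).comp fun x => Real.log n ^ ε * x
  exact ((hS.prodMk hl).prodMk hh).comp fun x => max (lastStart n ε + 2 * testLength n ε)
    (min F.T (lastStart n ε + max 0 (min 1 ((n * F.c - x.1.1 - (F.T - lastStart n ε) * x.2) /
      ((F.T - lastStart n ε) * (x.1.2 - x.2)))) * (F.T - lastStart n ε) + testLength n ε))

/-- The whole price path is a function of the finitely many phase states and the switch time. Thus
measurability of revenues reduces to that for a deterministic path. -/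
theorem isDiscrete_policyPrice : IsDiscrete P fun ω => policyPrice F sel n ε (obs ω) := by
  have hV : IsDiscrete P fun ω =>
      ((fun j : Fin (numExplore n ε) => phaseState F sel n ε (obs ω) j),
        lastState F sel n ε (obs ω), switchTime F sel n ε (obs ω)) :=
    (IsDiscrete.pi (ι := Fin (numExplore n ε)) fun j => isDiscrete_phaseState hobs j).prodMk
      ((isDiscrete_phaseState hobs _).prodMk (isDiscrete_switchTime hobs))
  refine hV.of_factors (V := fun o : Fin M → ℝ → ℝ → ℝ → ℝ =>
    ((fun j : Fin (numExplore n ε) => phaseState F sel n ε o j),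
      lastState F sel n ε o, switchTime F sel n ε o)) fun o o' h => ?_
  simp only [Prod.mk.injEq] at h
  obtain ⟨h1, h2, h3⟩ := h
  funext m t
  rw [policyPrice, policyPrice]
  congr 1
  · refine Finset.sum_congr rfl fun j hj => Finset.sum_congr rfl fun i _ => ?_
    have : phaseState F sel n ε o j = phaseState F sel n ε o' j :=
      congrFun h1 ⟨j, Finset.mem_range.mp hj⟩
    rw [this]
  · simp only [lastPrice, lowPrice, highPrice, h2, h3]

end PersonalizedPricing

/-! ### Measurability of revenues and sales. -/

namespace PersonalizedPricing

section Restriction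

variable {Ω X : Type*} [MeasurableSpace Ω] [MeasurableSpace X]

/-- A random measure restricted to a set of finite measure is an s-finite kernel. -/
lemma exists_sFiniteKernel_restrict {N : Ω → Measure X} (hN : Measurable N) {U : Set X}
    (hU : MeasurableSet U) :
    ∃ κ : Kernel Ω X, IsSFiniteKernel κ ∧ ∀ ω, N ω U ≠ ∞ → κ ω = (N ω).restrict U := by
  classical
  have hNU : Measurable fun ω => N ω U := (Measure.measurable_coe hU).comp hN
  let R : Kernel Ω X := Kernel.restrict ⟨N, hN⟩ hU
  have hR : ∀ ω, R ω = (N ω).restrict U := fun ω => Kernel.restrict_apply ⟨N, hN⟩ hU ω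
  -- Sorting realizations by the integer part of the mass of `U` writes the restriction as a
  -- countable sum of finite kernels; where the mass is infinite the kernel is `0`.
  have hs : ∀ k : ℕ, MeasurableSet {ω | ⌊(N ω U).toReal⌋₊ = k ∧ N ω U ≠ ∞} := fun k =>
    ((Nat.measurable_floor.comp hNU.ennreal_toReal) (measurableSet_singleton k)).inter
      (hNU (measurableSet_singleton ∞)).compl
  let κ : ℕ → Kernel Ω X := fun k => Kernel.piecewise (hs k) R 0
  have hκ : ∀ k, IsFiniteKernel (κ k) := fun k => by
    refine ⟨⟨k + 1, by simp, fun ω => ?_⟩⟩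
    simp only [κ, Kernel.piecewise_apply]
    split_ifs with h
    · obtain ⟨h1, h2⟩ := h
      rw [hR, Measure.restrict_apply_univ, ← ENNReal.ofReal_toReal h2]
      have := Nat.lt_floor_add_one (N ω U).toReal
      rw [h1] at this
      calc ENNReal.ofReal (N ω U).toReal ≤ ENNReal.ofReal ((k : ℝ) + 1) :=
            ENNReal.ofReal_le_ofReal this.le
        _ = k + 1 := by
          rw [ENNReal.ofReal_add (by positivity) zero_le_one, ENNReal.ofReal_natCast,
            ENNReal.ofReal_one]
    · simp
  refine ⟨Kernel.sum κ, inferInstance, fun ω hω => ?_⟩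
  ext s hms
  rw [Kernel.sum_apply, Measure.sum_apply _ hms, tsum_eq_single ⌊(N ω U).toReal⌋₊, ← hR]
  · simp only [κ, Kernel.piecewise_apply]
    rw [if_pos ⟨rfl, hω⟩]
  · intro k hk
    simp only [κ, Kernel.piecewise_apply]
    rw [if_neg fun h => hk h.1.symm]
    simp

end Restriction

variable {M : ℕ} {Ω : Type*} [MeasurableSpace Ω] {P : Measure Ω}
  {N : Ω → Measure (Fin M × ℝ × ℝ)} {d : Fin M → ℝ → ℝ} {n : ℕ} {q : Fin M → ℝ → ℝ} {B T : ℝ}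

lemma setIntegral_eq_indicator {X : Type*} [MeasurableSpace X] {ν : Measure X} {A U : Set X}
    (hA : MeasurableSet A) (h : A ⊆ U) (f : X → ℝ) :
    ∫ x in A, f x ∂ν = ∫ x, A.indicator f x ∂(ν.restrict U) := by
  rw [integral_indicator hA, Measure.restrict_restrict hA, inter_eq_left.mpr h]

section Path

variable (hN : IsPoissonRandomMeasure P (unitIntensity M) N) (hq : ∀ m, IsStep (q m))
  (hB : ∀ m p, d m p ≤ B)
include hN

lemma IsPoissonRandomMeasure.ae_slab_ne_top : ∀ᵐ ω ∂P, N ω (slab M 0 T (n * B)) ≠ ∞ := by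
  have hU : unitIntensity M (slab M 0 T (n * B)) ≠ ∞ := by
    rw [unitIntensity_slab]
    exact ENNReal.mul_ne_top (by simp) (ENNReal.mul_ne_top (by simp) ENNReal.ofReal_ne_top)
  filter_upwards [hN.ae_natCast (measurableSet_slab _ _ _) hU] with ω ⟨k, hk⟩
  rw [hk]
  simp

lemma isDiscrete_observe (m : Fin M) (s t p : ℝ) :
    IsDiscrete P fun ω => observe d n (N ω) m s t p := by
  have hU : unitIntensity M (cell m s t (n * d m p)) ≠ ∞ := by
    rw [unitIntensity_cell]
    exact ENNReal.mul_ne_top ENNReal.ofReal_ne_top ENNReal.ofReal_ne_top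
  refine ⟨⟨range ((↑) : ℕ → ℝ), countable_range _, ?_⟩, fun y => ?_⟩
  · filter_upwards [hN.ae_natCast (measurableSet_cell _ _ _ _) hU] with ω ⟨k, hk⟩
    refine ⟨k, ?_⟩
    rw [observe]
    change _ = (N ω (cell m s t (n * d m p))).toReal
    rw [hk, ENNReal.toReal_natCast]
  · have : Measurable fun ω => observe d n (N ω) m s t p :=
      (hN.measurable_apply (measurableSet_cell m s t (n * d m p))).ennreal_toReal
    exact (this (measurableSet_singleton y)).nullMeasurableSet

include hq hB

lemma aemeasurable_pathValue (φ : ℝ → ℝ) :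
    AEMeasurable (fun ω => pathValue d n (N ω) q φ 0 T) P := by
  obtain ⟨κ, hκ, hκN⟩ := exists_sFiniteKernel_restrict hN.measurable
    (measurableSet_slab (M := M) 0 T (n * B))
  have hA := measurableSet_pathSales (d := d) (n := n) hq 0 T
  have hmeas : StronglyMeasurable fun ω => ∫ x,
      (pathSales d n q 0 T).indicator (fun x => φ (q x.1 x.2.1)) x ∂κ ω :=
    ((measurable_path hq φ).indicator hA).stronglyMeasurable.integral_kernel
  refine hmeas.measurable.aemeasurable.congr ?_
  filter_upwards [hN.ae_slab_ne_top (T := T) (n := n) (B := B)] with ω hω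
  rw [hκN ω hω, pathValue, setIntegral_eq_indicator hA (pathSales_subset_slab hB le_rfl le_rfl)]

/-- The domain of integration is itself random. The number of sales up to the time of a point is a
kernel mass of a section, hence jointly measurable in realization and point, so the integral becomes
that of a jointly measurable indicator function against a kernel. -/
lemma aemeasurable_covered (x₀ : ℝ) :
    AEMeasurable (fun ω => ∫ x in pathSales d n q 0 T ∩
      {x | pathValue d n (N ω) q (fun _ => 1) 0 x.2.1 ≤ x₀}, q x.1 x.2.1 ∂(N ω)) P := by
  obtain ⟨κ, hκ, hκN⟩ := exists_sFiniteKernel_restrict hN.measurable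
    (measurableSet_slab (M := M) 0 T (n * B))
  have hA := measurableSet_pathSales (d := d) (n := n) hq 0 T
  have hsub : pathSales d n q 0 T ⊆ slab M 0 T (n * B) := pathSales_subset_slab hB le_rfl le_rfl
  have htime : Measurable fun x : Fin M × ℝ × ℝ => x.2.1 := by fun_prop
  have hcount : Measurable fun z : Ω × (Fin M × ℝ × ℝ) =>
      κ z.1 (pathSales d n q 0 T ∩ {y | y.2.1 ≤ z.2.2.1}) := by
    have hset : MeasurableSet {w : (Ω × (Fin M × ℝ × ℝ)) × (Fin M × ℝ × ℝ) |
        w.2 ∈ pathSales d n q 0 T ∧ w.2.2.1 ≤ w.1.2.2.1} :=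
      (measurable_snd hA).inter (measurableSet_le (htime.comp measurable_snd)
        (htime.comp (measurable_snd.comp measurable_fst)))
    exact Kernel.measurable_kernel_prodMk_left
      (κ := Kernel.comap κ (Prod.fst : Ω × (Fin M × ℝ × ℝ) → Ω) measurable_fst) hset
  have hG : Measurable fun z : Ω × (Fin M × ℝ × ℝ) =>
      ({z : Ω × (Fin M × ℝ × ℝ) | z.2 ∈ pathSales d n q 0 T ∧
        (κ z.1 (pathSales d n q 0 T ∩ {y | y.2.1 ≤ z.2.2.1})).toReal ≤ x₀}).indicator
        (fun z => q z.2.1 z.2.2.1) z := by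
    refine Measurable.indicator ?_ ?_
    · exact (measurable_path hq fun p => p).comp measurable_snd
    · exact (measurable_snd hA).inter (measurableSet_le hcount.ennreal_toReal measurable_const)
  have hmeas := hG.stronglyMeasurable.integral_kernel_prod_right' (κ := κ)
  refine hmeas.measurable.aemeasurable.congr ?_
  filter_upwards [hN.ae_slab_ne_top (T := T) (n := n) (B := B)] with ω hω
  have hcount_eq : ∀ x ∈ pathSales d n q 0 T,
      (κ ω (pathSales d n q 0 T ∩ {y | y.2.1 ≤ x.2.1})).toReal
        = pathValue d n (N ω) q (fun _ => 1) 0 x.2.1 := by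
    intro x hx
    have hset : pathSales d n q 0 T ∩ {y | y.2.1 ≤ x.2.1} = pathSales d n q 0 x.2.1 := by
      ext y
      constructor
      · exact fun h => ⟨⟨h.1.1.1, h.2⟩, h.1.2⟩
      · exact fun h => ⟨⟨⟨h.1.1, h.1.2.trans hx.1.2⟩, h.2⟩, h.1.2⟩
    rw [hset, pathValue_one, hκN ω hω, Measure.restrict_apply (measurableSet_pathSales hq _ _),
      inter_eq_left.mpr ((pathSales_mono le_rfl hx.1.2).trans hsub)]
    rfl
  have hD : MeasurableSet (pathSales d n q 0 T ∩
      {x | pathValue d n (N ω) q (fun _ => 1) 0 x.2.1 ≤ x₀}) :=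
    -- Only the season length of the `FirmInfo` matters here.
    measurableSet_covered (F := ⟨T, 0, 0, 0, 0⟩) hB hω hq x₀
  rw [setIntegral_eq_indicator hD (inter_subset_left.trans hsub), hκN ω hω]
  congr 1
  funext x
  classical
  by_cases hx : x ∈ pathSales d n q 0 T
  · simp only [indicator_apply, mem_ofPred_eq, mem_inter_iff, hx, true_and, hcount_eq x hx]
  · simp only [indicator_apply, mem_ofPred_eq, mem_inter_iff, hx, false_and, if_false]

end Path

variable {F : FirmInfo} {sel : Finset ℕ → ℕ} {ε : ℝ}
  (hN : IsPoissonRandomMeasure P (unitIntensity M) N) (hB : ∀ m p, d m p ≤ B)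
include hN

lemma isDiscrete_pricePath : IsDiscrete P fun ω => pricePath F d sel n ε (N ω) :=
  isDiscrete_policyPrice (isDiscrete_observe hN)

include hB

lemma aemeasurable_grossRevenue : AEMeasurable (fun ω => grossRevenue F d sel n ε (N ω)) P := by
  simp only [grossRevenue_eq]
  exact (isDiscrete_pricePath hN).aemeasurable
    (X := fun q ω => pathValue d n (N ω) q (fun p => p) 0 F.T) fun ω =>
      aemeasurable_pathValue hN (fun m => isStep_pricePath m) hB _

lemma aemeasurable_cumSales : AEMeasurable (fun ω => cumSales F d sel n ε (N ω) F.T) P := by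
  simp only [cumSales_eq]
  exact (isDiscrete_pricePath hN).aemeasurable
    (X := fun q ω => pathValue d n (N ω) q (fun _ => 1) 0 F.T) fun ω =>
      aemeasurable_pathValue hN (fun m => isStep_pricePath m) hB _

lemma aemeasurable_constrainedRevenue :
    AEMeasurable (fun ω => constrainedRevenue F d sel n ε (N ω)) P := by
  simp only [constrainedRevenue_eq]
  exact (isDiscrete_pricePath hN).aemeasurable
    (X := fun q ω => ∫ x in pathSales d n q 0 F.T ∩
      {x | pathValue d n (N ω) q (fun _ => 1) 0 x.2.1 ≤ n * F.c}, q x.1 x.2.1 ∂(N ω)) fun ω =>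
      aemeasurable_covered hN (fun m => isStep_pricePath m) hB _

end PersonalizedPricing

/-! ### Expectations, including the contribution of the bad event. -/

namespace PersonalizedPricing

variable {Ω : Type*} [MeasurableSpace Ω] {P : Measure Ω}

/-- An expectation is close to `x₀` if the random variable is close to `x₀` outside of an event of
small probability and dominated by a square integrable random variable. -/
lemma abs_integral_sub_le [IsProbabilityMeasure P] {X Y : Ω → ℝ} {S : Set Ω} {x₀ e c r : ℝ}
    (hX : AEMeasurable X P) (hY : Integrable (fun ω => Y ω ^ 2) P)
    (hXY : ∀ᵐ ω ∂P, |X ω| ≤ c * Y ω) (hS : MeasurableSet S)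
    (hgood : ∀ᵐ ω ∂P, ω ∉ S → |X ω - x₀| ≤ e) (hc : 0 ≤ c) (he : 0 ≤ e) (hr : 0 < r) :
    |∫ ω, X ω ∂P - x₀| ≤ e + c / r * ∫ ω, Y ω ^ 2 ∂P + (c * r + |x₀|) * P.real S := by
  -- On the bad event `|X| ≤ c Y` is split by this inequality into a multiple of `Y²` and a
  -- constant. With a suitable `r` this replaces the Cauchy–Schwarz inequality.
  have hYr : ∀ y : ℝ, y ≤ y ^ 2 / r + r := fun y => by
    rw [div_add' _ _ _ hr.ne', le_div_iff₀ hr]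
    nlinarith [sq_nonneg (y - r), sq_nonneg (y + r)]
  have hbound : ∀ᵐ ω ∂P, |X ω - x₀|
      ≤ e + c / r * Y ω ^ 2 + S.indicator (fun _ => c * r + |x₀|) ω := by
    filter_upwards [hXY, hgood] with ω h1 h2
    have h3 : 0 ≤ c / r * Y ω ^ 2 := by positivity
    by_cases hω : ω ∈ S
    · rw [indicator_of_mem hω]
      have h4 := mul_le_mul_of_nonneg_left (hYr (Y ω)) hc
      have h5 : c * (Y ω ^ 2 / r + r) = c / r * Y ω ^ 2 + c * r := by ring
      linarith [abs_sub (X ω) x₀]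
    · rw [indicator_of_notMem hω]
      linarith [h2 hω]
  have hint1 : Integrable (fun ω => e + c / r * Y ω ^ 2) P :=
    (integrable_const e).add (hY.const_mul _)
  have hint2 : Integrable (S.indicator fun _ => c * r + |x₀|) P :=
    (integrable_const _).indicator hS
  have hdom := hint1.add hint2
  have hXint : Integrable (fun ω => X ω - x₀) P :=
    hdom.mono' (hX.sub_const x₀).aestronglyMeasurable (by simpa using hbound)
  have hX' : Integrable X P := 
    (hXint.add (integrable_const x₀)).congr (ae_of_all _ fun ω => by simp)
  have h0 : ∫ ω, X ω ∂P - x₀ = ∫ ω, (X ω - x₀) ∂P := by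
    rw [integral_sub hX' (integrable_const x₀)]
    simp
  rw [h0]
  calc |∫ ω, (X ω - x₀) ∂P| ≤ ∫ ω, |X ω - x₀| ∂P := abs_integral_le_integral_abs
    _ ≤ ∫ ω, ((e + c / r * Y ω ^ 2) + S.indicator (fun _ => c * r + |x₀|) ω) ∂P :=
      integral_mono_ae hXint.abs hdom hbound
    _ = _ := by
      rw [integral_add hint1 hint2, integral_add (integrable_const e) (hY.const_mul _),
        integral_const_mul, integral_indicator_const _ hS]
      simp [mul_comm]

variable {M : ℕ} {F : FirmInfo} {d : Fin M → ℝ → ℝ} {pInf zS : ℝ} {pS : Fin M → ℝ} {a b l B : ℝ}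
  {sel : Finset ℕ → ℕ} {N : Ω → Measure (Fin M × ℝ × ℝ)}

/-- The expected revenues and the expected excess demand of the algorithm. -/
theorem MarketBounds.exists_expected_values [IsProbabilityMeasure P]
    (h : MarketBounds F d pInf zS pS a b l B)
    (hN : IsPoissonRandomMeasure P (unitIntensity M) N)
    (hsel : ∀ s : Finset ℕ, s.Nonempty → sel s ∈ s) {ε : ℝ} (hε : 0 < ε) :
    ∃ A : ℝ, ∀ᶠ n : ℕ in atTop,
      |∫ ω, grossRevenue F d sel n ε (N ω) ∂P - n * fluidRevenue F d pS|
        ≤ A * (quarter n ^ 2 * Real.log n ^ 2 * logPow n ε ^ 18) ∧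
      |∫ ω, max (cumSales F d sel n ε (N ω) F.T - n * F.c) 0 ∂P|
        ≤ A * (quarter n ^ 2 * Real.log n ^ 2 * logPow n ε ^ 18) ∧
      |∫ ω, constrainedRevenue F d sel n ε (N ω) ∂P - n * fluidRevenue F d pS|
        ≤ A * (quarter n ^ 2 * Real.log n ^ 2 * logPow n ε ^ 18) := by
  obtain ⟨C, C', hC, hC', hevent⟩ := hN.exists_goodEvent h.T_pos h.B_pos
  obtain ⟨G, K, hK, hpath⟩ := h.exists_goodPath hsel hC
  have hT := h.T_pos
  have hB := h.B_pos
  have hz := h.z_pos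
  have hpS := h.pS_mem ⟨0, h.M_pos⟩
  have hpLo := h.pLo_nonneg
  have hpHi : 0 ≤ F.pHi := by linarith [hpS.1, hpS.2]
  have hpInf : 0 ≤ pInf := hpHi.trans h.pHi_le
  have hzHi : 0 ≤ F.zHi := by linarith [h.z_lt]
  set c := F.pHi + 1 with hcdef
  have hc1 : 1 ≤ c := by linarith
  set J := fluidRevenue F d pS
  set E₀ := (1 + zS) * K + pInf * (K + M * (F.T * B + C * (F.T + 2))) with hE₀
  set A₀ := c * (2 * Real.exp (2 * (M * (F.T * B)))) + (c + |J|) * C' with hA₀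
  have hA₀0 : 0 ≤ A₀ := by positivity
  refine ⟨E₀ + A₀, ?_⟩
  filter_upwards [eventually_isLarge hε (|G| + 1 + 3 / F.T)] with n hlarge
  have hT3 : 0 ≤ 3 / F.T := by positivity
  have hlargeG : IsLarge n ε G := hlarge.mono (by linarith [le_abs_self G])
  have hlarge1 : IsLarge n ε 1 := hlarge.mono (by linarith [abs_nonneg G])
  have hn := hlarge.three_le
  have hn1 : (1 : ℝ) ≤ n := by exact_mod_cast (by omega : 1 ≤ n)
  have hn0 : (0 : ℝ) < n := by linarith
  have hTend := lastStart_add_le (F := F) hε hT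
    (hlarge.mono (by linarith [abs_nonneg G]))
  have hv := one_le_quarter hn
  have hL := one_le_log hn
  have hg := one_le_logPow hn hε
  obtain ⟨S, hS, hPS, hgood⟩ := hevent n hn
  obtain ⟨hY, hY2⟩ := hN.integral_sq_slab_le h.T_pos h.B_pos (show 1 ≤ n by omega)
  set R := quarter n ^ 2 * Real.log n ^ 2 * logPow n ε ^ 18 with hR
  have hvL : quarter n ^ 2 * Real.log n ≤ R := by
    have h1 : Real.log n ≤ Real.log n ^ 2 := le_self_pow₀ hL (by norm_num)
    have h2 : (1 : ℝ) ≤ logPow n ε ^ 18 := one_le_pow₀ hg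
    calc quarter n ^ 2 * Real.log n ≤ quarter n ^ 2 * Real.log n ^ 2 := by gcongr
      _ ≤ R := le_mul_of_one_le_right (by positivity) h2
  have hR1 : 1 ≤ R := (one_le_mul_of_one_le_of_one_le (one_le_pow₀ hv) hL).trans hvL
  have hR0 : 0 ≤ R := by linarith
  have hfin := hN.ae_slab_ne_top (T := F.T) (n := n) (B := B)
  have hprice : ∀ ω m t, |pricePath F d sel n ε (N ω) m t| ≤ c := fun ω m t =>
    abs_policyPrice_le hsel hlarge1 hε hpLo (by linarith [hpS.1, hpS.2]) hzHi m t
  have hvals : ∀ ω ∉ S, _ := fun ω hω => (hpath n ε _ hε hlargeG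
    ((hgood ω hω).goodObs h.nonneg h.le_B)).values h hC hn hε hTend (hgood ω hω)
  -- The choice `r = n²`: the second moment of the total count is `O(n²)` and the bad event has
  -- probability `O(n⁻²)`, so both terms are bounded.
  have hrest : ∀ x₀ : ℝ, |x₀| ≤ n * |J| → c / (n : ℝ) ^ 2
        * ∫ ω, (N ω (slab M 0 F.T (n * B))).toReal ^ 2 ∂P
      + (c * (n : ℝ) ^ 2 + |x₀|) * P.real S ≤ A₀ * R := by
    intro x₀ hx₀
    have h1 : c / (n : ℝ) ^ 2 * ∫ ω, (N ω (slab M 0 F.T (n * B))).toReal ^ 2 ∂P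
        ≤ c * (2 * Real.exp (2 * (M * (F.T * B)))) := by
      calc _ ≤ c / (n : ℝ) ^ 2 * (2 * n ^ 2 * Real.exp (2 * (M * (F.T * B)))) := by gcongr
        _ = _ := by field_simp
    have h2 : (c * (n : ℝ) ^ 2 + |x₀|) * P.real S ≤ (c + |J|) * C' := by
      have h3 : (n : ℝ) ≤ n ^ 2 := le_self_pow₀ hn1 (by norm_num)
      have h4 : |x₀| ≤ n ^ 2 * |J| := hx₀.trans (by gcongr)
      calc _ ≤ (c * (n : ℝ) ^ 2 + n ^ 2 * |J|) * (C' / (n : ℝ) ^ 2) := by gcongr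
        _ = _ := by field_simp
    calc _ ≤ A₀ := by rw [hA₀]; linarith
      _ ≤ A₀ * R := le_mul_of_one_le_right hA₀0 hR1
  have hmain : ∀ (X : Ω → ℝ) (x₀ e : ℝ), AEMeasurable X P →
      (∀ᵐ ω ∂P, |X ω| ≤ c * (N ω (slab M 0 F.T (n * B))).toReal) →
      (∀ ω ∉ S, |X ω - x₀| ≤ e) → 0 ≤ e → e ≤ E₀ * R → |x₀| ≤ n * |J| →
      |∫ ω, X ω ∂P - x₀| ≤ (E₀ + A₀) * R := by
    intro X x₀ e hX hXY hXe he heE hx₀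
    have := abs_integral_sub_le hX hY hXY hS (ae_of_all _ hXe) (by linarith) he
      (by positivity : (0 : ℝ) < n ^ 2)
    linarith [hrest x₀ hx₀, add_mul E₀ A₀ R]
  have hnJ : |n * J| ≤ n * |J| := by rw [abs_mul, abs_of_pos hn0]
  have hM0 : 0 ≤ M * (F.T * B + C * (F.T + 2)) := by positivity
  have hE1 : (1 + zS) * (K * R) ≤ E₀ * R := by
    have : 0 ≤ pInf * (K + M * (F.T * B + C * (F.T + 2))) * R := by positivity
    rw [hE₀]; linarith
  have hE2 : K * R ≤ E₀ * R := by
    refine le_trans ?_ hE1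
    have : 0 ≤ zS * (K * R) := by positivity
    linarith
  refine ⟨?_, ?_, ?_⟩
  · refine hmain _ _ _ (aemeasurable_grossRevenue hN h.le_B) ?_ (fun ω hω => (hvals ω hω).2.1)
      (by positivity) hE1 hnJ
    filter_upwards [hfin] with ω hω
    exact abs_grossRevenue_le h.le_B hω (by linarith) (hprice ω)
  -- The excess demand is compared with `0`: on the good event sales exceed `n c` by at most `K R`.
  · have := hmain (fun ω => max (cumSales F d sel n ε (N ω) F.T - n * F.c) 0) 0 (K * R)
      (((aemeasurable_cumSales hN h.le_B).sub_const _).max aemeasurable_const) ?_ ?_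
      (by positivity) hE2 (by rw [abs_zero]; positivity)
    · simpa using this
    · filter_upwards [hfin] with ω hω
      have h1 : cumSales F d sel n ε (N ω) F.T ≤ (N ω (slab M 0 F.T (n * B))).toReal := by
        rw [cumSales_eq]
        exact pathValue_one_le h.le_B hω le_rfl le_rfl
      have h2 : 0 ≤ (N ω (slab M 0 F.T (n * B))).toReal := ENNReal.toReal_nonneg
      have h3 : 0 ≤ n * F.c := by
        rw [h.slack]
        exact mul_nonneg hn0.le (mul_nonneg hT.le (Finset.sum_nonneg fun m _ => h.nonneg m _))
      rw [abs_of_nonneg (le_max_right _ _)]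
      refine max_le ?_ (by positivity)
      nlinarith
    · intro ω hω
      have := (hvals ω hω).1
      rw [sub_zero, abs_of_nonneg (le_max_right _ _)]
      exact max_le ((le_abs_self _).trans this) (by positivity)
  · refine hmain _ _ _ (aemeasurable_constrainedRevenue hN h.le_B) ?_
      (fun ω hω => (hvals ω hω).2.2) (by positivity) ?_ hnJ
    · filter_upwards [hfin] with ω hω
      exact abs_constrainedRevenue_le h.le_B hω (by linarith) (hprice ω)
    · have : pInf * (M * (F.T * B + C * (F.T + 2)) * (quarter n ^ 2 * Real.log n))
          ≤ pInf * (M * (F.T * B + C * (F.T + 2)) * R) := by gcongr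
      rw [hE₀]
      linarith

end PersonalizedPricing

open PersonalizedPricing in
theorem mainTheorem3 {M : ℕ} (hM : 0 < M)
    (F : FirmInfo) (hT : 0 < F.T) (hc : 0 < F.c)
    (d : Fin M → ℝ → ℝ) (pInf M₁ : ℝ) (M₂ : ℝ≥0) (M₃ M₄ : ℝ)
    (hd : RegularDemand d pInf M₁ M₂ M₃ M₄)
    (zStar : ℝ) (hz : IsDualOptimal d pInf F.T F.c zStar)
    (hF : InitialRanges F d pInf zStar)
    (hpos : 0 < zStar)
    (ε : ℝ) (hε : 0 < ε)
    (sel : Finset ℕ → ℕ) (hsel : ∀ s : Finset ℕ, s.Nonempty → sel s ∈ s)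
    {Ω : Type*} [MeasurableSpace Ω] (P : Measure Ω) [IsProbabilityMeasure P]
    (N : Ω → Measure (Fin M × ℝ × ℝ))
    (hN : IsPoissonRandomMeasure P (unitIntensity M) N) :
    ((fun n : ℕ => scaledFluidValue d pInf F.T F.c n - modifiedValue F d sel ε P N n)
      =O[atTop] fun n : ℕ => Real.log n ^ (2 + 18 * ε) * (n : ℝ) ^ (1 / 2 : ℝ)) ∧
    ((fun n : ℕ => regret F d pInf sel ε P N n)
      =O[atTop] fun n : ℕ => Real.log n ^ (2 + 18 * ε) * (n : ℝ) ^ (-(1 / 2) : ℝ)) := by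
  obtain ⟨pS, a, b, l, B, h⟩ := exists_marketBounds hM hT hd hc hz hF hpos
  have hfluid := h.scaledFluidValue_eq fun m => (hd.lipschitz_demand m).continuousOn
  have hJ := h.fluidRevenue_pos
  have hpHi : 0 ≤ F.pHi := by
    have := h.pS_mem ⟨0, hM⟩
    linarith [this.1, this.2, h.pLo_nonneg]
  obtain ⟨A, hA⟩ := h.exists_expected_values hN hsel hε
  constructor
  · refine IsBigO.of_bound (A + F.pHi * A) ?_
    filter_upwards [hA, eventually_ge_atTop 3] with n ⟨h1, h2, _⟩ hn
    rw [rate_eq hn, hfluid, modifiedValue]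
    have hv := one_le_quarter hn
    have hL := one_le_log hn
    have hg := one_le_logPow hn hε
    have hR : 0 ≤ quarter n ^ 2 * Real.log n ^ 2 * logPow n ε ^ 18 := by positivity
    rw [Real.norm_eq_abs, Real.norm_eq_abs, abs_of_nonneg hR]
    have h3 := abs_le.mp h1
    have h4 := abs_le.mp h2
    have h5 := mul_le_mul_of_nonneg_left h4.1 hpHi
    have h6 := mul_le_mul_of_nonneg_left h4.2 hpHi
    rw [abs_le]
    constructor <;> linarith [h3.1, h3.2]
  · refine IsBigO.of_bound (A / fluidRevenue F d pS) ?_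
    filter_upwards [hA, eventually_ge_atTop 3] with n ⟨_, _, h3⟩ hn
    have hn0 : (0 : ℝ) < n := by positivity
    have hrate : Real.log n ^ (2 + 18 * ε) * (n : ℝ) ^ (-(1 / 2) : ℝ)
        = quarter n ^ 2 * Real.log n ^ 2 * logPow n ε ^ 18 / n := by
      rw [← rate_eq hn, show (-(1 / 2) : ℝ) = 1 / 2 - 1 by norm_num, Real.rpow_sub_one hn0.ne']
      ring
    have hv := one_le_quarter hn
    have hL := one_le_log hn
    have hg := one_le_logPow hn hε
    have hR : 0 ≤ quarter n ^ 2 * Real.log n ^ 2 * logPow n ε ^ 18 / n := by positivity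
    rw [hrate, regret, policyValue, hfluid, Real.norm_eq_abs, Real.norm_eq_abs, abs_of_nonneg hR]
    have hnJ : 0 < n * fluidRevenue F d pS := by positivity
    -- Dividing the absolute bound for the constrained revenue by the fluid value, which is `n`
    -- times a positive constant, turns `√n` into `n ^ (-1 / 2)`.
    rw [one_sub_div hnJ.ne', abs_div, abs_of_pos hnJ, abs_sub_comm]
    calc _ ≤ A * (quarter n ^ 2 * Real.log n ^ 2 * logPow n ε ^ 18) / (n * fluidRevenue F d pS) := by
          gcongr
      _ = _ := by field_simp
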